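/- For a natural number $q$, write $L(s,\chi)$ for the Dirichlet $L$-function of a Dirichlet character $\chi$ modulo $q$ and $\psi(x;q,a)=\sum_{n\le x,\ n\equiv a\,(\mathrm{mod}\ q)}\Lambda(n)$, where $\Lambda$ is the von Mangoldt function; $\varphi$ is Euler's totient function. Let $W(u)=4/(4+u^2)$, and for Dirichlet characters $\chi_1,\chi_2$ modulo $q$ put $$G_{\chi_1,\chi_2}(x,T)=\sum_{\substack{|\gamma_j|\le T,\ j=1,2\\ L(1/2+i\gamma_j,\chi_j)=0}}x^{i(\gamma_1-\gamma_2)}\,W(\gamma_1-\gamma_2),$$ zeros being counted with multiplicity, and for $(a,q)=1$ put $$F_q(x,T)=F_{q,a}(x,T)=\sum_{\chi_1,\chi_2\,(\mathrm{mod}\ q)}\overline{\chi_1}(a)\,\chi_2(a)\,G_{\chi_1,\chi_2}(x,T).$$ Assume the following two hypotheses. 1. (GRH) For every $q\ge1$ and every Dirichlet character $\chi$ modulo $q$, all zeros of $L(s,\chi)$ with $0<\operatorname{Re}s<1$ satisfy $\operatorname{Re}s=1/2$. 2. (Pair correlation conjecture) Under GRH, for every fixed $\varepsilon>0$ one has,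 as $x\to\infty$, $F_{q,a}(x,T)\ll_\varepsilon\varphi(q)\,T\,x^{\varepsilon}$ uniformly for $1\le q\le x^{1-\varepsilon}$, $x^{\varepsilon}\le T<x$ and all $a$ coprime to $q$. Then for every $\varepsilon>0$ and all sufficiently large $x$ (in terms of $\varepsilon$), $$\sum_{q\le x^{1-4\varepsilon}}\ \max_{(a,q)=1}\Bigl|\psi(x;q,a)-\frac{x}{\varphi(q)}\Bigr|\ll_\varepsilon x^{1-\varepsilon}.$$ -/

import Mathlib

namespace PairCorrelation

/-- The Generalized Riemann Hypothesis for Dirichlet `L`-functions: for every modulus `q ≥ 1`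
and every Dirichlet character `χ` mod `q` (primitive or not, the case `q = 1` being the Riemann
zeta function), every zero of `L(s, χ)` in the open strip `0 < Re s < 1` has real part `1 / 2`. -/
def GRH : Prop :=
  ∀ (q : ℕ) [NeZero q] (χ : DirichletCharacter ℂ q) (s : ℂ),
    0 < s.re → s.re < 1 → DirichletCharacter.LFunction χ s = 0 → s.re = 1 / 2

/-- `ψ(x; q, a)`, the sum of `Λ(n)` over `n ≤ x` with `n ≡ a (mod q)`. -/
noncomputable def psi (x : ℝ) (q : ℕ) (a : ZMod q) : ℝ :=
  ∑ n ∈ (Finset.Icc 1 ⌊x⌋₊).filter (fun n : ℕ => (n : ZMod q) = a),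
    ArithmeticFunction.vonMangoldt n

/-- The point `1/2 + iγ` of the critical line. -/
noncomputable def critPoint (γ : ℝ) : ℂ := 1 / 2 + Complex.I * (γ : ℂ)

theorem critPoint_ne_one (γ : ℝ) : critPoint γ ≠ 1 := by
  intro h
  have := congrArg Complex.re h
  norm_num [critPoint] at this

/-- The real numbers `γ` with `|γ| ≤ T` and `L(1/2 + iγ, χ) = 0`. -/
def ordinates {q : ℕ} [NeZero q] (χ : DirichletCharacter ℂ q) (T : ℝ) : Set ℝ :=
  {γ : ℝ | |γ| ≤ T ∧ DirichletCharacter.LFunction χ (critPoint γ) = 0}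

theorem ordinates_finite {q : ℕ} [NeZero q] (χ : DirichletCharacter ℂ q) (T : ℝ) :
    (ordinates χ T).Finite := by
  by_contra hinf
  have hsub : ordinates χ T ⊆ Set.Icc (-T) T := fun γ hγ => abs_le.mp hγ.1
  obtain ⟨t, -, ht⟩ := Set.Infinite.exists_accPt_of_subset_isCompact hinf isCompact_Icc hsub
  have hcont : Continuous critPoint := by unfold critPoint; fun_prop
  have hinj : Function.Injective critPoint := by
    intro u v huv
    have := congrArg Complex.im huv
    simpa [critPoint] using this
  have htend : Filter.Tendsto critPoint (nhdsWithin t {t}ᶜ)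
      (nhdsWithin (critPoint t) {critPoint t}ᶜ) :=
    hcont.continuousAt.continuousWithinAt.tendsto_nhdsWithin (fun u hu h => hu (hinj h))
  have hfreq : ∃ᶠ s in nhdsWithin (critPoint t) {critPoint t}ᶜ,
      DirichletCharacter.LFunction χ s = 0 := by
    have h1 : ∃ᶠ u in nhdsWithin t {t}ᶜ, u ∈ ordinates χ T :=
      accPt_iff_frequently_nhdsNE.mp ht
    exact htend.frequently (h1.mono fun u hu => hu.2)
  have han : AnalyticOnNhd ℂ (DirichletCharacter.LFunction χ) {1}ᶜ :=
    DifferentiableOn.analyticOnNhd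
      (fun s hs => (DirichletCharacter.differentiableAt_LFunction χ s
        (Or.inl hs)).differentiableWithinAt) isOpen_compl_singleton
  have hpre : IsPreconnected ({1}ᶜ : Set ℂ) :=
    (isConnected_compl_singleton_of_one_lt_rank (by simp) 1).isPreconnected
  have hzero := han.eqOn_zero_of_preconnected_of_frequently_eq_zero hpre
    (critPoint_ne_one t) hfreq
  exact DirichletCharacter.LFunction_ne_zero_of_one_le_re (s := 2) χ
    (Or.inr (by norm_num)) (by norm_num) (hzero (by norm_num))

/-- The multiplicity of `1/2 + iγ` as a zero of `L(s, χ)`. -/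
noncomputable def mult {q : ℕ} [NeZero q] (χ : DirichletCharacter ℂ q) (γ : ℝ) : ℕ :=
  analyticOrderNatAt (DirichletCharacter.LFunction χ) (critPoint γ)

/-- The weight `W(u) = 4 / (4 + u²)`. -/
noncomputable def W (u : ℝ) : ℝ := 4 / (4 + u ^ 2)

/-- `G_{χ₁,χ₂}(x, T)`, the sum of `x^{i(γ₁ - γ₂)} W(γ₁ - γ₂)` over the ordinates
`|γ₁|, |γ₂| ≤ T` of the zeros on the critical line of `L(s, χ₁)` and `L(s, χ₂)`, each zero
being repeated according to its multiplicity. -/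
noncomputable def G {q : ℕ} [NeZero q] (χ₁ χ₂ : DirichletCharacter ℂ q) (x T : ℝ) : ℂ :=
  ∑ γ₁ ∈ (ordinates_finite χ₁ T).toFinset, ∑ γ₂ ∈ (ordinates_finite χ₂ T).toFinset,
    (mult χ₁ γ₁ : ℂ) * (mult χ₂ γ₂ : ℂ) *
      ((x : ℂ) ^ (Complex.I * ((γ₁ - γ₂ : ℝ) : ℂ)) * (W (γ₁ - γ₂) : ℂ))

/-- `F_q(x, T)`, the sum of `conj χ₁(a) χ₂(a) G_{χ₁,χ₂}(x, T)` over all pairs of Dirichlet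
characters mod `q`; the dependence on the residue class `a` is kept explicit. -/
noncomputable def F (q : ℕ) [NeZero q] (a : (ZMod q)ˣ) (x T : ℝ) : ℂ :=
  ∑ χ₁ : DirichletCharacter ℂ q, ∑ χ₂ : DirichletCharacter ℂ q,
    (starRingEnd ℂ) (χ₁ (a : ZMod q)) * χ₂ (a : ZMod q) * G χ₁ χ₂ x T

/-- The pair correlation conjecture for Dirichlet `L`-functions: under GRH, for every fixed
`ε > 0`, as `x → ∞`, `F_q(x, T) ≪ φ(q) T x^ε` uniformly for `1 ≤ q ≤ x^{1-ε}`,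
`x^ε ≤ T < x` and `a` coprime to `q`. -/
def PairCorrelationConjecture : Prop :=
  GRH → ∀ ε : ℝ, 0 < ε → ∃ C x₀ : ℝ, ∀ x : ℝ, x₀ ≤ x →
    ∀ (q : ℕ) [NeZero q] (a : (ZMod q)ˣ) (T : ℝ),
      (q : ℝ) ≤ x ^ (1 - ε) → x ^ ε ≤ T → T < x →
        ‖F q a x T‖ ≤ C * ((Nat.totient q : ℝ) * T * x ^ ε)

/-- The maximum of `|ψ(x; q, a) - x / φ(q)|` over the reduced residue classes `a` mod `q`
(a supremum over a finite non-empty set when `q ≥ 1`). -/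
noncomputable def maxError (x : ℝ) (q : ℕ) : ℝ :=
  ⨆ a : (ZMod q)ˣ, |psi x q (a : ZMod q) - x / (Nat.totient q : ℝ)|

end PairCorrelation

/-!
The sum over zeros `S_a(r) = Σ_χ χ̄(a) Σ_{|γ| ≤ T} e^{iγr}` governs the primes `n ≡ a (mod q)` with
`log n` near `r`. Since `W` is the Fourier transform of `e^{-2|u|}`, the form factor is a mean
square, `F_q(x, T) = ∫ |S_a(r)|² e^{-2|r - log x|} dr` (`F_eq_integral`), so the pair correlation
conjecture says that `S_a` has square-root cancellation in mean square over the `φ(q)` characters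
and over the zeros at once. This is what yields a saving uniform in `a`, and the moduli go beyond
`√x` because the bound has `φ(q)`, not `φ(q)²`.

The mean square is fed into an explicit formula for a window `(X, eX]`. The weight of the primes is
a Gaussian of width `δ` in `log n`, integrated over the window; its Laplace transform decays like
`e^{δ²s²/2}`, so zeros above height `T` with `δT` large are never seen. The formula is obtained by
shifting a contour from `Re s = 2` to a line `Re s = 4c` close to `0`. No functional equation is
used: under GRH, dividing `L(s, χ)` by the polynomial of its zeros up to height `T` leaves a
function whose logarithmic derivative is `O(T log X)` in the strip, by Jensen's inequality and the
Borel–Carathéodory theorem in discs centred on `Re s = 2` (`exists_factor_norm_logDeriv_le`), the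
growth of `L(s, χ)` on `Re s > 0` coming from partial summation (`norm_entireL_le`). This gives
`exists_smoothed_explicit_formula`, whose remainder is a small power of `X` times `T / δ`.

In the window the zeros contribute `√(A X) / φ(q)` when `F_q(X, T) ≤ A`, by the arithmetic-geometric
mean inequality (`norm_integral_zeroSum_mul_windowKernel_le`), and the passage from the smooth to
the sharp window costs the number of `n ≡ a (mod q)` within a factor `e^{±O(δ log X)}` of its
endpoints (`abs_tsum_residueClass_mul_windowKernel_sub_le`). With `T = x^{1.4ε}` and
`δ = x^{-1.2ε}`, windows are added down to `x^{1 - 1.5ε}`, below which primes are counted trivially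
(`exists_abs_psi_sub_div_totient_le`). The sum over `q ≤ x^{1-4ε}` uses only
`φ(q) ≫ q / log q`. For `ε > 1/4` no modulus is left once `x > 1`.
-/

namespace PairCorrelation

open Complex Metric Set

/-! ### Logarithmic derivatives of holomorphic functions in discs -/

/-- A holomorphic function is the product of a polynomial vanishing at a prescribed finite set of
points to the order of the function there, and of a holomorphic function that does not vanish at
these points. -/
theorem exists_eq_prod_sub_pow_mul {U : Set ℂ} (hU : IsOpen U) {f : ℂ → ℂ}
    (hf : DifferentiableOn ℂ f U) (Z : Finset ℂ) (hZ : ∀ ρ ∈ Z, ρ ∈ U)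
    (hord : ∀ ρ ∈ Z, analyticOrderAt f ρ ≠ ⊤) :
    ∃ h : ℂ → ℂ, DifferentiableOn ℂ h U ∧
      (∀ s ∈ U, f s = (∏ ρ ∈ Z, (s - ρ) ^ analyticOrderNatAt f ρ) * h s) ∧
      ∀ ρ ∈ Z, h ρ ≠ 0 := by
  classical
  induction Z using Finset.induction_on with
  | empty => exact ⟨f, hf, by simp, by simp⟩
  | insert ρ Z hρ ih =>
    obtain ⟨h, hh, hfac, hne⟩ := ih (fun r hr => hZ r (Finset.mem_insert_of_mem hr))
      (fun r hr => hord r (Finset.mem_insert_of_mem hr))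
    have hρU : ρ ∈ U := hZ ρ (Finset.mem_insert_self _ _)
    have hρn : U ∈ nhds ρ := hU.mem_nhds hρU
    have hha : AnalyticAt ℂ h ρ := hh.analyticAt hρn
    set P : ℂ → ℂ := fun s => ∏ r ∈ Z, (s - r) ^ analyticOrderNatAt f r with hP
    have hPa : AnalyticAt ℂ P ρ := by
      have : Differentiable ℂ P := by simp only [hP]; fun_prop
      exact this.analyticAt ρ
    have hP0 : P ρ ≠ 0 := by
      simp only [hP]
      refine Finset.prod_ne_zero_iff.mpr fun r hr => pow_ne_zero _ (sub_ne_zero.mpr ?_)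
      rintro rfl; exact hρ hr
    have hev : f =ᶠ[nhds ρ] P * h := by
      filter_upwards [hρn] with s hs using hfac s hs
    have hordeq : analyticOrderAt h ρ = analyticOrderAt f ρ := by
      rw [analyticOrderAt_congr hev, analyticOrderAt_mul hPa hha,
        hPa.analyticOrderAt_eq_zero.mpr hP0, zero_add]
    have htop : analyticOrderAt h ρ ≠ ⊤ := by
      rw [hordeq]; exact hord ρ (Finset.mem_insert_self _ _)
    obtain ⟨g, hg, hg0, hgev⟩ := hha.analyticOrderAt_ne_top.mp htop
    have hnat : analyticOrderNatAt h ρ = analyticOrderNatAt f ρ := by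
      simp [analyticOrderNatAt, hordeq]
    rw [hnat] at hgev
    set m := analyticOrderNatAt f ρ with hm
    set h1 : ℂ → ℂ := Function.update (fun s => h s / (s - ρ) ^ m) ρ (g ρ) with hh1
    have h1ne : ∀ s, s ≠ ρ → h1 s = h s / (s - ρ) ^ m := fun s hs => by
      simp [hh1, Function.update_of_ne hs]
    have h1ρ : h1 ρ = g ρ := by simp [hh1]
    have h1mul : ∀ s ∈ U, h s = (s - ρ) ^ m * h1 s := by
      intro s _
      by_cases hs : s = ρ
      · subst hs
        rw [h1ρ]
        simpa using hgev.self_of_nhds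
      · rw [h1ne s hs]
        have := pow_ne_zero m (sub_ne_zero.mpr hs)
        field_simp
    refine ⟨h1, fun s hs => ?_, fun s hs => ?_, fun r hr => ?_⟩
    · by_cases hsρ : s = ρ
      · subst hsρ
        have : h1 =ᶠ[nhds s] g := by
          filter_upwards [hgev] with w hw
          by_cases hws : w = s
          · rw [hws, h1ρ]
          · rw [h1ne w hws, hw, smul_eq_mul]
            have := pow_ne_zero m (sub_ne_zero.mpr hws)
            field_simp
        exact (this.differentiableAt_iff.mpr hg.differentiableAt).differentiableWithinAt
      · have : h1 =ᶠ[nhds s] fun w => h w / (w - ρ) ^ m := by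
          filter_upwards [isOpen_ne.mem_nhds hsρ] with w hw using h1ne w hw
        refine (this.differentiableAt_iff.mpr ?_).differentiableWithinAt
        exact (hh.differentiableAt (hU.mem_nhds hs)).div (by fun_prop)
          (pow_ne_zero m (sub_ne_zero.mpr hsρ))
    · rw [Finset.prod_insert hρ, hfac s hs, h1mul s hs]; ring
    · rcases Finset.mem_insert.mp hr with rfl | hr'
      · rw [h1ρ]; exact hg0
      · have h3 := h1mul r (hZ r hr)
        intro h0
        exact hne r hr' (by rw [h3, h0, mul_zero])

/-- On the circle of radius `R` around `c`, the Blaschke denominator attached to a point `ρ` has the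
same modulus as `s - ρ`. -/
theorem norm_blaschke_denom_eq {c ρ s : ℂ} {R : ℝ} (hR : 0 < R) (hs : ‖s - c‖ = R) :
    ‖((R : ℂ) ^ 2 - (starRingEnd ℂ) (ρ - c) * (s - c)) / R‖ = ‖s - ρ‖ := by
  have h1 : (R : ℂ) ^ 2 = (starRingEnd ℂ) (s - c) * (s - c) := by
    rw [← normSq_eq_conj_mul_self, normSq_eq_norm_sq, hs]; push_cast; ring
  rw [h1, ← sub_mul, ← map_sub, norm_div, norm_mul, RCLike.norm_conj, hs, norm_real,
    Real.norm_of_nonneg hR.le, mul_div_assoc, div_self hR.ne', mul_one]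
  congr 1; ring

/-- The logarithmic derivative of a zero-free holomorphic function on a disc, which is bounded by
`e ^ M` times its value at the centre, is `O(M)` in a smaller disc. -/
theorem norm_logDeriv_le_of_norm_le {H : ℂ → ℂ} {c : ℂ} {r₂ r₃ M : ℝ} (hr₃ : 0 < r₃) (h32 : r₃ < r₂)
    (hM : 0 < M) (hH : DifferentiableOn ℂ H (ball c r₂)) (hne : ∀ s ∈ ball c r₂, H s ≠ 0)
    (hb : ∀ s ∈ ball c r₂, ‖H s‖ ≤ Real.exp M * ‖H c‖) {s : ℂ} (hs : s ∈ closedBall c r₃) :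
    ‖deriv H s / H s‖ ≤ 8 * r₂ / (r₂ - r₃) ^ 2 * M := by
  have hr₂ : 0 < r₂ := hr₃.trans h32
  have hc : c ∈ ball c r₂ := mem_ball_self hr₂
  have hdH : DifferentiableOn ℂ (fun s => deriv H s / H s) (ball c r₂) :=
    (hH.deriv isOpen_ball).div hH hne
  obtain ⟨ℓ, hℓ⟩ := hdH.isExactOn_ball
  -- `exp (ℓ - ℓ c)` equals `H / H c` since their quotient has derivative zero
  have hexp : ∀ s ∈ ball c r₂, H s = H c * exp (ℓ s - ℓ c) := by
    have hder : ∀ s ∈ ball c r₂, HasDerivAt (fun s => H s * exp (-(ℓ s - ℓ c))) 0 s := by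
      intro s hs
      have h1 := (hH.differentiableAt (isOpen_ball.mem_nhds hs)).hasDerivAt
      have h2 := (((hℓ s hs).sub_const (ℓ c)).neg).cexp
      have h3 := h1.mul h2
      refine h3.congr_deriv ?_
      have := hne s hs
      field_simp
      simp
    intro s hs
    have hconst := isOpen_ball.is_const_of_deriv_eq_zero (convex_ball c r₂).isPreconnected
      (f := fun s => H s * exp (-(ℓ s - ℓ c)))
      (fun s hs => (hder s hs).differentiableAt.differentiableWithinAt)
      (fun s hs => (hder s hs).deriv) hs hc
    simp only [sub_self, neg_zero, exp_zero, mul_one] at hconst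
    rw [← hconst, mul_assoc, ← exp_add]; simp
  set r : ℝ := (r₂ + r₃) / 2 with hr
  set φ : ℂ → ℂ := fun w => ℓ (c + w) - ℓ c with hφ
  have hmem : ∀ w ∈ ball (0 : ℂ) r₂, c + w ∈ ball c r₂ := by
    intro w hw; simpa [mem_ball, dist_eq_norm] using hw
  have hφd : DifferentiableOn ℂ φ (ball 0 r₂) := by
    intro w hw
    have h1 : HasDerivAt ℓ _ (c + w) := hℓ _ (hmem w hw)
    have h2 : HasDerivAt φ _ w := (h1.comp_const_add c w).sub_const (ℓ c)
    exact h2.differentiableAt.differentiableWithinAt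
  have hφre : MapsTo φ (ball 0 r₂) {z | z.re ≤ M} := by
    intro w hw
    have h1 := hb _ (hmem w hw)
    rw [hexp _ (hmem w hw), norm_mul, norm_exp, mul_comm] at h1
    have h2 : 0 < ‖H c‖ := norm_pos_iff.mpr (hne c hc)
    exact Real.exp_le_exp.mp (le_of_mul_le_mul_right h1 h2)
  have hbd : ∀ w ∈ ball (0 : ℂ) r₂, ‖w‖ ≤ r → ‖φ w‖ ≤ 2 * M * r₂ / (r₂ - r) := by
    intro w hw hwr
    refine (borelCaratheodory_zero hM hφd hφre hr₂ hw (by simp [hφ])).trans ?_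
    have : 0 < r₂ - r := by rw [hr]; linarith
    gcongr
    rw [hr] at *; linarith
  have hρ : 0 < r - r₃ := by rw [hr]; linarith
  have hsr : ‖s - c‖ ≤ r₃ := by simpa [dist_eq_norm] using hs
  have hsub : ∀ w ∈ closedBall (s - c) (r - r₃), ‖w‖ ≤ r := by
    intro w hw
    have : ‖w - (s - c)‖ ≤ r - r₃ := by simpa [dist_eq_norm] using hw
    calc ‖w‖ = ‖(w - (s - c)) + (s - c)‖ := by ring_nf
      _ ≤ _ := norm_add_le _ _
      _ ≤ r := by linarith
  have hrr : r < r₂ := by rw [hr]; linarith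
  have hsub2 : closedBall (s - c) (r - r₃) ⊆ ball 0 r₂ := fun w hw => by
    simpa using (hsub w hw).trans_lt hrr
  have hcau := norm_deriv_le_of_forall_mem_sphere_norm_le (f := φ) (c := s - c) hρ
    (C := 2 * M * r₂ / (r₂ - r))
    ((hφd.mono hsub2).diffContOnCl_ball subset_rfl)
    (fun w hw => hbd w (hsub2 (sphere_subset_closedBall hw)) (hsub w (sphere_subset_closedBall hw)))
  have hsball : s ∈ ball c r₂ := by
    simpa [dist_eq_norm] using hsr.trans_lt h32
  have hd : deriv φ (s - c) = deriv H s / H s := by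
    have h1 : HasDerivAt ℓ (deriv H s / H s) (c + (s - c)) := by
      rw [add_sub_cancel]; exact hℓ s hsball
    exact ((h1.comp_const_add c (s - c)).sub_const (ℓ c)).deriv
  rw [hd] at hcau
  refine hcau.trans (le_of_eq ?_)
  have h3 : r₂ - r₃ ≠ 0 := by linarith
  have h4 : r₂ - r = (r₂ - r₃) / 2 := by rw [hr]; ring
  have h5 : r - r₃ = (r₂ - r₃) / 2 := by rw [hr]; ring
  rw [h4, h5]; field_simp; ring

/-- The polynomial of Blaschke denominators attached to the points `ρ ∈ Z` with multiplicities `m`,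
for the disc of centre `c` and radius `R`. -/
noncomputable def blaschkeDenom (c : ℂ) (R : ℝ) (Z : Finset ℂ) (m : ℂ → ℕ) (s : ℂ) : ℂ :=
  ∏ ρ ∈ Z, (((R : ℂ) ^ 2 - (starRingEnd ℂ) (ρ - c) * (s - c)) / R) ^ m ρ

theorem logDeriv_prod_pow {Z : Finset ℂ} {m : ℂ → ℕ} {u : ℂ → ℂ → ℂ} {s : ℂ}
    (hd : ∀ ρ ∈ Z, DifferentiableAt ℂ (u ρ) s) (hne : ∀ ρ ∈ Z, u ρ s ≠ 0) :
    logDeriv (fun s => ∏ ρ ∈ Z, u ρ s ^ m ρ) s = ∑ ρ ∈ Z, m ρ * logDeriv (u ρ) s := by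
  have := logDeriv_prod (s := Z) (f := fun ρ s => u ρ s ^ m ρ) (x := s)
    (fun ρ hρ => pow_ne_zero _ (hne ρ hρ)) (fun ρ hρ => (hd ρ hρ).pow _)
  rw [this]
  refine Finset.sum_congr rfl fun ρ hρ => ?_
  exact logDeriv_fun_pow (hd ρ hρ) (m ρ)

/-- A local form of the partial fraction expansion of a logarithmic derivative: if `f` is bounded on
a circle by `e ^ M` times its value at the centre and `Z` is the set of its zeros in a smaller disc,
then these zeros number `O(M)` and the logarithmic derivative of `f` deprived of these zeros is
`O(M)` in a still smaller disc. -/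
theorem sum_mult_le_and_norm_logDeriv_le {f h : ℂ → ℂ} {U : Set ℂ} {c : ℂ} {R r₂ r₃ M : ℝ}
    (hr₃ : 0 < r₃) (h32 : r₃ < r₂) (h2R : r₂ < R) (hM : 0 < M) (hU : IsOpen U)
    (hRU : closedBall c R ⊆ U) (hh : DifferentiableOn ℂ h U)
    {Z : Finset ℂ} {m : ℂ → ℕ} (hZ : ∀ ρ ∈ Z, ρ ∈ closedBall c r₂)
    (hfac : ∀ s ∈ U, f s = (∏ ρ ∈ Z, (s - ρ) ^ m ρ) * h s)
    (hfc : f c ≠ 0)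
    (hb : ∀ s ∈ sphere c R, ‖f s‖ ≤ Real.exp M * ‖f c‖) :
    (∑ ρ ∈ Z, (m ρ : ℝ)) * Real.log (R / r₂) ≤ M ∧
    ((∀ s ∈ ball c r₂, h s ≠ 0) → ∀ s ∈ closedBall c r₃, ‖logDeriv h s‖ ≤
      8 * r₂ / (r₂ - r₃) ^ 2 * M + (∑ ρ ∈ Z, (m ρ : ℝ)) * (r₂ / (R ^ 2 - r₂ * r₃))) := by
  have hr₂ : 0 < r₂ := hr₃.trans h32
  have hR : 0 < R := hr₂.trans h2R
  have hRC : (R : ℂ) ≠ 0 := by exact_mod_cast hR.ne'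
  set D := blaschkeDenom c R Z m with hD
  set u : ℂ → ℂ → ℂ := fun ρ s => ((R : ℂ) ^ 2 - (starRingEnd ℂ) (ρ - c) * (s - c)) / R with hu
  have hDu : D = fun s => ∏ ρ ∈ Z, u ρ s ^ m ρ := by ext s; rfl
  have hud : ∀ ρ, Differentiable ℂ (u ρ) := by intro ρ; simp only [hu]; fun_prop
  have hDd : Differentiable ℂ D := by
    rw [hDu]; exact Differentiable.fun_finsetProd (fun ρ _ => (hud ρ).pow _)
  have hunum : ∀ ρ ∈ Z, ∀ s, ‖s - c‖ ≤ r₂ → R ^ 2 - r₂ * ‖s - c‖ ≤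
      ‖(R : ℂ) ^ 2 - (starRingEnd ℂ) (ρ - c) * (s - c)‖ := by
    intro ρ hρ s hs
    have h1 : ‖ρ - c‖ ≤ r₂ := by simpa [dist_eq_norm] using hZ ρ hρ
    have h2 := norm_sub_norm_le ((R : ℂ) ^ 2) ((starRingEnd ℂ) (ρ - c) * (s - c))
    rw [norm_mul, RCLike.norm_conj, norm_pow, norm_real, Real.norm_of_nonneg hR.le] at h2
    have h3 : ‖ρ - c‖ * ‖s - c‖ ≤ r₂ * ‖s - c‖ := by gcongr
    linarith
  have hpos : ∀ s, ‖s - c‖ ≤ r₂ → 0 < R ^ 2 - r₂ * ‖s - c‖ := by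
    intro s hs
    have : r₂ * ‖s - c‖ ≤ r₂ * r₂ := by gcongr
    nlinarith
  have hune : ∀ ρ ∈ Z, ∀ s, ‖s - c‖ ≤ r₂ → u ρ s ≠ 0 := by
    intro ρ hρ s hs
    refine div_ne_zero (fun h0 => ?_) hRC
    have := hunum ρ hρ s hs
    rw [h0, norm_zero] at this
    exact absurd (hpos s hs) (not_lt.mpr this)
  have hDne : ∀ s, ‖s - c‖ ≤ r₂ → D s ≠ 0 := by
    intro s hs
    rw [hDu]
    exact Finset.prod_ne_zero_iff.mpr fun ρ hρ => pow_ne_zero _ (hune ρ hρ s hs)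
  set H : ℂ → ℂ := fun s => D s * h s with hH
  have hHd : DifferentiableOn ℂ H U := hDd.differentiableOn.mul hh
  have hHs : ∀ s ∈ sphere c R, ‖H s‖ = ‖f s‖ := by
    intro s hs
    have hs' : ‖s - c‖ = R := by simpa [dist_eq_norm] using hs
    rw [hH, hfac s (hRU (sphere_subset_closedBall hs)), norm_mul, norm_mul, hDu, norm_prod,
      norm_prod]
    congr 1
    refine Finset.prod_congr rfl fun ρ _ => ?_
    rw [norm_pow, norm_pow, norm_blaschke_denom_eq hR hs']
  have hHb : ∀ s ∈ closedBall c R, ‖H s‖ ≤ Real.exp M * ‖f c‖ := by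
    intro s hs
    refine norm_le_of_forall_mem_frontier_norm_le (U := ball c R) isBounded_ball
      ((hHd.mono hRU).diffContOnCl_ball subset_rfl) (fun z hz => ?_) ?_
    · rw [frontier_ball c hR.ne'] at hz
      rw [hHs z hz]; exact hb z hz
    · rwa [closure_ball c hR.ne']
  have hcU : c ∈ U := hRU (mem_closedBall_self hR.le)
  have hfcpos : 0 < ‖f c‖ := norm_pos_iff.mpr hfc
  have hDc : ‖D c‖ = ∏ ρ ∈ Z, R ^ m ρ := by
    rw [hDu, norm_prod]
    refine Finset.prod_congr rfl fun ρ _ => ?_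
    simp only [hu, sub_self, mul_zero, sub_zero, norm_pow, norm_div, norm_real,
      Real.norm_of_nonneg hR.le]
    congr 1
    field_simp
  have hhc : ‖f c‖ ≤ (∏ ρ ∈ Z, r₂ ^ m ρ) * ‖h c‖ := by
    rw [hfac c hcU, norm_mul, norm_prod]
    gcongr with ρ hρ
    rw [norm_pow]
    gcongr
    simpa [dist_eq_norm, norm_sub_rev] using hZ ρ hρ
  set N : ℝ := ∑ ρ ∈ Z, (m ρ : ℝ) with hN
  have hkey : (R / r₂) ^ (∑ ρ ∈ Z, m ρ) * ‖f c‖ ≤ ‖H c‖ := by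
    rw [hH, norm_mul, hDc, Finset.prod_pow_eq_pow_sum]
    rw [Finset.prod_pow_eq_pow_sum] at hhc
    rw [div_pow]
    calc _ ≤ R ^ (∑ ρ ∈ Z, m ρ) / r₂ ^ (∑ ρ ∈ Z, m ρ) * (r₂ ^ (∑ ρ ∈ Z, m ρ) * ‖h c‖) := by
          gcongr
      _ = _ := by field_simp
  have h1R : 1 ≤ R / r₂ := (one_le_div hr₂).mpr h2R.le
  refine ⟨?_, fun hne s hs => ?_⟩
  · have h1 := hkey.trans (hHb c (mem_closedBall_self hR.le))
    have h2 : (R / r₂) ^ (∑ ρ ∈ Z, m ρ) ≤ Real.exp M := le_of_mul_le_mul_right h1 hfcpos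
    have h3 := Real.log_le_log (by positivity) h2
    rw [Real.log_exp, Real.log_pow] at h3
    rw [hN]; exact_mod_cast h3
  · have hs3 : ‖s - c‖ ≤ r₃ := by simpa [dist_eq_norm] using hs
    have hs2 : ‖s - c‖ ≤ r₂ := hs3.trans h32.le
    have hsb : s ∈ ball c r₂ := by simpa [dist_eq_norm] using hs3.trans_lt h32
    have hbU : ball c r₂ ⊆ U := (ball_subset_closedBall.trans (closedBall_subset_closedBall h2R.le)).trans hRU
    have hHc : ‖f c‖ ≤ ‖H c‖ := le_trans (by
      nlinarith [one_le_pow₀ h1R (n := ∑ ρ ∈ Z, m ρ)]) hkey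
    have hHlog := norm_logDeriv_le_of_norm_le (H := H) hr₃ h32 hM (hHd.mono hbU)
      (fun z hz => mul_ne_zero (hDne z (by simpa [dist_eq_norm] using (mem_ball.mp hz).le)) (hne z hz))
      (fun z hz => (hHb z (closedBall_subset_closedBall h2R.le (ball_subset_closedBall hz))).trans
        (by gcongr)) hs
    have hlog : logDeriv H s = logDeriv D s + logDeriv h s :=
      logDeriv_mul s (hDne s hs2) (hne s hsb) (hDd s)
        (hh.differentiableAt (hU.mem_nhds (hbU hsb)))
    have hDlog : ‖logDeriv D s‖ ≤ N * (r₂ / (R ^ 2 - r₂ * r₃)) := by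
      rw [hDu, logDeriv_prod_pow (fun ρ _ => hud ρ s) (fun ρ hρ => hune ρ hρ s hs2), hN,
        Finset.sum_mul]
      refine (norm_sum_le _ _).trans (Finset.sum_le_sum fun ρ hρ => ?_)
      rw [norm_mul, norm_natCast]
      gcongr
      have hder : HasDerivAt (u ρ) (-((starRingEnd ℂ) (ρ - c)) / R) s := by
        have h1 : HasDerivAt (fun s : ℂ => s - c) 1 s := (hasDerivAt_id s).sub_const c
        have h2 := ((h1.const_mul ((starRingEnd ℂ) (ρ - c))).const_sub ((R : ℂ) ^ 2)).div_const (R : ℂ)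
        simpa [hu] using h2
      rw [logDeriv_apply, hder.deriv]
      have h4 : -((starRingEnd ℂ) (ρ - c)) / R / u ρ s =
          -((starRingEnd ℂ) (ρ - c)) / ((R : ℂ) ^ 2 - (starRingEnd ℂ) (ρ - c) * (s - c)) := by
        simp only [hu]; rw [div_div_div_cancel_right₀ hRC]
      rw [h4, norm_div, norm_neg, RCLike.norm_conj]
      have h5 : 0 < R ^ 2 - r₂ * r₃ := by nlinarith
      have h6 : R ^ 2 - r₂ * r₃ ≤ R ^ 2 - r₂ * ‖s - c‖ := by
        have : r₂ * ‖s - c‖ ≤ r₂ * r₃ := by gcongr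
        linarith
      have h7 : ‖ρ - c‖ ≤ r₂ := by simpa [dist_eq_norm] using hZ ρ hρ
      exact div_le_div₀ hr₂.le h7 h5 (h6.trans (hunum ρ hρ s hs2))
    have : logDeriv h s = logDeriv H s - logDeriv D s := by rw [hlog]; ring
    rw [this]
    refine (norm_sub_le _ _).trans (add_le_add ?_ hDlog)
    simpa [logDeriv_apply] using hHlog

/-! ### Removing the zeros up to a given height -/

theorem logDeriv_prod_sub_pow_mul {Z : Finset ℂ} {m : ℂ → ℕ} {f h : ℂ → ℂ} {U : Set ℂ}
    (hU : IsOpen U) (hh : DifferentiableOn ℂ h U)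
    (hfac : ∀ s ∈ U, f s = (∏ ρ ∈ Z, (s - ρ) ^ m ρ) * h s) {s : ℂ} (hs : s ∈ U) (hf : f s ≠ 0)
    (hZ : ∀ ρ ∈ Z, f ρ = 0) :
    logDeriv f s = ∑ ρ ∈ Z, m ρ / (s - ρ) + logDeriv h s := by
  have hev : f =ᶠ[nhds s] fun s => (∏ ρ ∈ Z, (s - ρ) ^ m ρ) * h s := by
    filter_upwards [hU.mem_nhds hs] with w hw using hfac w hw
  have h1 : logDeriv f s = logDeriv (fun s => (∏ ρ ∈ Z, (s - ρ) ^ m ρ) * h s) s := by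
    rw [logDeriv_apply, logDeriv_apply, hev.deriv_eq, hev.self_of_nhds]
  have hne : ∀ ρ ∈ Z, s - ρ ≠ 0 := fun ρ hρ h0 => hf (by rw [sub_eq_zero.mp h0]; exact hZ ρ hρ)
  rw [h1, logDeriv_mul (f := fun s => ∏ ρ ∈ Z, (s - ρ) ^ m ρ) s
    (Finset.prod_ne_zero_iff.mpr fun ρ hρ => pow_ne_zero _ (hne ρ hρ))
    (right_ne_zero_of_mul (hfac s hs ▸ hf)) (by fun_prop) (hh.differentiableAt (hU.mem_nhds hs)),
    logDeriv_prod_pow (u := fun ρ s => s - ρ) (fun ρ _ => by fun_prop) hne]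
  congr 1
  refine Finset.sum_congr rfl fun ρ _ => ?_
  rw [logDeriv_apply, deriv_sub_const, deriv_id'', mul_one_div]

/-- The right half plane `Re s > 0`. -/
def rightHalfPlane : Set ℂ := {s | 0 < s.re}

theorem isOpen_rightHalfPlane : IsOpen rightHalfPlane :=
  isOpen_lt continuous_const continuous_re

theorem closedBall_two_add_subset_rightHalfPlane {R : ℝ} (hR : R < 2) (t : ℝ) :
    closedBall (2 + t * I : ℂ) R ⊆ rightHalfPlane := by
  intro s hs
  have h1 : ‖s - (2 + t * I)‖ ≤ R := by simpa [dist_eq_norm] using hs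
  have h2 := (abs_le.mp ((abs_re_le_norm _).trans h1)).1
  simp at h2
  change 0 < s.re
  linarith

/-- For a holomorphic function on `Re s > 0` whose zeros lie on the critical line, and which has
controlled growth, removing the zeros up to height `T` leaves a function whose logarithmic
derivative is `O(MT)` inside the critical strip, up to height `T - 4`. -/
theorem exists_factor_norm_logDeriv_le {c : ℝ} (hc : 0 < c) (hc' : c ≤ 1 / 16) :
    ∃ K : ℝ, 0 < K ∧ ∀ (f : ℂ → ℂ) (M T : ℝ) (Z : Finset ℂ),
      DifferentiableOn ℂ f rightHalfPlane →
      (∀ s ∈ rightHalfPlane, f s = 0 → s.re = 1 / 2) → 0 < M → 1 ≤ T →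
      (∀ t : ℝ, |t| ≤ T → ∀ s ∈ closedBall (2 + t * I : ℂ) (2 - c),
        ‖f s‖ ≤ Real.exp M * ‖f (2 + t * I)‖) →
      (∀ s, s ∈ Z ↔ 0 < s.re ∧ |s.im| ≤ T ∧ f s = 0) →
      ∃ h : ℂ → ℂ, DifferentiableOn ℂ h rightHalfPlane ∧
        (∀ s ∈ rightHalfPlane, f s = (∏ ρ ∈ Z, (s - ρ) ^ analyticOrderNatAt f ρ) * h s) ∧
        (∀ s ∈ rightHalfPlane, |s.im| ≤ T → h s ≠ 0) ∧
        ∑ ρ ∈ Z, (analyticOrderNatAt f ρ : ℝ) ≤ K * M * T ∧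
        ∀ s : ℂ, 4 * c ≤ s.re → s.re ≤ 2 → |s.im| ≤ T - 4 → ‖logDeriv h s‖ ≤ K * M * T := by
  classical
  set R := 2 - c with hR
  set r₂ := 2 - 2 * c with hr₂
  set r₃ := 2 - 4 * c with hr₃
  have hr₃0 : 0 < r₃ := by rw [hr₃]; linarith
  have h32 : r₃ < r₂ := by rw [hr₃, hr₂]; linarith
  have h2R : r₂ < R := by rw [hR, hr₂]; linarith
  have hr₂0 : 0 < r₂ := hr₃0.trans h32
  set l := Real.log (R / r₂) with hl
  have hl0 : 0 < l := Real.log_pos ((one_lt_div hr₂0).mpr h2R)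
  set b := r₂ / (R ^ 2 - r₂ * r₃) with hb
  have hb0 : 0 < b := div_pos hr₂0 (by nlinarith)
  set A := 8 * r₂ / (r₂ - r₃) ^ 2 with hA
  have hA0 : 0 < A := div_pos (by linarith) (pow_pos (by linarith) 2)
  refine ⟨A + b / l + 3 / l / (2 * c) + 3 / l, by positivity, ?_⟩
  intro f M T Z hf hzero hM hT hbd hZ
  have hRU : ∀ t : ℝ, closedBall (2 + t * I : ℂ) R ⊆ rightHalfPlane := fun t =>
    closedBall_two_add_subset_rightHalfPlane (by rw [hR]; linarith) t
  have hZU : ∀ ρ ∈ Z, ρ ∈ rightHalfPlane := fun ρ hρ => ((hZ ρ).mp hρ).1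
  have hc2 : ∀ t : ℝ, f (2 + t * I) ≠ 0 := by
    intro t h0
    have := hzero _ (hRU t (mem_closedBall_self (by linarith))) h0
    norm_num at this
  have han : AnalyticOnNhd ℂ f rightHalfPlane := hf.analyticOnNhd isOpen_rightHalfPlane
  have hpre : IsPreconnected rightHalfPlane := (convex_halfSpace_re_gt 0).isPreconnected
  have hord : ∀ ρ ∈ rightHalfPlane, analyticOrderAt f ρ ≠ ⊤ := by
    intro ρ hρ
    have h2U : (2 + (0 : ℝ) * I : ℂ) ∈ rightHalfPlane := hRU 0 (mem_closedBall_self (by linarith))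
    refine han.analyticOrderAt_ne_top_of_isPreconnected hpre h2U hρ ?_
    rw [(han _ h2U).analyticOrderAt_eq_zero.mpr (hc2 0)]
    exact ENat.zero_ne_top
  -- the local expansion around `2 + it`
  set Zt : ℝ → Finset ℂ := fun t => Z.filter (fun ρ => ρ ∈ closedBall (2 + t * I : ℂ) r₂) with hZt
  have hloc : ∀ t : ℝ, |t| ≤ T → ∃ k : ℂ → ℂ, DifferentiableOn ℂ k rightHalfPlane ∧
      (∀ s ∈ rightHalfPlane, f s = (∏ ρ ∈ Zt t, (s - ρ) ^ analyticOrderNatAt f ρ) * k s) ∧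
      (∑ ρ ∈ Zt t, (analyticOrderNatAt f ρ : ℝ)) ≤ M / l ∧
      (|t| ≤ T - 4 → ∀ s ∈ closedBall (2 + t * I : ℂ) r₃, ‖logDeriv k s‖ ≤ (A + b / l) * M) := by
    intro t ht
    obtain ⟨k, hk, hkfac, hkne⟩ := exists_eq_prod_sub_pow_mul isOpen_rightHalfPlane hf (Zt t)
      (fun ρ hρ => hZU ρ (Finset.mem_filter.mp hρ).1)
      (fun ρ hρ => hord ρ (hZU ρ (Finset.mem_filter.mp hρ).1))
    obtain ⟨h1, h2⟩ := sum_mult_le_and_norm_logDeriv_le hr₃0 h32 h2R hM isOpen_rightHalfPlane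
      (hRU t) hk (fun ρ hρ => (Finset.mem_filter.mp hρ).2) hkfac (hc2 t)
      (fun s hs => hbd t ht s (sphere_subset_closedBall hs))
    have h3 : (∑ ρ ∈ Zt t, (analyticOrderNatAt f ρ : ℝ)) ≤ M / l := (le_div_iff₀ hl0).mpr h1
    refine ⟨k, hk, hkfac, h3, fun ht4 s hs => ?_⟩
    refine (h2 ?_ s hs).trans ?_
    · intro w hw h0
      have hwU : w ∈ rightHalfPlane := hRU t (ball_subset_closedBall (ball_subset_ball h2R.le hw))
      have hfw : f w = 0 := by rw [hkfac w hwU, h0, mul_zero]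
      have hwim : |w.im| ≤ T := by
        have h4 : ‖w - (2 + t * I)‖ < r₂ := by simpa [dist_eq_norm] using hw
        have h5 := (abs_im_le_norm (w - (2 + t * I))).trans h4.le
        simp only [sub_im, add_im, im_ofNat, mul_im, ofReal_re, I_im, mul_one, ofReal_im, I_re,
          mul_zero, add_zero, zero_add] at h5
        calc |w.im| = |(w.im - t) + t| := by ring_nf
          _ ≤ |w.im - t| + |t| := abs_add_le _ _
          _ ≤ T := by rw [hr₂] at h5; linarith
      exact hkne w (Finset.mem_filter.mpr ⟨(hZ w).mpr ⟨hwU, hwim, hfw⟩, ball_subset_closedBall hw⟩) h0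
    · calc A * M + (∑ ρ ∈ Zt t, (analyticOrderNatAt f ρ : ℝ)) * b ≤ A * M + M / l * b := by gcongr
        _ = _ := by ring
  -- the zeros up to height `T` are covered by the discs centred at `2 + ij`, `|j| ≤ T`
  have hcount : ∑ ρ ∈ Z, (analyticOrderNatAt f ρ : ℝ) ≤ 3 / l * M * T := by
    set J := Finset.Icc (-(⌊T⌋₊ : ℤ)) ⌊T⌋₊ with hJ
    have hJT : ∀ j ∈ J, |((j : ℤ) : ℝ)| ≤ T := by
      intro j hj
      rw [hJ, Finset.mem_Icc] at hj
      have h1 : |j| ≤ (⌊T⌋₊ : ℤ) := abs_le.mpr hj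
      have h2 : |(j : ℝ)| ≤ (⌊T⌋₊ : ℝ) := by exact_mod_cast h1
      exact h2.trans (Nat.floor_le (by linarith))
    have hsub : ∀ ρ ∈ Z, ∃ j ∈ J, ρ ∈ closedBall (2 + ((j : ℝ) : ℂ) * I) r₂ := by
      intro ρ hρ
      obtain ⟨h0, h1, h2⟩ := (hZ ρ).mp hρ
      have hre := hzero ρ h0 h2
      have : ∃ j ∈ J, |ρ.im - (j : ℝ)| ≤ 1 := by
        have hfl : (⌊|ρ.im|⌋₊ : ℤ) ≤ ⌊T⌋₊ := by exact_mod_cast Nat.floor_le_floor h1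
        have h3 := Nat.floor_le (abs_nonneg ρ.im)
        have h4 := (Nat.lt_floor_add_one |ρ.im|).le
        rcases le_total 0 ρ.im with h5 | h5
        · refine ⟨(⌊|ρ.im|⌋₊ : ℤ), Finset.mem_Icc.mpr ⟨by omega, hfl⟩, ?_⟩
          rw [abs_of_nonneg h5] at *
          push_cast
          rw [abs_le]; constructor <;> linarith
        · refine ⟨-(⌊|ρ.im|⌋₊ : ℤ), Finset.mem_Icc.mpr ⟨by omega, by omega⟩, ?_⟩
          rw [abs_of_nonpos h5] at *
          push_cast
          rw [abs_le]; constructor <;> linarith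
      obtain ⟨j, hj, hj1⟩ := this
      refine ⟨j, hj, ?_⟩
      rw [mem_closedBall, dist_eq_norm]
      refine abs_le_of_sq_le_sq' ?_ hr₂0.le |>.2
      rw [Complex.sq_norm, normSq_apply]
      have e1 : (ρ - (2 + ((j : ℝ) : ℂ) * I)).re = -3 / 2 := by simp [hre]; norm_num
      have e2 : (ρ - (2 + ((j : ℝ) : ℂ) * I)).im = ρ.im - j := by simp
      rw [e1, e2]
      have h6 : (ρ.im - j) * (ρ.im - j) ≤ 1 := by
        have := abs_le.mp hj1
        nlinarith
      rw [hr₂]; nlinarith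
    calc ∑ ρ ∈ Z, (analyticOrderNatAt f ρ : ℝ)
        ≤ ∑ ρ ∈ Z, ∑ j ∈ J, if ρ ∈ closedBall (2 + ((j : ℝ) : ℂ) * I) r₂ then
            (analyticOrderNatAt f ρ : ℝ) else 0 := by
          refine Finset.sum_le_sum fun ρ hρ => ?_
          obtain ⟨j, hj, hρj⟩ := hsub ρ hρ
          refine le_trans ?_ (Finset.single_le_sum (fun i _ => ?_) hj)
          · rw [if_pos hρj]
          · positivity
      _ = ∑ j ∈ J, ∑ ρ ∈ Zt j, (analyticOrderNatAt f ρ : ℝ) := by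
          rw [Finset.sum_comm]
          refine Finset.sum_congr rfl fun j _ => ?_
          rw [hZt, Finset.sum_filter]
      _ ≤ ∑ j ∈ J, M / l := Finset.sum_le_sum fun j hj => by
          obtain ⟨k, _, _, h3, _⟩ := hloc j (hJT j hj)
          exact h3
      _ = (2 * ⌊T⌋₊ + 1 : ℝ) * (M / l) := by
          rw [Finset.sum_const, hJ, Int.card_Icc, nsmul_eq_mul]
          congr 1
          have : ((⌊T⌋₊ : ℤ) + 1 - -(⌊T⌋₊ : ℤ)).toNat = 2 * ⌊T⌋₊ + 1 := by omega
          rw [this]; push_cast; ring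
      _ ≤ (3 * T) * (M / l) := by
          have := Nat.floor_le (show (0 : ℝ) ≤ T by linarith)
          gcongr; linarith
      _ = _ := by ring
  obtain ⟨h, hh, hfac, hne⟩ := exists_eq_prod_sub_pow_mul isOpen_rightHalfPlane hf Z hZU
    (fun ρ hρ => hord ρ (hZU ρ hρ))
  have hMT : M ≤ M * T := by nlinarith
  have hne' : ∀ s ∈ rightHalfPlane, |s.im| ≤ T → h s ≠ 0 := by
    intro s hs hsT h0
    exact hne s ((hZ s).mpr ⟨hs, hsT, by rw [hfac s hs, h0, mul_zero]⟩) h0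
  refine ⟨h, hh, hfac, hne', ?_, ?_⟩
  · refine hcount.trans ?_
    rw [mul_assoc, mul_assoc]
    gcongr
    have : 0 < A + b / l + 3 / l / (2 * c) := by positivity
    linarith
  -- away from the zeros the two expansions are compared
  have hoff : ∀ s : ℂ, 4 * c ≤ s.re → s.re ≤ 2 → |s.im| ≤ T - 4 → f s ≠ 0 →
      ‖logDeriv h s‖ ≤ (A + b / l + 3 / l / (2 * c) + 3 / l) * M * T := by
    intro s hs1 hs2 hsT hfs
    have hsU : s ∈ rightHalfPlane := by change 0 < s.re; linarith
    obtain ⟨k, hk, hkfac, _, hkb⟩ := hloc s.im (by linarith)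
    have hsb : ‖s - (2 + s.im * I)‖ ≤ r₃ := by
      have : s - (2 + s.im * I) = ((s.re - 2 : ℝ) : ℂ) := by
        apply Complex.ext <;> simp
      rw [this, norm_real, Real.norm_eq_abs, abs_of_nonpos (by linarith), hr₃]; linarith
    have hkb' := hkb hsT s (by simpa [dist_eq_norm] using hsb)
    have e1 := logDeriv_prod_sub_pow_mul isOpen_rightHalfPlane hh hfac hsU hfs
      (fun ρ hρ => ((hZ ρ).mp hρ).2.2)
    have e2 := logDeriv_prod_sub_pow_mul isOpen_rightHalfPlane hk hkfac hsU hfs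
      (fun ρ hρ => ((hZ ρ).mp (Finset.mem_filter.mp hρ).1).2.2)
    have e3 := Finset.sum_filter_add_sum_filter_not Z
      (fun ρ => ρ ∈ closedBall (2 + (s.im : ℂ) * I : ℂ) r₂)
      (fun ρ => (analyticOrderNatAt f ρ : ℂ) / (s - ρ))
    have e4 : logDeriv h s = logDeriv k s -
        ∑ ρ ∈ Z with ρ ∉ closedBall (2 + (s.im : ℂ) * I : ℂ) r₂,
          (analyticOrderNatAt f ρ : ℂ) / (s - ρ) := by
      rw [e1, ← e3] at e2
      linear_combination e2
    have e5 : ‖∑ ρ ∈ Z with ρ ∉ closedBall (2 + (s.im : ℂ) * I : ℂ) r₂,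
          (analyticOrderNatAt f ρ : ℂ) / (s - ρ)‖ ≤ 3 / l * M * T / (2 * c) := by
      refine (norm_sum_le _ _).trans ?_
      calc _ ≤ ∑ ρ ∈ Z with ρ ∉ closedBall (2 + (s.im : ℂ) * I : ℂ) r₂,
            (analyticOrderNatAt f ρ : ℝ) / (2 * c) := by
            refine Finset.sum_le_sum fun ρ hρ => ?_
            rw [norm_div, Complex.norm_natCast]
            have h1 := (Finset.mem_filter.mp hρ).2
            rw [mem_closedBall, dist_eq_norm, not_le] at h1
            have h2 : ‖ρ - (2 + s.im * I)‖ ≤ ‖s - ρ‖ + ‖s - (2 + s.im * I)‖ := by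
              rw [norm_sub_rev s ρ]
              calc _ = ‖(ρ - s) + (s - (2 + s.im * I))‖ := by ring_nf
                _ ≤ _ := norm_add_le _ _
            gcongr
            rw [hr₂] at h1; rw [hr₃] at hsb; linarith
        _ ≤ ∑ ρ ∈ Z, (analyticOrderNatAt f ρ : ℝ) / (2 * c) :=
            Finset.sum_le_sum_of_subset_of_nonneg (Finset.filter_subset _ _)
              (fun _ _ _ => by positivity)
        _ = (∑ ρ ∈ Z, (analyticOrderNatAt f ρ : ℝ)) / (2 * c) := by rw [Finset.sum_div]
        _ ≤ _ := by gcongr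
    rw [e4]
    refine (norm_sub_le _ _).trans ((add_le_add hkb' e5).trans ?_)
    have h7 : (A + b / l) * M ≤ (A + b / l) * (M * T) := by gcongr
    have h8 : 0 ≤ 3 / l * (M * T) := by positivity
    calc _ ≤ (A + b / l) * (M * T) + 3 / l * M * T / (2 * c) + 3 / l * (M * T) := by linarith
      _ = _ := by ring
  intro s hs1 hs2 hsT
  have hsU : s ∈ rightHalfPlane := by change 0 < s.re; linarith
  by_cases hfs : f s = 0
  · -- at a zero the bound follows by continuity along the horizontal line
    have hre := hzero s hsU hfs
    have hcont : ContinuousAt (fun x : ℝ => ‖logDeriv h (x + s.im * I)‖) s.re := by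
      have h1 : ContinuousAt (logDeriv h) (s.re + s.im * I) := by
        rw [re_add_im]
        have hn := isOpen_rightHalfPlane.mem_nhds hsU
        exact ((hh.deriv isOpen_rightHalfPlane).differentiableAt hn).continuousAt.div
          (hh.differentiableAt hn).continuousAt (hne' s hsU (by linarith))
      exact (ContinuousAt.comp (f := fun x : ℝ => (x + s.im * I : ℂ)) h1 (by fun_prop)).norm
    have hlim := hcont.tendsto.mono_left (nhdsWithin_le_nhds (s := Ioi s.re))
    simp only [re_add_im] at hlim
    refine le_of_tendsto hlim ?_
    filter_upwards [self_mem_nhdsWithin, Ioo_mem_nhdsGT (show s.re < 2 by linarith)] with x hx hx2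
    refine hoff _ (by simpa using hs1.trans (le_of_lt hx)) (by simpa using hx2.2.le)
      (by simpa using hsT) (fun h0 => ?_)
    have := hzero (x + s.im * I) (by
      have h9 : s.re < x := hx
      change 0 < (x + s.im * I : ℂ).re
      simp only [add_re, ofReal_re, mul_re, I_re, ofReal_im, I_im]
      linarith) h0
    simp at this
    have hx' : s.re < x := hx
    linarith
  · exact hoff s hs1 hs2 hsT hfs

/-! ### Growth of Dirichlet `L`-functions to the right of `Re s = 0` -/

open DirichletCharacter MeasureTheory

section Growth

variable {q : ℕ} [NeZero q]

/-- The mean value of a Dirichlet character over a period. -/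
noncomputable def charMean (χ : DirichletCharacter ℂ q) : ℂ :=
  (∑ k ∈ Finset.range q, χ (k : ZMod q)) / q

theorem sum_range_modulus_eq (χ : DirichletCharacter ℂ q) :
    ∑ k ∈ Finset.range q, χ (k : ZMod q) = ∑ a : ZMod q, χ a := by
  refine Finset.sum_bij' (fun k _ => (k : ZMod q)) (fun a _ => a.val) ?_ ?_ ?_ ?_ ?_
  · intros; simp
  · intro a _; simpa using a.val_lt
  · intro k hk; simpa using ZMod.val_cast_of_lt (Finset.mem_range.mp hk)
  · intro a _; simp
  · intros; rfl

theorem charMean_eq_zero {χ : DirichletCharacter ℂ q} (hχ : χ ≠ 1) : charMean χ = 0 := by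
  rw [charMean, sum_range_modulus_eq, MulChar.sum_eq_zero_of_ne_one hχ, zero_div]

omit [NeZero q] in
theorem norm_sum_range_char_le (χ : DirichletCharacter ℂ q) (n : ℕ) :
    ‖∑ k ∈ Finset.range n, χ (k : ZMod q)‖ ≤ n := by
  refine (norm_sum_le _ _).trans ?_
  calc _ ≤ ∑ k ∈ Finset.range n, (1 : ℝ) := Finset.sum_le_sum fun k _ => χ.norm_le_one _
    _ = n := by simp

theorem norm_charMean_le_one (χ : DirichletCharacter ℂ q) : ‖charMean χ‖ ≤ 1 := by
  have hq : (0 : ℝ) < q := by exact_mod_cast Nat.pos_of_neZero q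
  rw [charMean, norm_div, Complex.norm_natCast]
  exact (div_le_one hq).mpr (norm_sum_range_char_le χ q)

/-- Sums of a character over complete periods are exactly multiples of the mean value. -/
theorem norm_sum_range_char_sub_le (χ : DirichletCharacter ℂ q) (n : ℕ) :
    ‖∑ k ∈ Finset.range n, χ (k : ZMod q) - charMean χ * n‖ ≤ 2 * q := by
  have hq : (0 : ℝ) < q := by exact_mod_cast Nat.pos_of_neZero q
  induction n using Nat.strong_induction_on with
  | _ n ih =>
    rcases lt_or_ge n q with h | h
    · refine (norm_sub_le _ _).trans ?_
      rw [norm_mul, Complex.norm_natCast]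
      have h1 := norm_sum_range_char_le χ n
      have h2 := norm_charMean_le_one χ
      have h3 : (n : ℝ) ≤ q := by exact_mod_cast h.le
      have h4 : ‖charMean χ‖ * n ≤ 1 * n := by gcongr
      linarith
    · obtain ⟨m, rfl⟩ := Nat.exists_eq_add_of_le h
      have h1 := ih m (by have := Nat.pos_of_neZero q; omega)
      have h2 : ∑ k ∈ Finset.range (q + m), χ (k : ZMod q) - charMean χ * ((q + m : ℕ) : ℂ) =
          ∑ k ∈ Finset.range m, χ (k : ZMod q) - charMean χ * m := by
        rw [Finset.sum_range_add]
        have h3 : charMean χ * q = ∑ k ∈ Finset.range q, χ (k : ZMod q) := by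
          rw [charMean]
          have : (q : ℂ) ≠ 0 := by exact_mod_cast hq.ne'
          field_simp
        push_cast
        rw [mul_add, h3]
        simp
      rw [h2]; exact h1

/-- The remainder in the counting function of a Dirichlet character. -/
noncomputable def charRemainder (χ : DirichletCharacter ℂ q) (u : ℝ) : ℂ :=
  ∑ k ∈ Finset.Icc 1 ⌊u⌋₊, χ (k : ZMod q) - charMean χ * u

theorem norm_charRemainder_le (χ : DirichletCharacter ℂ q) {u : ℝ} (hu : 0 ≤ u) :
    ‖charRemainder χ u‖ ≤ 5 * q := by
  have hq : (1 : ℝ) ≤ q := by exact_mod_cast Nat.pos_of_neZero q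
  have h1 : ∑ k ∈ Finset.Icc 1 ⌊u⌋₊, χ (k : ZMod q) =
      ∑ k ∈ Finset.range (⌊u⌋₊ + 1), χ (k : ZMod q) - χ ((0 : ℕ) : ZMod q) := by
    rw [Finset.sum_range_succ', add_sub_cancel_right, Finset.range_eq_Ico, Finset.sum_Ico_add'
      (fun k => χ ((k : ℕ) : ZMod q))]
    rfl
  have h2 : charRemainder χ u = (∑ k ∈ Finset.range (⌊u⌋₊ + 1), χ (k : ZMod q) -
      charMean χ * ((⌊u⌋₊ + 1 : ℕ) : ℂ)) - χ ((0 : ℕ) : ZMod q) +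
        charMean χ * ((⌊u⌋₊ + 1 - u : ℝ) : ℂ) := by
    rw [charRemainder, h1]; push_cast; ring
  rw [h2]
  have h3 := norm_sum_range_char_sub_le χ (⌊u⌋₊ + 1)
  have h4 := χ.norm_le_one ((0 : ℕ) : ZMod q)
  have h5 : ‖charMean χ * ((⌊u⌋₊ + 1 - u : ℝ) : ℂ)‖ ≤ 1 := by
    rw [norm_mul, norm_real, Real.norm_eq_abs]
    have h6 := Nat.floor_le hu
    have h7 := Nat.lt_floor_add_one u
    have h8 : |(⌊u⌋₊ : ℝ) + 1 - u| ≤ 1 := by rw [abs_le]; constructor <;> linarith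
    exact mul_le_one₀ (norm_charMean_le_one χ) (abs_nonneg _) h8
  refine (norm_add_le _ _).trans ?_
  have := norm_sub_le (∑ k ∈ Finset.range (⌊u⌋₊ + 1), χ (k : ZMod q) -
      charMean χ * ((⌊u⌋₊ + 1 : ℕ) : ℂ)) (χ ((0 : ℕ) : ZMod q))
  linarith

omit [NeZero q] in
theorem measurable_charRemainder (χ : DirichletCharacter ℂ q) :
    Measurable (charRemainder χ) := by
  unfold charRemainder
  refine Measurable.sub ?_ (by fun_prop)
  exact (measurable_from_top (f := fun n : ℕ => ∑ k ∈ Finset.Icc 1 n, χ (k : ZMod q))).comp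
    Nat.measurable_floor

theorem norm_charRemainder_mul_cpow_le (χ : DirichletCharacter ℂ q) (s : ℂ) {t : ℝ}
    (ht : t ∈ Ioi (1 : ℝ)) :
    ‖charRemainder χ t * (t : ℂ) ^ (-(s + 1))‖ ≤ 5 * q * t ^ (-(s.re + 1)) := by
  have ht0 : (0 : ℝ) < t := lt_trans zero_lt_one ht
  rw [norm_mul, norm_cpow_eq_rpow_re_of_pos ht0]
  have : (-(s + 1)).re = -(s.re + 1) := by simp
  rw [this]
  gcongr
  exact norm_charRemainder_le χ ht0.le

theorem integrableOn_charRemainder_mul_cpow (χ : DirichletCharacter ℂ q) {s : ℂ} (hs : 0 < s.re) :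
    IntegrableOn (fun t : ℝ => charRemainder χ t * (t : ℂ) ^ (-(s + 1))) (Ioi 1) := by
  have h1 : IntegrableOn (fun t : ℝ => 5 * q * t ^ (-(s.re + 1))) (Ioi 1) :=
    (integrableOn_Ioi_rpow_of_lt (by linarith) zero_lt_one).const_mul _
  refine Integrable.mono' h1 ?_ ?_
  · exact ((measurable_charRemainder χ).mul (by fun_prop)).aestronglyMeasurable
  · filter_upwards [ae_restrict_mem measurableSet_Ioi] with t ht
      using norm_charRemainder_mul_cpow_le χ s ht

/-- The Mellin transform `∫₁^∞ E(t) t^{-s-1} dt` of the remainder `E` in the counting function of a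
Dirichlet character. -/
noncomputable def remainderTransform (χ : DirichletCharacter ℂ q) (s : ℂ) : ℂ :=
  ∫ t in Ioi (1 : ℝ), charRemainder χ t * (t : ℂ) ^ (-(s + 1))

theorem norm_remainderTransform_le (χ : DirichletCharacter ℂ q) {s : ℂ} (hs : 0 < s.re) :
    ‖remainderTransform χ s‖ ≤ 5 * q / s.re := by
  have h1 : IntegrableOn (fun t : ℝ => 5 * q * t ^ (-(s.re + 1))) (Ioi 1) :=
    (integrableOn_Ioi_rpow_of_lt (by linarith) zero_lt_one).const_mul _
  refine (norm_integral_le_of_norm_le h1 ?_).trans (le_of_eq ?_)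
  · filter_upwards [ae_restrict_mem measurableSet_Ioi] with t ht
      using norm_charRemainder_mul_cpow_le χ s ht
  · rw [integral_const_mul, integral_Ioi_rpow_of_lt (by linarith) zero_lt_one]
    have : -(s.re + 1) + 1 = -s.re := by ring
    rw [this, Real.one_rpow, neg_div_neg_eq, mul_one_div]

theorem differentiableOn_remainderTransform (χ : DirichletCharacter ℂ q) :
    DifferentiableOn ℂ (remainderTransform χ) rightHalfPlane := by
  have heq : remainderTransform χ = fun s => mellin (indicator (Ioi 1) (charRemainder χ)) (-s) := by
    ext s
    rw [remainderTransform, mellin]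
    have h1 : ∀ t : ℝ, (t : ℂ) ^ (-s - 1) • indicator (Ioi 1) (charRemainder χ) t =
        indicator (Ioi 1) (fun t : ℝ => charRemainder χ t * (t : ℂ) ^ (-(s + 1))) t := by
      intro t
      by_cases ht : t ∈ Ioi (1 : ℝ)
      · rw [indicator_of_mem ht, indicator_of_mem ht, smul_eq_mul, mul_comm]
        congr 2; ring
      · rw [indicator_of_notMem ht, indicator_of_notMem ht, smul_zero]
    simp_rw [h1]
    rw [setIntegral_indicator measurableSet_Ioi, Ioi_inter_Ioi, max_eq_right zero_le_one]
  have hmeas : Measurable (indicator (Ioi (1 : ℝ)) (charRemainder χ)) :=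
    (measurable_charRemainder χ).indicator measurableSet_Ioi
  have hbd : ∀ t, ‖indicator (Ioi (1 : ℝ)) (charRemainder χ) t‖ ≤ 5 * q := by
    intro t
    by_cases ht : t ∈ Ioi (1 : ℝ)
    · rw [indicator_of_mem ht]
      exact norm_charRemainder_le χ (le_trans zero_le_one (le_of_lt ht))
    · rw [indicator_of_notMem ht, norm_zero]; positivity
  intro s hs
  rw [heq]
  refine DifferentiableAt.differentiableWithinAt ?_
  have hs' : 0 < s.re := hs
  have hm : DifferentiableAt ℂ (mellin (indicator (Ioi 1) (charRemainder χ))) (-s) := by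
    refine mellin_differentiableAt_of_isBigO_rpow (a := 0) (b := (-s).re - 1) ?_ ?_ (by simpa) ?_
      (by linarith)
    · refine LocallyIntegrable.locallyIntegrableOn ?_ _
      refine (locallyIntegrable_const (5 * q : ℝ)).mono hmeas.aestronglyMeasurable ?_
      refine Filter.Eventually.of_forall fun t => (hbd t).trans (Real.le_norm_self _)
    · refine Asymptotics.IsBigO.of_bound (5 * q) (Filter.Eventually.of_forall fun t => ?_)
      simpa using hbd t
    · have : indicator (Ioi (1 : ℝ)) (charRemainder χ) =ᶠ[nhdsWithin 0 (Ioi 0)] 0 := by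
        filter_upwards [mem_nhdsWithin_of_mem_nhds (Iio_mem_nhds (show (0 : ℝ) < 1 by norm_num))]
          with t ht
        exact indicator_of_notMem (by simpa using (le_of_lt ht)) _
      exact this.trans_isBigO (Asymptotics.isBigO_zero _ _)
  exact hm.comp s (by fun_prop)

/-- Partial summation. -/
theorem sub_one_mul_LSeries_eq (χ : DirichletCharacter ℂ q) {s : ℂ} (hs : 1 < s.re) :
    (s - 1) * LSeries (fun n => χ n) s =
      charMean χ * s + (s - 1) * (s * remainderTransform χ s) := by
  have hs1 : s - 1 ≠ 0 := by
    intro h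
    rw [sub_eq_zero.mp h] at hs
    norm_num at hs
  have hO : (fun n : ℕ => ∑ k ∈ Finset.Icc 1 n, χ (k : ZMod q)) =O[Filter.atTop]
      fun n : ℕ => (n : ℝ) ^ (1 : ℝ) := by
    refine Asymptotics.IsBigO.of_bound 1 (Filter.Eventually.of_forall fun n => ?_)
    refine (norm_sum_le _ _).trans ?_
    calc _ ≤ ∑ k ∈ Finset.Icc 1 n, (1 : ℝ) := Finset.sum_le_sum fun k _ => χ.norm_le_one _
      _ = n := by simp
      _ ≤ _ := by simp
  rw [LSeries_eq_mul_integral (fun n => χ n) zero_le_one hs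
    (LSeriesSummable_of_one_lt_re χ hs) hO]
  have h1 : ∀ t ∈ Ioi (1 : ℝ), (∑ k ∈ Finset.Icc 1 ⌊t⌋₊, χ (k : ZMod q)) * (t : ℂ) ^ (-(s + 1)) =
      charMean χ * (t : ℂ) ^ (-s) + charRemainder χ t * (t : ℂ) ^ (-(s + 1)) := by
    intro t ht
    have ht0 : (t : ℂ) ≠ 0 := by
      exact_mod_cast (lt_trans zero_lt_one (show (1 : ℝ) < t from ht)).ne'
    have h2 : (t : ℂ) ^ (-s) = t * (t : ℂ) ^ (-(s + 1)) := by
      rw [show -s = 1 + -(s + 1) by ring, cpow_add _ _ ht0, cpow_one]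
    rw [h2, charRemainder]; ring
  have hre : (-s).re < -1 := by simpa using hs
  have hI : IntegrableOn (fun t : ℝ => (t : ℂ) ^ (-s)) (Ioi 1) :=
    integrableOn_Ioi_cpow_of_lt hre zero_lt_one
  rw [setIntegral_congr_fun measurableSet_Ioi h1, integral_add (hI.const_mul _)
    (integrableOn_charRemainder_mul_cpow χ (by linarith)), integral_const_mul,
    integral_Ioi_cpow_of_lt hre zero_lt_one, ← remainderTransform]
  have h3 : -s + 1 = -(s - 1) := by ring
  rw [h3, ofReal_one, one_cpow, neg_div_neg_eq]
  field_simp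

/-- The Dirichlet `L`-function deprived of its possible pole: `(s - 1) L(s, χ)` if `χ` is principal
and `L(s, χ)` otherwise. -/
noncomputable def entireL (χ : DirichletCharacter ℂ q) : ℂ → ℂ :=
  open Classical in if χ = 1 then LFunctionTrivChar₁ q else LFunction χ

/-- The order of the pole of `L(s, χ)` at `s = 1`. -/
noncomputable def poleOrder (χ : DirichletCharacter ℂ q) : ℂ :=
  open Classical in if χ = 1 then 1 else 0

theorem differentiable_entireL (χ : DirichletCharacter ℂ q) : Differentiable ℂ (entireL χ) := by
  unfold entireL
  split_ifs with h
  · exact differentiable_LFunctionTrivChar₁ q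
  · exact differentiable_LFunction h

theorem entireL_one {s : ℂ} (hs : s ≠ 1) :
    entireL (1 : DirichletCharacter ℂ q) s = (s - 1) * LFunction (1 : DirichletCharacter ℂ q) s := by
  simp only [entireL, if_true]
  exact Function.update_of_ne hs _ _

theorem entireL_of_ne {χ : DirichletCharacter ℂ q} (hχ : χ ≠ 1) : entireL χ = LFunction χ := by
  simp only [entireL, if_neg hχ]

/-- The formula obtained by partial summation for `Re s > 1` persists on `Re s > 0` by the identity
theorem. -/
theorem entireL_one_eq_on : EqOn (entireL (1 : DirichletCharacter ℂ q))
    (fun s => charMean (1 : DirichletCharacter ℂ q) * s +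
      (s - 1) * (s * remainderTransform (1 : DirichletCharacter ℂ q) s)) rightHalfPlane := by
  have hpre : IsPreconnected rightHalfPlane := (convex_halfSpace_re_gt 0).isPreconnected
  refine AnalyticOnNhd.eqOn_of_preconnected_of_eventuallyEq (z₀ := 2)
    ((differentiable_entireL _).differentiableOn.analyticOnNhd isOpen_rightHalfPlane)
    (DifferentiableOn.analyticOnNhd ?_ isOpen_rightHalfPlane) hpre
    (by change (0 : ℝ) < (2 : ℂ).re; norm_num) ?_
  · have := differentiableOn_remainderTransform (1 : DirichletCharacter ℂ q)
    fun_prop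
  · filter_upwards [(isOpen_lt continuous_const continuous_re).mem_nhds
      (show (1 : ℝ) < (2 : ℂ).re by norm_num)] with s hs
    have hs' : 1 < s.re := hs
    rw [entireL_one (by rintro rfl; norm_num at hs'), LFunction_eq_LSeries _ hs',
      sub_one_mul_LSeries_eq _ hs']

theorem entireL_eq_on_of_ne {χ : DirichletCharacter ℂ q} (hχ : χ ≠ 1) :
    EqOn (entireL χ) (fun s => s * remainderTransform χ s) rightHalfPlane := by
  have hpre : IsPreconnected rightHalfPlane := (convex_halfSpace_re_gt 0).isPreconnected
  refine AnalyticOnNhd.eqOn_of_preconnected_of_eventuallyEq (z₀ := 2)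
    ((differentiable_entireL _).differentiableOn.analyticOnNhd isOpen_rightHalfPlane)
    (DifferentiableOn.analyticOnNhd ?_ isOpen_rightHalfPlane) hpre
    (by change (0 : ℝ) < (2 : ℂ).re; norm_num) ?_
  · have := differentiableOn_remainderTransform χ
    fun_prop
  · filter_upwards [(isOpen_lt continuous_const continuous_re).mem_nhds
      (show (1 : ℝ) < (2 : ℂ).re by norm_num)] with s hs
    have hs' : 1 < s.re := hs
    have h1 : s - 1 ≠ 0 := sub_ne_zero.mpr (by rintro rfl; norm_num at hs')
    rw [entireL_of_ne hχ, LFunction_eq_LSeries _ hs']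
    have := sub_one_mul_LSeries_eq χ hs'
    rw [charMean_eq_zero hχ, zero_mul, zero_add] at this
    exact mul_left_cancel₀ h1 this

/-- Polynomial growth of `L`-functions to the right of the line `Re s = 0`. -/
theorem norm_entireL_le (χ : DirichletCharacter ℂ q) {c : ℝ} (hc : 0 < c) {s : ℂ}
    (hs : c ≤ s.re) : ‖entireL χ s‖ ≤ (‖s‖ + 1) ^ 2 * (1 + 5 * q / c) := by
  have hsr : s ∈ rightHalfPlane := lt_of_lt_of_le hc hs
  have hI : ‖remainderTransform χ s‖ ≤ 5 * q / c :=
    (norm_remainderTransform_le χ hsr).trans (by gcongr)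
  have h0 := norm_nonneg s
  have hb : 0 ≤ 5 * q / c := by positivity
  by_cases hχ : χ = 1
  · subst hχ
    rw [entireL_one_eq_on hsr]
    have h1 : ‖s - 1‖ ≤ ‖s‖ + 1 := (norm_sub_le _ _).trans (by simp)
    calc _ ≤ ‖charMean (1 : DirichletCharacter ℂ q)‖ * ‖s‖ +
          ‖s - 1‖ * (‖s‖ * ‖remainderTransform (1 : DirichletCharacter ℂ q) s‖) := by
          refine (norm_add_le _ _).trans (le_of_eq ?_)
          simp only [norm_mul]
      _ ≤ 1 * ‖s‖ + (‖s‖ + 1) * (‖s‖ * (5 * q / c)) := by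
          gcongr
          exact norm_charMean_le_one _
      _ ≤ _ := by nlinarith [mul_nonneg h0 hb]
  · rw [entireL_eq_on_of_ne hχ hsr, norm_mul]
    calc _ ≤ ‖s‖ * (5 * q / c) := by gcongr
      _ ≤ _ := by nlinarith [mul_nonneg h0 hb, mul_nonneg (mul_nonneg h0 h0) hb]

omit [NeZero q] in
/-- On `Re s = 2` the first term of the Dirichlet series dominates, because `ζ(2) - 1 < 3 / 4`. -/
theorem norm_LSeries_char_ge (χ : DirichletCharacter ℂ q) {s : ℂ} (hs : s.re = 2) :
    1 / 4 ≤ ‖LSeries (fun n => χ n) s‖ := by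
  have hsum := LSeriesSummable_of_one_lt_re χ (show 1 < s.re by rw [hs]; norm_num)
  have hz := hasSum_zeta_two
  have h1 : LSeries (fun n => χ n) s = LSeries.term (fun n => χ n) s 1 +
      ∑' n, if n = 1 then 0 else LSeries.term (fun n => χ n) s n :=
    hsum.tsum_eq_add_tsum_ite 1
  have h2 := hz.summable.tsum_eq_add_tsum_ite 1
  rw [hz.tsum_eq] at h2
  have hz' : Summable (fun n : ℕ => if n = 1 then 0 else 1 / (n : ℝ) ^ 2) := by
    refine hz.summable.of_nonneg_of_le (fun n => ?_) (fun n => ?_) <;> split_ifs <;>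
      first | positivity | exact le_rfl
  have h3 : ‖∑' n, if n = 1 then 0 else LSeries.term (fun n => χ n) s n‖ ≤
      ∑' n : ℕ, if n = 1 then 0 else 1 / (n : ℝ) ^ 2 := by
    refine tsum_of_norm_bounded hz'.hasSum fun n => ?_
    split_ifs with hn
    · simp
    · rw [LSeries.norm_term_eq, hs]
      split_ifs with h0
      · positivity
      · have := χ.norm_le_one (n : ZMod q)
        rw [Real.rpow_two]
        gcongr
  have h4 : LSeries.term (fun n => χ n) s 1 = 1 := by simp
  have h5 : Real.pi ^ 2 / 6 < 1.66 := by
    have := Real.pi_lt_d2; have := Real.pi_pos; nlinarith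
  rw [h1, h4]
  have h6 := norm_sub_le_norm_add (1 : ℂ) (∑' n, if n = 1 then 0 else LSeries.term (fun n => χ n) s n)
  rw [norm_one] at h6
  have h7 : 1 / ((1 : ℕ) : ℝ) ^ 2 = 1 := by norm_num
  rw [h7] at h2
  linarith

/-- A lower bound at the centres of the discs in which the zeros are counted. -/
theorem norm_entireL_ge (χ : DirichletCharacter ℂ q) (t : ℝ) :
    1 / 4 ≤ ‖entireL χ (2 + t * I)‖ := by
  have hre : (2 + t * I : ℂ).re = 2 := by simp
  have h1 := norm_LSeries_char_ge χ hre
  have hs' : 1 < (2 + t * I : ℂ).re := by rw [hre]; norm_num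
  rw [← LFunction_eq_LSeries _ hs'] at h1
  by_cases hχ : χ = 1
  · subst hχ
    rw [entireL_one (by intro h; rw [h] at hre; norm_num at hre), norm_mul]
    have h2 : 1 ≤ ‖(2 + t * I : ℂ) - 1‖ := by
      have := (le_abs_self _).trans (abs_re_le_norm ((2 + t * I : ℂ) - 1))
      simp at this
      linarith
    nlinarith
  · rwa [entireL_of_ne hχ]

end Growth

/-! ### Logarithmic derivatives of Dirichlet `L`-functions under GRH -/

section Zeros

variable {q : ℕ} [NeZero q]

/-- Near a point other than `1`, `entireL χ` is `L(s, χ)` times a nonvanishing factor, whose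
logarithmic derivative accounts for the pole. -/
theorem entireL_eq_mul (χ : DirichletCharacter ℂ q) {s : ℂ} (hs : s ≠ 1) :
    ∃ u : ℂ → ℂ, AnalyticAt ℂ u s ∧ u s ≠ 0 ∧ entireL χ =ᶠ[nhds s] u * LFunction χ ∧
      logDeriv u s = poleOrder χ / (s - 1) := by
  by_cases hχ : χ = 1
  · subst hχ
    refine ⟨fun s => s - 1, by fun_prop, sub_ne_zero.mpr hs, ?_, ?_⟩
    · filter_upwards [isOpen_ne.mem_nhds hs] with w hw using entireL_one hw
    · simp [logDeriv_apply, poleOrder]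
  · refine ⟨fun _ => 1, by fun_prop, one_ne_zero, ?_, ?_⟩
    · rw [entireL_of_ne hχ]
      exact Filter.Eventually.of_forall fun w => by simp
    · simp [logDeriv_apply, poleOrder, hχ]

theorem entireL_eq_zero_iff (χ : DirichletCharacter ℂ q) {s : ℂ} (hs : s ≠ 1) :
    entireL χ s = 0 ↔ LFunction χ s = 0 := by
  obtain ⟨u, _, hu0, hev, _⟩ := entireL_eq_mul χ hs
  rw [hev.self_of_nhds, Pi.mul_apply, mul_eq_zero, or_iff_right hu0]

theorem analyticAt_LFunction (χ : DirichletCharacter ℂ q) {s : ℂ} (hs : s ≠ 1) :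
    AnalyticAt ℂ (LFunction χ) s := by
  have : DifferentiableOn ℂ (LFunction χ) {1}ᶜ := fun w hw =>
    (differentiableAt_LFunction χ w (Or.inl hw)).differentiableWithinAt
  exact this.analyticAt (isOpen_compl_singleton.mem_nhds hs)

theorem analyticOrderNatAt_entireL (χ : DirichletCharacter ℂ q) {s : ℂ} (hs : s ≠ 1) :
    analyticOrderNatAt (entireL χ) s = analyticOrderNatAt (LFunction χ) s := by
  obtain ⟨u, hu, hu0, hev, _⟩ := entireL_eq_mul χ hs
  rw [analyticOrderNatAt, analyticOrderNatAt, analyticOrderAt_congr hev,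
    analyticOrderAt_mul hu (analyticAt_LFunction χ hs), hu.analyticOrderAt_eq_zero.mpr hu0, zero_add]

theorem re_eq_of_entireL_eq_zero (hGRH : GRH) (χ : DirichletCharacter ℂ q) {s : ℂ}
    (hs : s ∈ rightHalfPlane) (h0 : entireL χ s = 0) : s.re = 1 / 2 := by
  have hs0 : 0 < s.re := hs
  by_cases hs1 : s = 1
  · exfalso
    subst hs1
    by_cases hχ : χ = 1
    · subst hχ
      simp only [entireL, if_true] at h0
      exact LFunctionTrivChar₁_apply_one_ne_zero q h0
    · rw [entireL_of_ne hχ] at h0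
      exact LFunction_apply_one_ne_zero hχ h0
  · rw [entireL_eq_zero_iff χ hs1] at h0
    rcases lt_or_ge s.re 1 with h | h
    · exact hGRH q χ s hs0 h h0
    · exact absurd h0 (LFunction_ne_zero_of_one_le_re χ (Or.inr hs1) h)

theorem LSeries_twist_eq (χ : DirichletCharacter ℂ q) {s : ℂ} (hs : 1 < s.re) :
    LSeries ((fun n : ℕ => χ n) * fun n : ℕ => (ArithmeticFunction.vonMangoldt n : ℂ)) s =
      -logDeriv (entireL χ) s + poleOrder χ / (s - 1) := by
  have hs1 : s ≠ 1 := by rintro rfl; norm_num at hs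
  obtain ⟨u, hu, hu0, hev, hlog⟩ := entireL_eq_mul χ hs1
  have hL0 := LFunction_ne_zero_of_one_le_re χ (Or.inr hs1) hs.le
  have h1 : logDeriv (entireL χ) s = logDeriv u s + logDeriv (LFunction χ) s := by
    rw [← logDeriv_mul s hu0 hL0 hu.differentiableAt (analyticAt_LFunction χ hs1).differentiableAt]
    rw [logDeriv_apply, logDeriv_apply, hev.deriv_eq, hev.self_of_nhds]
    rfl
  rw [LSeries_twist_vonMangoldt_eq χ hs, h1, hlog, logDeriv_apply,
    deriv_LFunction_eq_deriv_LSeries χ hs, LFunction_eq_LSeries χ hs]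
  ring

/-- The finite set of ordinates of the zeros of `L(s, χ)` on the critical line up to height `T`. -/
noncomputable def ords (χ : DirichletCharacter ℂ q) (T : ℝ) : Finset ℝ :=
  (ordinates_finite χ T).toFinset

theorem critPoint_injective : Function.Injective critPoint := by
  intro u v huv
  have := congrArg Complex.im huv
  simpa [critPoint] using this

@[simp] theorem critPoint_re (γ : ℝ) : (critPoint γ).re = 1 / 2 := by
  simp [critPoint]

@[simp] theorem critPoint_im (γ : ℝ) : (critPoint γ).im = γ := by
  simp [critPoint]

open Classical in
theorem mem_image_critPoint_ords (hGRH : GRH) (χ : DirichletCharacter ℂ q) (T : ℝ) (s : ℂ) :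
    s ∈ (ords χ T).image critPoint ↔ 0 < s.re ∧ |s.im| ≤ T ∧ entireL χ s = 0 := by
  simp only [Finset.mem_image, ords, Set.Finite.mem_toFinset, ordinates]
  constructor
  · rintro ⟨γ, ⟨h1, h2⟩, rfl⟩
    refine ⟨by simp, by simpa using h1, ?_⟩
    rw [entireL_eq_zero_iff χ (critPoint_ne_one γ)]
    exact h2
  · rintro ⟨h1, h2, h3⟩
    have hre := re_eq_of_entireL_eq_zero hGRH χ h1 h3
    have hs : critPoint s.im = s := by
      apply Complex.ext
      · rw [critPoint_re, hre]
      · simp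
    refine ⟨s.im, ⟨h2, ?_⟩, hs⟩
    rw [hs, ← entireL_eq_zero_iff χ (by rw [← hs]; exact critPoint_ne_one _)]
    exact h3

/-- The sum of `‖Λ(n) n⁻²‖`, which bounds the logarithmic derivatives of all Dirichlet
`L`-functions on the line `Re s = 2`. -/
noncomputable def logDerivBound : ℝ :=
  ∑' n : ℕ, ‖LSeries.term (fun n => (ArithmeticFunction.vonMangoldt n : ℂ)) 2 n‖

theorem logDerivBound_nonneg : 0 ≤ logDerivBound := tsum_nonneg fun _ => norm_nonneg _

omit [NeZero q] in
theorem norm_LSeries_twist_le (χ : DirichletCharacter ℂ q) {s : ℂ} (hs : s.re = 2) :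
    ‖LSeries ((fun n : ℕ => χ n) * fun n : ℕ => (ArithmeticFunction.vonMangoldt n : ℂ)) s‖ ≤
      logDerivBound := by
  have hsum : Summable fun n => ‖LSeries.term
      (fun n => (ArithmeticFunction.vonMangoldt n : ℂ)) 2 n‖ :=
    (ArithmeticFunction.LSeriesSummable_vonMangoldt (s := 2) (by norm_num)).norm
  refine tsum_of_norm_bounded hsum.hasSum fun n => ?_
  rw [LSeries.norm_term_eq, LSeries.norm_term_eq, hs]
  split_ifs
  · exact le_rfl
  · rw [Pi.mul_apply, norm_mul]
    have := χ.norm_le_one (n : ZMod q)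
    norm_num
    gcongr
    exact mul_le_of_le_one_left (abs_nonneg _) this

/-- Under GRH, minus the logarithmic derivative of `L(s, χ)`, deprived of its pole at `1` and of its
poles at the zeros up to height `T`, is `O(T log X)` inside the critical strip up to height
`T - 4`, as well as on the line `Re s = 2`; here `X` bounds `q` and `T`. -/
theorem exists_LSeries_twist_eq (hGRH : GRH) {c : ℝ} (hc : 0 < c) (hc' : c ≤ 1 / 16) :
    ∃ K X₀ : ℝ, 0 < K ∧ 3 ≤ X₀ ∧ ∀ X : ℝ, X₀ ≤ X → ∀ (q : ℕ) [NeZero q], (q : ℝ) ≤ X →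
      ∀ (χ : DirichletCharacter ℂ q) (T : ℝ), 1 ≤ T → T ≤ X → ∃ g : ℂ → ℂ,
        (∀ s ∈ rightHalfPlane, (|s.im| ≤ T ∨ s.re = 2) → DifferentiableAt ℂ g s) ∧
        (∀ s : ℂ, 1 < s.re →
          LSeries ((fun n : ℕ => χ n) * fun n : ℕ => (ArithmeticFunction.vonMangoldt n : ℂ)) s -
            poleOrder χ / (s - 1) + ∑ γ ∈ ords χ T, mult χ γ / (s - critPoint γ) = g s) ∧
        (∀ t : ℝ, ‖g (2 + t * I)‖ ≤ K * Real.log X * T) ∧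
        ∀ s : ℂ, 4 * c ≤ s.re → s.re ≤ 2 → |s.im| ≤ T - 4 → ‖g s‖ ≤ K * Real.log X * T := by
  classical
  obtain ⟨K, hK, hmain⟩ := exists_factor_norm_logDeriv_le hc hc'
  have hB := logDerivBound_nonneg
  refine ⟨4 * K + logDerivBound + 1, 864 / c + 3, by positivity, by
    have : 0 < 864 / c := by positivity
    linarith, ?_⟩
  intro X hX q _ hqX χ T hT1 hTX
  have hcpos : 0 < 864 / c := by positivity
  have hX3 : 3 ≤ X := by linarith
  have hlog : 1 ≤ Real.log X := by
    rw [Real.le_log_iff_exp_le (by linarith)]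
    have := Real.exp_one_lt_d9; linarith
  have hq1 : (1 : ℝ) ≤ q := by exact_mod_cast Nat.pos_of_neZero q
  have hgrowth : ∀ t : ℝ, |t| ≤ T → ∀ s ∈ closedBall (2 + t * I : ℂ) (2 - c),
      ‖entireL χ s‖ ≤ Real.exp (4 * Real.log X) * ‖entireL χ (2 + t * I)‖ := by
    intro t ht s hs
    have h1 : ‖s - (2 + t * I)‖ ≤ 2 - c := by simpa [dist_eq_norm] using hs
    have hre : c ≤ s.re := by
      have h2 := (abs_le.mp ((abs_re_le_norm _).trans h1)).1
      simp at h2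
      linarith
    have hnorm : ‖s‖ + 1 ≤ 6 * X := by
      have h3 : ‖(2 + t * I : ℂ)‖ ≤ 2 + |t| := by
        refine (norm_add_le _ _).trans ?_
        simp
      have h4 : ‖s‖ ≤ ‖s - (2 + t * I)‖ + ‖(2 + t * I : ℂ)‖ := by
        simpa using norm_add_le (s - (2 + t * I)) (2 + t * I : ℂ)
      linarith
    have h5 := norm_entireL_le χ hc hre
    have h6 : 1 + 5 * q / c ≤ 6 * X / c := by
      rw [← sub_nonneg]
      have : 6 * X / c - (1 + 5 * q / c) = (6 * X - c - 5 * q) / c := by field_simp; ring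
      rw [this]
      exact div_nonneg (by linarith) hc.le
    have h7 : ‖entireL χ s‖ ≤ (6 * X) ^ 2 * (6 * X / c) := by
      refine h5.trans ?_
      gcongr
    have h8 : Real.exp (4 * Real.log X) = X ^ 4 := by
      rw [mul_comm, Real.exp_mul, Real.exp_log (by linarith)]; norm_num
    have h9 := norm_entireL_ge χ t
    rw [h8]
    calc ‖entireL χ s‖ ≤ (6 * X) ^ 2 * (6 * X / c) := h7
      _ = (864 / c) * X ^ 3 * (1 / 4) := by ring
      _ ≤ X * X ^ 3 * (1 / 4) := by gcongr; linarith
      _ = X ^ 4 * (1 / 4) := by ring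
      _ ≤ _ := by gcongr
  set Z := (ords χ T).image critPoint with hZ
  have hZmem := mem_image_critPoint_ords hGRH χ T
  obtain ⟨h, hh, hfac, hne, hcount, hbound⟩ := hmain (entireL χ) (4 * Real.log X) T Z
    (differentiable_entireL χ).differentiableOn (fun s hs h0 => re_eq_of_entireL_eq_zero hGRH χ hs h0)
    (by positivity) hT1 hgrowth hZmem
  have hsumZ : ∀ φ : ℂ → ℂ, ∑ ρ ∈ Z, (analyticOrderNatAt (entireL χ) ρ : ℂ) / φ ρ =
      ∑ γ ∈ ords χ T, mult χ γ / φ (critPoint γ) := by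
    intro φ
    rw [hZ, Finset.sum_image (fun a _ b _ hab => critPoint_injective hab)]
    refine Finset.sum_congr rfl fun γ _ => ?_
    rw [analyticOrderNatAt_entireL χ (critPoint_ne_one γ), mult]
  have hne0 : ∀ s : ℂ, 1 < s.re → entireL χ s ≠ 0 := by
    intro s hs h0
    have := re_eq_of_entireL_eq_zero hGRH χ (show 0 < s.re by linarith) h0
    linarith
  have hhne : ∀ s ∈ rightHalfPlane, (|s.im| ≤ T ∨ s.re = 2) → h s ≠ 0 := by
    intro s hs hor
    rcases hor with h1 | h1
    · exact hne s hs h1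
    · exact right_ne_zero_of_mul (hfac s hs ▸ hne0 s (by rw [h1]; norm_num))
  have hlogD : ∀ s : ℂ, 1 < s.re → logDeriv (entireL χ) s =
      ∑ γ ∈ ords χ T, mult χ γ / (s - critPoint γ) + logDeriv h s := by
    intro s hs
    rw [logDeriv_prod_sub_pow_mul isOpen_rightHalfPlane hh hfac (show 0 < s.re by linarith)
      (hne0 s hs) (fun ρ hρ => ((hZmem ρ).mp hρ).2.2), hsumZ (fun ρ => s - ρ)]
  refine ⟨fun s => -logDeriv h s, ?_, ?_, ?_, ?_⟩
  · intro s hs hor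
    have hn := isOpen_rightHalfPlane.mem_nhds hs
    exact (((hh.deriv isOpen_rightHalfPlane).differentiableAt hn).div (hh.differentiableAt hn)
      (hhne s hs hor)).neg
  · intro s hs
    rw [LSeries_twist_eq χ hs, hlogD s hs]; ring
  · intro t
    have hre : (2 + t * I : ℂ).re = 2 := by simp
    have hs' : 1 < (2 + t * I : ℂ).re := by rw [hre]; norm_num
    have h1 := LSeries_twist_eq χ hs'
    rw [hlogD _ hs'] at h1
    have h2 : -logDeriv h (2 + t * I) =
        LSeries ((fun n : ℕ => χ n) * fun n : ℕ => (ArithmeticFunction.vonMangoldt n : ℂ)) (2 + t * I) -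
          poleOrder χ / (2 + t * I - 1) + ∑ γ ∈ ords χ T, mult χ γ / (2 + t * I - critPoint γ) := by
      rw [h1]; ring
    have hge1 : ∀ ρ : ℂ, ρ.re ≤ 1 → 1 ≤ ‖(2 + t * I : ℂ) - ρ‖ := by
      intro ρ hρ
      have := (le_abs_self _).trans (abs_re_le_norm ((2 + t * I : ℂ) - ρ))
      simp at this
      linarith
    have h3 : ‖poleOrder χ / (2 + t * I - 1)‖ ≤ 1 := by
      rw [norm_div]
      refine div_le_one_of_le₀ ?_ (norm_nonneg _)
      refine le_trans ?_ (hge1 1 (by simp))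
      unfold poleOrder
      split_ifs <;> simp
    have h4 : ‖∑ γ ∈ ords χ T, (mult χ γ : ℂ) / (2 + t * I - critPoint γ)‖ ≤
        K * (4 * Real.log X) * T := by
      have h5 := hsumZ (fun ρ => 2 + t * I - ρ)
      rw [← h5]
      refine (norm_sum_le _ _).trans (le_trans (Finset.sum_le_sum fun ρ hρ => ?_) hcount)
      rw [norm_div, Complex.norm_natCast]
      refine div_le_self (by positivity) (hge1 ρ ?_)
      have := re_eq_of_entireL_eq_zero hGRH χ ((hZmem ρ).mp hρ).1 ((hZmem ρ).mp hρ).2.2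
      rw [this]; norm_num
    change ‖-logDeriv h (2 + t * I)‖ ≤ _
    rw [h2]
    have h6 := norm_LSeries_twist_le χ hre
    have hlT : 1 ≤ Real.log X * T := by nlinarith
    calc _ ≤ logDerivBound + 1 + K * (4 * Real.log X) * T := by
          refine (norm_add_le _ _).trans (add_le_add ?_ h4)
          exact (norm_sub_le _ _).trans (add_le_add h6 h3)
      _ ≤ (logDerivBound + 1) * (Real.log X * T) + K * (4 * Real.log X) * T := by
          gcongr
          exact le_mul_of_one_le_right (by linarith) hlT
      _ = _ := by ring
  · intro s h1 h2 h3
    rw [norm_neg]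
    refine (hbound s h1 h2 h3).trans ?_
    have hlT : 0 ≤ Real.log X * T := by positivity
    nlinarith [mul_nonneg hB hlT]

end Zeros

/-! ### Inversion of Laplace transforms against a Gaussian -/

/-- The Gaussian density of standard deviation `δ`. -/
noncomputable def gaussKernel (δ y : ℝ) : ℝ :=
  (√(2 * Real.pi) * δ)⁻¹ * Real.exp (-y ^ 2 / (2 * δ ^ 2))

/-- The Mellin–Laplace weight `e^{δ²s²/2 + sz}` whose inverse transform is the Gaussian density. -/
noncomputable def laplaceKernel (δ z : ℝ) (s : ℂ) : ℂ :=
  cexp ((δ : ℂ) ^ 2 * s ^ 2 / 2 + s * z)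

theorem norm_laplaceKernel (δ z σ t : ℝ) :
    ‖laplaceKernel δ z (σ + t * I)‖ = Real.exp (δ ^ 2 * (σ ^ 2 - t ^ 2) / 2 + σ * z) := by
  rw [laplaceKernel, norm_exp]
  congr 1
  have : (δ : ℂ) ^ 2 * (σ + t * I) ^ 2 / 2 + (σ + t * I) * z =
      ((δ ^ 2 * (σ ^ 2 - t ^ 2) / 2 + σ * z : ℝ) : ℂ) + ((δ ^ 2 * σ * t + t * z : ℝ) : ℂ) * I := by
    push_cast
    linear_combination ((δ : ℂ) ^ 2 * t ^ 2 / 2) * I_sq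
  rw [this]; simp [-ofReal_add, -ofReal_mul, -ofReal_sub, -ofReal_pow, -ofReal_div]

theorem integrable_norm_laplaceKernel {δ : ℝ} (hδ : 0 < δ) (z σ : ℝ) :
    Integrable (fun t : ℝ => laplaceKernel δ z (σ + t * I)) := by
  have h1 : Integrable (fun t : ℝ =>
      Real.exp (δ ^ 2 * σ ^ 2 / 2 + σ * z) * Real.exp (-(δ ^ 2 / 2) * t ^ 2)) :=
    (integrable_exp_neg_mul_sq (by positivity)).const_mul _
  refine h1.mono' ?_ (Filter.Eventually.of_forall fun t => ?_)
  · refine Continuous.aestronglyMeasurable ?_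
    unfold laplaceKernel; fun_prop
  · rw [norm_laplaceKernel, ← Real.exp_add]
    refine le_of_eq ?_
    congr 1; ring

theorem integral_laplaceKernel {δ : ℝ} (hδ : 0 < δ) (y σ : ℝ) :
    ∫ t : ℝ, laplaceKernel δ y (σ + t * I) = 2 * Real.pi * gaussKernel δ y := by
  have hδC : (δ : ℂ) ≠ 0 := by exact_mod_cast hδ.ne'
  have hb : (((-(δ ^ 2 / 2) : ℝ)) : ℂ).re < 0 := by rw [ofReal_re]; have := pow_pos hδ 2; linarith
  have h := integral_cexp_quadratic hb (((δ ^ 2 * σ + y : ℝ) : ℂ) * I)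
    ((δ ^ 2 * σ ^ 2 / 2 + σ * y : ℝ) : ℂ)
  have h1 : ∀ t : ℝ, laplaceKernel δ y (σ + t * I) =
      cexp (((-(δ ^ 2 / 2) : ℝ) : ℂ) * t ^ 2 + ((δ ^ 2 * σ + y : ℝ) : ℂ) * I * t +
        ((δ ^ 2 * σ ^ 2 / 2 + σ * y : ℝ) : ℂ)) := by
    intro t
    rw [laplaceKernel]
    congr 1
    push_cast
    linear_combination ((δ : ℂ) ^ 2 * t ^ 2 / 2) * I_sq
  simp_rw [h1]
  rw [h]
  have h2 : ((δ ^ 2 * σ ^ 2 / 2 + σ * y : ℝ) : ℂ) - (((δ ^ 2 * σ + y : ℝ) : ℂ) * I) ^ 2 /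
      (4 * ((-(δ ^ 2 / 2) : ℝ) : ℂ)) = ((-y ^ 2 / (2 * δ ^ 2) : ℝ) : ℂ) := by
    push_cast
    rw [mul_pow, I_sq]
    field_simp
    ring
  have h3 : ((Real.pi : ℂ) / -((-(δ ^ 2 / 2) : ℝ) : ℂ)) ^ (1 / 2 : ℂ) =
      ((√(2 * Real.pi) / δ : ℝ) : ℂ) := by
    have h4 : (Real.pi : ℂ) / -((-(δ ^ 2 / 2) : ℝ) : ℂ) = ((Real.pi / (δ ^ 2 / 2) : ℝ) : ℂ) := by
      push_cast; ring
    rw [h4, show (1 / 2 : ℂ) = ((1 / 2 : ℝ) : ℂ) by push_cast; rfl, ← ofReal_cpow (by positivity),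
      ← Real.sqrt_eq_rpow]
    congr 1
    rw [show Real.pi / (δ ^ 2 / 2) = 2 * Real.pi / δ ^ 2 by field_simp,
      Real.sqrt_div' _ (by positivity), Real.sqrt_sq hδ.le]
  rw [h2, h3, ← ofReal_exp, gaussKernel]
  have h5 : √(2 * Real.pi) / δ = 2 * Real.pi * (√(2 * Real.pi) * δ)⁻¹ := by
    have h6 : √(2 * Real.pi) * √(2 * Real.pi) = 2 * Real.pi :=
      Real.mul_self_sqrt (by positivity)
    have h7 : √(2 * Real.pi) ≠ 0 := by positivity
    field_simp
    rw [sq, h6]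
  rw [h5]; push_cast; ring

theorem mul_cexp_laplaceKernel (δ z r : ℝ) (b s : ℂ) :
    laplaceKernel δ z s * (b * cexp (-s * r)) = b * laplaceKernel δ (z - r) s := by
  have : laplaceKernel δ (z - r) s = laplaceKernel δ z s * cexp (-s * r) := by
    rw [laplaceKernel, laplaceKernel, ← Complex.exp_add]; congr 1; push_cast; ring
  rw [this]; ring

section Laplace

variable {α : Type*} [MeasurableSpace α] {ν : Measure α} [SFinite ν] {r : α → ℝ} {b : α → ℂ}
  {δ σ : ℝ}

omit [SFinite ν] in
theorem integrable_laplace_prod (hδ : 0 < δ) (hr : Measurable r)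
    (hb : Integrable (fun x => b x * cexp (-(σ : ℂ) * r x)) ν) (z : ℝ) :
    Integrable (fun p : ℝ × α => laplaceKernel δ z (σ + p.1 * I) *
      (b p.2 * cexp (-(σ + p.1 * I) * r p.2))) (volume.prod ν) := by
  have h1 := (integrable_norm_laplaceKernel hδ z σ).mul_prod hb
  have h2 : (fun p : ℝ × α => laplaceKernel δ z (σ + p.1 * I) *
      (b p.2 * cexp (-(σ + p.1 * I) * r p.2))) = fun p : ℝ × α => cexp (-(p.1 * r p.2 : ℝ) * I) *
        (laplaceKernel δ z (σ + p.1 * I) * (b p.2 * cexp (-(σ : ℂ) * r p.2))) := by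
    ext p
    have : cexp (-(σ + p.1 * I) * r p.2) =
        cexp (-(p.1 * r p.2 : ℝ) * I) * cexp (-(σ : ℂ) * r p.2) := by
      rw [← Complex.exp_add]; congr 1; push_cast; ring
    rw [this]; ring
  rw [h2]
  refine h1.bdd_mul (c := 1) ?_ (Filter.Eventually.of_forall fun p => ?_)
  · refine Measurable.aestronglyMeasurable ?_
    fun_prop
  · rw [← ofReal_neg, norm_exp_ofReal_mul_I]

/-- Inversion of the Laplace transform of a complex measure `b ν`, placed on the line by `r`,
against a Gaussian. -/
theorem integral_laplaceKernel_mul (hδ : 0 < δ) (hr : Measurable r)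
    (hb : Integrable (fun x => b x * cexp (-(σ : ℂ) * r x)) ν) (z : ℝ) :
    ∫ t : ℝ, laplaceKernel δ z (σ + t * I) * ∫ x, b x * cexp (-(σ + t * I) * r x) ∂ν =
      2 * Real.pi * ∫ x, b x * gaussKernel δ (z - r x) ∂ν := by
  have h := integrable_laplace_prod hδ hr hb z
  have h1 : ∀ t : ℝ, laplaceKernel δ z (σ + t * I) * ∫ x, b x * cexp (-(σ + t * I) * r x) ∂ν =
      ∫ x, laplaceKernel δ z (σ + t * I) * (b x * cexp (-(σ + t * I) * r x)) ∂ν := fun t =>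
    (integral_const_mul _ _).symm
  simp_rw [h1]
  rw [integral_integral_swap h, ← integral_const_mul]
  refine integral_congr_ae (Filter.Eventually.of_forall fun x => ?_)
  have h2 : ∀ t : ℝ, laplaceKernel δ z (σ + t * I) * (b x * cexp (-(σ + t * I) * r x)) =
      b x * laplaceKernel δ (z - r x) (σ + t * I) := fun t => mul_cexp_laplaceKernel _ _ _ _ _
  simp_rw [h2]
  rw [integral_const_mul, integral_laplaceKernel hδ]; ring

theorem integrable_laplaceKernel_mul (hδ : 0 < δ) (hr : Measurable r)
    (hb : Integrable (fun x => b x * cexp (-(σ : ℂ) * r x)) ν) (z : ℝ) :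
    Integrable fun t : ℝ =>
      laplaceKernel δ z (σ + t * I) * ∫ x, b x * cexp (-(σ + t * I) * r x) ∂ν := by
  refine (integrable_laplace_prod hδ hr hb z).integral_prod_left.congr
    (Filter.Eventually.of_forall fun t => ?_)
  exact integral_const_mul (laplaceKernel δ z (σ + t * I)) _

theorem integrable_mul_gaussKernel (hδ : 0 < δ) (hr : Measurable r)
    (hb : Integrable (fun x => b x * cexp (-(σ : ℂ) * r x)) ν) (z : ℝ) :
    Integrable (fun x => b x * gaussKernel δ (z - r x)) ν := by
  have h := ((integrable_laplace_prod hδ hr hb z).integral_prod_right).const_mul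
    ((2 * Real.pi : ℂ)⁻¹)
  refine h.congr (Filter.Eventually.of_forall fun x => ?_)
  have h2 : ∀ t : ℝ, laplaceKernel δ z (σ + t * I) * (b x * cexp (-(σ + t * I) * r x)) =
      b x * laplaceKernel δ (z - r x) (σ + t * I) := fun t => mul_cexp_laplaceKernel _ _ _ _ _
  simp only [h2]
  rw [integral_const_mul, integral_laplaceKernel hδ]
  have : (Real.pi : ℂ) ≠ 0 := by exact_mod_cast Real.pi_ne_zero
  field_simp

end Laplace

theorem differentiable_laplaceKernel (δ z : ℝ) : Differentiable ℂ (laplaceKernel δ z) := by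
  unfold laplaceKernel; fun_prop

/-- Moving the line of integration from `Re s = 2` to `Re s = c` up to height `T`. -/
theorem norm_integral_laplaceKernel_mul_le {g : ℂ → ℂ} {B c T δ z : ℝ} (hδ : 0 < δ) (hδ1 : δ ≤ 1)
    (hc : 0 < c) (hc1 : c ≤ 1) (hz : 0 ≤ z) (hT : 0 ≤ T) (hB : 0 ≤ B)
    (hg : ∀ s ∈ rightHalfPlane, (|s.im| ≤ T ∨ s.re = 2) → DifferentiableAt ℂ g s)
    (h2 : ∀ t : ℝ, ‖g (2 + t * I)‖ ≤ B)
    (hstrip : ∀ s : ℂ, c ≤ s.re → s.re ≤ 2 → |s.im| ≤ T → ‖g s‖ ≤ B) :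
    ‖∫ t : ℝ, laplaceKernel δ z (2 + t * I) * g (2 + t * I)‖ ≤
      80 * B / δ * (Real.exp (c * z) + Real.exp (2 * z - δ ^ 2 * T ^ 2 / 4)) := by
  set f : ℂ → ℂ := fun s => laplaceKernel δ z s * g s with hf
  have hδ2 : δ ^ 2 ≤ 1 := by nlinarith
  have hE2 : Real.exp 2 ≤ 7.4 := by
    have h1 := Real.exp_one_lt_d9
    have : Real.exp 2 = Real.exp 1 * Real.exp 1 := by rw [← Real.exp_add]; norm_num
    rw [this]; nlinarith [Real.exp_pos 1]
  have hcast : ∀ t : ℝ, (2 + t * I : ℂ) = ((2 : ℝ) : ℂ) + t * I := fun t => by push_cast; rfl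
  have hline : Continuous fun t : ℝ => f (2 + t * I) := by
    refine continuous_iff_continuousAt.mpr fun t => ?_
    have h1 : DifferentiableAt ℂ f (2 + t * I) :=
      (differentiable_laplaceKernel δ z _).mul (hg _ (by change 0 < (2 + t * I : ℂ).re; simp)
        (Or.inr (by simp)))
    exact ContinuousAt.comp (f := fun t : ℝ => (2 + t * I : ℂ)) h1.continuousAt (by fun_prop)
  have hfnorm : ∀ t : ℝ, ‖f (2 + t * I)‖ ≤ B * Real.exp (δ ^ 2 * (2 ^ 2 - t ^ 2) / 2 + 2 * z) := by
    intro t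
    rw [hf, norm_mul, mul_comm, hcast, norm_laplaceKernel]
    gcongr
    rw [← hcast]; exact h2 t
  have hint : Integrable fun t : ℝ => f (2 + t * I) := by
    refine ((integrable_norm_laplaceKernel hδ z 2).norm.const_mul B).mono'
      hline.aestronglyMeasurable (Filter.Eventually.of_forall fun t => ?_)
    rw [norm_laplaceKernel]; exact hfnorm t
  -- the part of the line above height `T`
  have htail : ‖∫ t in (Ioc (-T) T)ᶜ, f (2 + t * I)‖ ≤
      B * Real.exp (2 + 2 * z - δ ^ 2 * T ^ 2 / 4) * (4 / δ) := by
    have hgi : Integrable fun t : ℝ => B * Real.exp (2 + 2 * z - δ ^ 2 * T ^ 2 / 4) *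
        Real.exp (-(δ ^ 2 / 4) * t ^ 2) :=
      (integrable_exp_neg_mul_sq (by positivity)).const_mul _
    refine (norm_integral_le_of_norm_le hgi.integrableOn ?_).trans
      ((setIntegral_le_integral hgi (Filter.Eventually.of_forall fun t => by positivity)).trans ?_)
    · filter_upwards [ae_restrict_mem measurableSet_Ioc.compl] with t ht
      refine (hfnorm t).trans ?_
      rw [mul_assoc, ← Real.exp_add]
      refine mul_le_mul_of_nonneg_left (Real.exp_le_exp.mpr ?_) hB
      have hTt : T ^ 2 ≤ t ^ 2 := by
        refine sq_le_sq' ?_ ?_ |>.trans (le_of_eq (sq_abs t))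
        · linarith [abs_nonneg t]
        · by_contra hlt
          have := abs_lt.mp (not_le.mp hlt)
          exact ht ⟨this.1, this.2.le⟩
      nlinarith [mul_le_mul_of_nonneg_left hTt (sq_nonneg δ)]
    · rw [integral_const_mul, integral_gaussian]
      gcongr
      rw [show Real.pi / (δ ^ 2 / 4) = (4 * Real.pi) / δ ^ 2 by field_simp,
        Real.sqrt_div' _ (by positivity), Real.sqrt_sq hδ.le]
      gcongr
      rw [Real.sqrt_le_left (by norm_num)]
      have := Real.pi_lt_d2; linarith
  -- the contour integral over the rectangle vanishes
  have hrect := integral_boundary_rect_eq_zero_of_differentiableOn f (c + (-T : ℝ) * I) (2 + T * I)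
    (fun s hs => by
      rw [mem_reProdIm] at hs
      simp only [add_re, ofReal_re, mul_re, I_re, mul_zero, ofReal_im, I_im, mul_one, sub_self,
        add_zero, re_ofNat, add_im, mul_im, zero_add, im_ofNat] at hs
      rw [uIcc_of_le (by linarith), uIcc_of_le (by linarith)] at hs
      refine ((differentiable_laplaceKernel δ z _).mul (hg s (lt_of_lt_of_le hc hs.1.1)
        (Or.inl (abs_le.mpr hs.2)))).differentiableWithinAt)
  simp only [add_re, ofReal_re, mul_re, I_re, mul_zero, ofReal_im, I_im, mul_one, sub_self,
    add_zero, re_ofNat, add_im, mul_im, zero_add, im_ofNat] at hrect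
  have hhor : ∀ y : ℝ, |y| = T → ‖∫ x in c..2, f (x + y * I)‖ ≤
      B * Real.exp (2 + 2 * z - δ ^ 2 * T ^ 2 / 4) * 2 := by
    intro y hy
    have hy2 : y ^ 2 = T ^ 2 := by rw [← sq_abs, hy]
    refine (intervalIntegral.norm_integral_le_of_norm_le_const (C := B *
      Real.exp (2 + 2 * z - δ ^ 2 * T ^ 2 / 4)) fun x hx => ?_).trans ?_
    · rw [uIoc_of_le (by linarith)] at hx
      rw [hf, norm_mul, mul_comm, norm_laplaceKernel]
      have h1 : ‖g (x + y * I)‖ ≤ B := hstrip _ (by simpa using hx.1.le) (by simpa using hx.2)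
        (by simpa using hy.le)
      gcongr
      rw [hy2]
      have hx0 : 0 ≤ x := hc.le.trans hx.1.le
      have h3 : x * z ≤ 2 * z := by gcongr; exact hx.2
      have h4 : x ^ 2 ≤ 4 := by nlinarith [hx.2]
      have h5 : δ ^ 2 * x ^ 2 ≤ 1 * 4 := by gcongr
      nlinarith [mul_nonneg (sq_nonneg δ) (sq_nonneg T)]
    · gcongr
      rw [abs_of_nonneg (by linarith)]; linarith
  have hleft : ‖∫ y in (-T)..T, f (c + y * I)‖ ≤ B * Real.exp (c * z) * (8 / δ) := by
    have hgi : Integrable fun t : ℝ => B * Real.exp (1 / 2 + c * z) *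
        Real.exp (-(δ ^ 2 / 2) * t ^ 2) :=
      (integrable_exp_neg_mul_sq (by positivity)).const_mul _
    rw [intervalIntegral.integral_of_le (by linarith)]
    refine (norm_integral_le_of_norm_le hgi.integrableOn ?_).trans
      ((setIntegral_le_integral hgi (Filter.Eventually.of_forall fun t => by positivity)).trans ?_)
    · filter_upwards [ae_restrict_mem measurableSet_Ioc] with t ht
      rw [hf, norm_mul, mul_comm, norm_laplaceKernel, mul_assoc, ← Real.exp_add]
      have h1 : ‖g (c + t * I)‖ ≤ B := hstrip _ (by simp) (by simp; linarith)
        (by simpa using abs_le.mpr ⟨ht.1.le, ht.2⟩)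
      refine mul_le_mul h1 (Real.exp_le_exp.mpr ?_) (Real.exp_nonneg _) hB
      have h5 : δ ^ 2 * c ^ 2 ≤ 1 * 1 := by gcongr; nlinarith
      nlinarith
    · rw [integral_const_mul, integral_gaussian, Real.exp_add]
      have h6 : Real.exp (1 / 2) ≤ 2 := by
        have h7 : Real.exp (1 / 2) ^ 2 ≤ 2 ^ 2 := by
          rw [← Real.exp_nat_mul]
          have := Real.exp_one_lt_d9
          norm_num; linarith
        exact le_of_sq_le_sq h7 (by norm_num)
      have h8 : √(Real.pi / (δ ^ 2 / 2)) ≤ 4 / δ := by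
        rw [show Real.pi / (δ ^ 2 / 2) = (2 * Real.pi) / δ ^ 2 by field_simp,
          Real.sqrt_div' _ (by positivity), Real.sqrt_sq hδ.le]
        gcongr
        rw [Real.sqrt_le_left (by norm_num)]
        have := Real.pi_lt_d2; linarith
      calc _ ≤ B * (2 * Real.exp (c * z)) * (4 / δ) := by gcongr
        _ = _ := by ring
  have hmid : ‖∫ y in (-T)..T, f (2 + y * I)‖ ≤
      B * Real.exp (2 + 2 * z - δ ^ 2 * T ^ 2 / 4) * 4 + B * Real.exp (c * z) * (8 / δ) := by
    have h1 : I * ∫ y in (-T)..T, f (2 + y * I) = (∫ x in c..2, f (x + T * I)) -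
        (∫ x in c..2, f (x + (-T : ℝ) * I)) + I * ∫ y in (-T)..T, f (c + y * I) := by
      simp only [smul_eq_mul] at hrect
      linear_combination hrect
    have h3 : ‖∫ y in (-T)..T, f (2 + y * I)‖ = ‖I * ∫ y in (-T)..T, f (2 + y * I)‖ := by
      rw [norm_mul, norm_I, one_mul]
    rw [h3, h1]
    refine (norm_add_le _ _).trans (add_le_add ?_ ?_)
    · refine (norm_sub_le _ _).trans ?_
      have h4 := hhor T (abs_of_nonneg hT)
      have h5 := hhor (-T) (by rw [abs_neg, abs_of_nonneg hT])
      linarith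
    · rw [norm_mul, norm_I, one_mul]; exact hleft
  have hsplit : ∫ t : ℝ, f (2 + t * I) =
      (∫ y in (-T)..T, f (2 + y * I)) + ∫ t in (Ioc (-T) T)ᶜ, f (2 + t * I) := by
    rw [intervalIntegral.integral_of_le (by linarith), integral_add_compl measurableSet_Ioc hint]
  rw [hsplit]
  refine (norm_add_le _ _).trans ((add_le_add hmid htail).trans ?_)
  have h9 : Real.exp (2 + 2 * z - δ ^ 2 * T ^ 2 / 4) ≤
      7.4 * Real.exp (2 * z - δ ^ 2 * T ^ 2 / 4) := by
    rw [show 2 + 2 * z - δ ^ 2 * T ^ 2 / 4 = 2 + (2 * z - δ ^ 2 * T ^ 2 / 4) by ring, Real.exp_add]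
    gcongr
  have h10 : (4 : ℝ) ≤ 4 / δ := by rw [le_div_iff₀ hδ]; linarith
  set e := Real.exp (2 * z - δ ^ 2 * T ^ 2 / 4)
  have he : 0 ≤ e := Real.exp_nonneg _
  calc _ ≤ B * (7.4 * e) * (4 / δ) + B * Real.exp (c * z) * (8 / δ) + B * (7.4 * e) * (4 / δ) := by
        gcongr
    _ = B / δ * (59.2 * e + 8 * Real.exp (c * z)) := by ring
    _ ≤ B / δ * (80 * e + 80 * Real.exp (c * z)) := by
        have := Real.exp_nonneg (c * z)
        gcongr <;> norm_num
    _ = _ := by ring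

/-! ### The smoothed explicit formula in a residue class -/

open ArithmeticFunction.vonMangoldt

section Explicit

variable {q : ℕ} [NeZero q]

/-- The sum `Σ_χ χ̄(a) Σ_{|γ| ≤ T} e^{iγr}` over the zeros of the `L`-functions mod `q`, counted with
multiplicity. -/
noncomputable def zeroSum (a : (ZMod q)ˣ) (T r : ℝ) : ℂ :=
  ∑ χ : DirichletCharacter ℂ q, (starRingEnd ℂ) (χ (a : ZMod q)) *
    ∑ γ ∈ ords χ T, mult χ γ * cexp (I * γ * r)

/-- The density `(e^r - e^{r/2} Σ_χ χ̄(a) Σ_γ e^{iγr}) / φ(q)` of the main terms of the explicit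
formula in the variable `r = log n`. -/
noncomputable def mainDensity (a : (ZMod q)ˣ) (T r : ℝ) : ℂ :=
  (q.totient : ℂ)⁻¹ * (cexp r - zeroSum a T r * cexp (r / 2))

theorem mainDensity_mul_cexp (a : (ZMod q)ˣ) (T r : ℝ) (s : ℂ) :
    mainDensity a T r * cexp (-s * r) = (q.totient : ℂ)⁻¹ * (cexp ((1 - s) * r) -
      ∑ χ : DirichletCharacter ℂ q, (starRingEnd ℂ) (χ (a : ZMod q)) *
        ∑ γ ∈ ords χ T, mult χ γ * cexp ((critPoint γ - s) * r)) := by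
  have h1 : cexp ((1 - s) * r) = cexp r * cexp (-s * r) := by
    rw [← Complex.exp_add]; congr 1; ring
  have h2 : ∀ γ : ℝ, cexp ((critPoint γ - s) * r) =
      cexp (I * γ * r) * (cexp (r / 2) * cexp (-s * r)) := by
    intro γ
    rw [← Complex.exp_add, ← Complex.exp_add]; congr 1; rw [critPoint]; ring
  simp_rw [h1, h2, ← mul_assoc, ← Finset.sum_mul]
  rw [mainDensity, zeroSum]
  simp_rw [← mul_assoc, ← Finset.sum_mul]
  ring

theorem integrableOn_mainDensity_mul_cexp (a : (ZMod q)ˣ) (T : ℝ) {s : ℂ} (hs : 1 < s.re) :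
    IntegrableOn (fun r : ℝ => mainDensity a T r * cexp (-s * r)) (Ioi 0) := by
  simp_rw [mainDensity_mul_cexp]
  have h : ∀ w : ℂ, w.re < 0 → IntegrableOn (fun r : ℝ => cexp (w * r)) (Ioi 0) := fun w hw =>
    integrableOn_exp_mul_complex_Ioi hw 0
  refine Integrable.const_mul (Integrable.sub (h _ (by simp; linarith)) ?_) _
  refine integrable_finsetSum _ fun χ _ => Integrable.const_mul ?_ _
  refine integrable_finsetSum _ fun γ _ => Integrable.const_mul (h _ ?_) _
  simp; linarith

theorem integral_mainDensity_mul_cexp (a : (ZMod q)ˣ) (T : ℝ) {s : ℂ} (hs : 1 < s.re) :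
    ∫ r in Ioi (0 : ℝ), mainDensity a T r * cexp (-s * r) = (q.totient : ℂ)⁻¹ * (1 / (s - 1) -
      ∑ χ : DirichletCharacter ℂ q, (starRingEnd ℂ) (χ (a : ZMod q)) *
        ∑ γ ∈ ords χ T, mult χ γ / (s - critPoint γ)) := by
  simp_rw [mainDensity_mul_cexp]
  have h : ∀ w : ℂ, w.re < 0 → IntegrableOn (fun r : ℝ => cexp (w * r)) (Ioi 0) := fun w hw =>
    integrableOn_exp_mul_complex_Ioi hw 0
  have hi : ∀ w : ℂ, w.re < s.re → ∫ r in Ioi (0 : ℝ), cexp ((w - s) * r) = 1 / (s - w) := by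
    intro w hw
    rw [integral_exp_mul_complex_Ioi (by simpa using hw)]
    rw [ofReal_zero, mul_zero, Complex.exp_zero, ← neg_sub s w, neg_div_neg_eq]
  have hγ : ∀ γ : ℝ, (critPoint γ - s).re < 0 := fun γ => by simp; linarith
  rw [integral_const_mul, integral_sub (h _ (by simp; linarith)), hi 1 (by simpa using hs),
    integral_finsetSum]
  · congr 2
    refine Finset.sum_congr rfl fun χ _ => ?_
    rw [integral_const_mul, integral_finsetSum]
    · congr 1
      refine Finset.sum_congr rfl fun γ _ => ?_
      rw [integral_const_mul, hi _ (by simp; linarith), mul_one_div]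
    · exact fun γ _ => Integrable.const_mul (h _ (hγ γ)) _
  · exact fun χ _ => Integrable.const_mul
      (integrable_finsetSum _ fun γ _ => Integrable.const_mul (h _ (hγ γ)) _) _
  · exact integrable_finsetSum _ fun χ _ => Integrable.const_mul
      (integrable_finsetSum _ fun γ _ => Integrable.const_mul (h _ (hγ γ)) _) _

omit [NeZero q] in
theorem residueClass_mul_cexp (a : ZMod q) (s : ℂ) (n : ℕ) :
    (residueClass a n : ℂ) * cexp (-s * Real.log n) =
      LSeries.term (fun n => (residueClass a n : ℂ)) s n := by
  rcases eq_or_ne n 0 with rfl | hn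
  · simp
  · have hn' : (n : ℂ) ≠ 0 := by exact_mod_cast hn
    rw [LSeries.term_of_ne_zero hn, cpow_def_of_ne_zero hn', div_eq_mul_inv, ← Complex.exp_neg,
      natCast_log]
    congr 2; ring

omit [NeZero q] in
theorem LSeriesSummable_residueClass (a : ZMod q) {s : ℂ} (hs : 1 < s.re) :
    LSeriesSummable (fun n => (residueClass a n : ℂ)) s := by
  refine LSeriesSummable_of_abscissaOfAbsConv_lt_re
    (lt_of_le_of_lt (abscissaOfAbsConv_residueClass_le_one a) ?_)
  exact_mod_cast hs

omit [NeZero q] in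
theorem conj_char_eq (a : (ZMod q)ˣ) (χ : DirichletCharacter ℂ q) :
    (starRingEnd ℂ) (χ (a : ZMod q)) = χ ((a : ZMod q)⁻¹) := by
  rw [starRingEnd_apply, MulChar.star_apply', MulChar.inv_apply_eq_inv', ZMod.inv_coe_unit]
  have h := map_mul χ (a : ZMod q) ((a⁻¹ : (ZMod q)ˣ) : ZMod q)
  rw [← Units.val_mul, mul_inv_cancel, Units.val_one, map_one] at h
  exact (eq_inv_of_mul_eq_one_right h.symm).symm

theorem LSeries_residueClass_eq_sum (a : (ZMod q)ˣ) {s : ℂ} (hs : 1 < s.re) :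
    LSeries (fun n => (residueClass (a : ZMod q) n : ℂ)) s = (q.totient : ℂ)⁻¹ *
      ∑ χ : DirichletCharacter ℂ q, (starRingEnd ℂ) (χ (a : ZMod q)) *
        LSeries ((fun n : ℕ => χ n) * fun n : ℕ => (ArithmeticFunction.vonMangoldt n : ℂ)) s := by
  rw [LSeries_residueClass_eq a.isUnit hs, neg_mul, ← mul_neg, ← Finset.sum_neg_distrib]
  congr 1
  refine Finset.sum_congr rfl fun χ _ => ?_
  rw [LSeries_twist_vonMangoldt_eq χ hs, deriv_LFunction_eq_deriv_LSeries χ hs,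
    LFunction_eq_LSeries χ hs, conj_char_eq]
  ring

theorem card_dirichletCharacter : Fintype.card (DirichletCharacter ℂ q) = q.totient := by
  rw [← Nat.card_eq_fintype_card, card_eq_totient_of_hasEnoughRootsOfUnity]

theorem sum_conj_mul_poleOrder (a : (ZMod q)ˣ) (w : ℂ) :
    ∑ χ : DirichletCharacter ℂ q, (starRingEnd ℂ) (χ (a : ZMod q)) * (poleOrder χ / w) = 1 / w := by
  rw [Finset.sum_eq_single (1 : DirichletCharacter ℂ q)]
  · simp [poleOrder, MulChar.one_apply a.isUnit]
  · intro χ _ hχ; simp [poleOrder, hχ]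
  · simp

end Explicit

/-- The smoothed explicit formula in an arithmetic progression, in terms of the zeros up to height
`T`. -/
theorem exists_smoothed_explicit_formula (hGRH : GRH) {c : ℝ} (hc : 0 < c) (hc' : c ≤ 1 / 16) :
    ∃ K X₀ : ℝ, 0 < K ∧ 3 ≤ X₀ ∧ ∀ X : ℝ, X₀ ≤ X → ∀ (q : ℕ) [NeZero q], (q : ℝ) ≤ X →
      ∀ (a : (ZMod q)ˣ) (T δ z : ℝ), 4 ≤ T → T ≤ X → 0 < δ → δ ≤ 1 → 0 ≤ z →
        ‖∑' n : ℕ, (residueClass (a : ZMod q) n : ℂ) * gaussKernel δ (z - Real.log n) -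
          ∫ r in Ioi (0 : ℝ), mainDensity a T r * gaussKernel δ (z - r)‖ ≤
        K * Real.log X * T / δ *
          (Real.exp (4 * c * z) + Real.exp (2 * z - δ ^ 2 * (T - 4) ^ 2 / 4)) := by
  obtain ⟨K, X₀, hK, hX₀, hmain⟩ := exists_LSeries_twist_eq hGRH hc hc'
  refine ⟨80 * K, X₀, by positivity, hX₀, ?_⟩
  intro X hX q _ hqX a T δ z hT4 hTX hδ hδ1 hz
  have hlog : 0 ≤ Real.log X := Real.log_nonneg (by linarith)
  choose g hgd hgeq hg2 hgs using fun χ => hmain X hX q hqX χ T (by linarith) hTX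
  set B := K * Real.log X * T with hB
  have hB0 : 0 ≤ B := by positivity
  set G : ℂ → ℂ := fun s => (q.totient : ℂ)⁻¹ *
    ∑ χ : DirichletCharacter ℂ q, (starRingEnd ℂ) (χ (a : ZMod q)) * g χ s with hG
  have hφ : (0 : ℝ) < q.totient := by exact_mod_cast Nat.totient_pos.mpr (Nat.pos_of_neZero q)
  have hGnorm : ∀ s, (∀ χ, ‖g χ s‖ ≤ B) → ‖G s‖ ≤ B := by
    intro s hs
    rw [hG, norm_mul, norm_inv, Complex.norm_natCast, inv_mul_le_iff₀ hφ]
    refine (norm_sum_le _ _).trans ?_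
    calc _ ≤ ∑ χ : DirichletCharacter ℂ q, B := by
          refine Finset.sum_le_sum fun χ _ => ?_
          rw [norm_mul, RCLike.norm_conj]
          exact (mul_le_of_le_one_left (norm_nonneg _) (χ.norm_le_one _)).trans (hs χ)
      _ = q.totient * B := by
          rw [Finset.sum_const, Finset.card_univ, card_dirichletCharacter, nsmul_eq_mul]
  have hshift := norm_integral_laplaceKernel_mul_le (g := G) (B := B) (c := 4 * c) (T := T - 4)
    hδ hδ1 (by linarith) (by linarith) hz (by linarith) hB0
    (fun s hs hor => by
      refine DifferentiableAt.const_mul (DifferentiableAt.fun_sum fun χ _ => ?_) _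
      refine (hgd χ s hs ?_).const_mul _
      rcases hor with h | h
      · left; linarith
      · right; exact h)
    (fun t => hGnorm _ fun χ => hg2 χ t)
    (fun s h1 h2 h3 => hGnorm _ fun χ => hgs χ s h1 h2 h3)
  -- the two Laplace transforms
  have hcast : ∀ t : ℝ, (2 + t * I : ℂ) = ((2 : ℝ) : ℂ) + t * I := fun t => by push_cast; rfl
  have hre : ∀ t : ℝ, 1 < (((2 : ℝ) : ℂ) + t * I).re := fun t => by simp
  have hre2 : 1 < (((2 : ℝ) : ℂ)).re := by simp
  have hbN : Integrable (fun n : ℕ => (residueClass (a : ZMod q) n : ℂ) *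
      cexp (-((2 : ℝ) : ℂ) * Real.log n)) Measure.count := by
    rw [integrable_count_iff]
    simp_rw [residueClass_mul_cexp]
    exact (LSeriesSummable_residueClass _ hre2).norm
  have hmN : Measurable fun n : ℕ => Real.log n := measurable_from_top
  have hbR := integrableOn_mainDensity_mul_cexp a T hre2
  have e1 := integral_laplaceKernel_mul hδ hmN hbN z
  have e2 := integral_laplaceKernel_mul (ν := volume.restrict (Ioi 0)) hδ measurable_id hbR z
  have i1 := integrable_laplaceKernel_mul hδ hmN hbN z
  have i2 := integrable_laplaceKernel_mul (ν := volume.restrict (Ioi 0)) hδ measurable_id hbR z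
  have i3 := integrable_mul_gaussKernel hδ hmN hbN z
  have htsum : ∫ n : ℕ, (residueClass (a : ZMod q) n : ℂ) * gaussKernel δ (z - Real.log n)
      ∂Measure.count =
      ∑' n : ℕ, (residueClass (a : ZMod q) n : ℂ) * gaussKernel δ (z - Real.log n) := by
    rw [integral_countable i3]; simp
  have hsum : ∀ t : ℝ, ∫ n : ℕ, (residueClass (a : ZMod q) n : ℂ) *
      cexp (-(((2 : ℝ) : ℂ) + t * I) * Real.log n) ∂Measure.count =
      LSeries (fun n => (residueClass (a : ZMod q) n : ℂ)) (((2 : ℝ) : ℂ) + t * I) := by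
    intro t
    rw [integral_countable]
    · simp only [measureReal_def, Measure.count_singleton, ENNReal.toReal_one, one_smul,
        residueClass_mul_cexp]
      rfl
    · rw [integrable_count_iff]
      simp_rw [residueClass_mul_cexp]
      exact (LSeriesSummable_residueClass _ (hre t)).norm
  have hkey : ∫ t : ℝ, laplaceKernel δ z (2 + t * I) * G (2 + t * I) =
      2 * Real.pi * (∑' n : ℕ, (residueClass (a : ZMod q) n : ℂ) * gaussKernel δ (z - Real.log n) -
          ∫ r in Ioi (0 : ℝ), mainDensity a T r * gaussKernel δ (z - r)) := by
    rw [← htsum, mul_sub]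
    simp only [id] at e2 i2
    rw [← e1, ← e2, ← integral_sub i1 i2]
    refine integral_congr_ae (Filter.Eventually.of_forall fun t => ?_)
    beta_reduce
    rw [← mul_sub, hcast, hsum, integral_mainDensity_mul_cexp a T (hre t),
      LSeries_residueClass_eq_sum a (hre t), hG]
    congr 1
    beta_reduce
    rw [← mul_sub]
    congr 1
    rw [← sum_conj_mul_poleOrder a, ← Finset.sum_sub_distrib, ← Finset.sum_sub_distrib]
    refine Finset.sum_congr rfl fun χ _ => ?_
    rw [← hgeq χ _ (hre t)]; ring
  rw [hkey, norm_mul] at hshift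
  have h2pi : 1 ≤ ‖(2 * Real.pi : ℂ)‖ := by
    rw [norm_mul, norm_real, Real.norm_of_nonneg Real.pi_pos.le]
    have := Real.pi_gt_three
    norm_num; linarith
  refine (le_mul_of_one_le_left (norm_nonneg _) h2pi).trans (hshift.trans (le_of_eq ?_))
  rw [hB]; ring

/-! ### The form factor as a mean square -/

section FRepresentation

variable {q : ℕ} [NeZero q]

theorem integrable_exp_neg_mul_abs {b : ℝ} (hb : 0 < b) :
    Integrable fun u : ℝ => Real.exp (-b * |u|) := by
  rw [← integrableOn_univ, ← Iic_union_Ioi (a := (0 : ℝ)), integrableOn_union]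
  constructor
  · refine (integrableOn_exp_mul_Iic hb 0).congr_fun (fun u hu => ?_) measurableSet_Iic
    beta_reduce
    rw [abs_of_nonpos hu]; congr 1; ring
  · refine (integrableOn_exp_mul_Ioi (neg_lt_zero.mpr hb) 0).congr_fun (fun u hu => ?_)
      measurableSet_Ioi
    beta_reduce
    rw [abs_of_pos hu]

theorem integral_exp_neg_mul_abs {b : ℝ} (hb : 0 < b) :
    ∫ u : ℝ, Real.exp (-b * |u|) = 2 / b := by
  have h := integral_comp_abs (f := fun u : ℝ => Real.exp (-b * u))
  rw [h, integral_exp_mul_Ioi (neg_lt_zero.mpr hb)]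
  simp only [mul_zero, Real.exp_zero]
  field_simp

/-- The weight `W` is the Fourier transform of `e^{-2|u|}`. -/
theorem integral_cexp_mul_exp_neg_abs (v : ℝ) :
    ∫ u : ℝ, cexp (I * v * u) * Real.exp (-2 * |u|) = W v := by
  have hint : Integrable fun u : ℝ => cexp (I * v * u) * Real.exp (-2 * |u|) := by
    have h := (integrable_exp_neg_mul_abs (b := 2) (by norm_num)).ofReal (𝕜 := ℂ)
    refine h.bdd_mul (c := 1) (by fun_prop) (Filter.Eventually.of_forall fun u => ?_)
    rw [show I * v * u = ((v * u : ℝ) : ℂ) * I by push_cast; ring, norm_exp_ofReal_mul_I]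
  have hsplit := intervalIntegral.integral_Iic_add_Ioi (b := (0 : ℝ)) hint.integrableOn
    hint.integrableOn
  rw [← hsplit]
  have h1 : ∫ u in Iic (0 : ℝ), cexp (I * v * u) * Real.exp (-2 * |u|) =
      ∫ u in Ioi (0 : ℝ), cexp ((-I * v - 2) * u) := by
    have h := integral_comp_neg_Ioi (0 : ℝ) fun u : ℝ => cexp (I * v * u) * Real.exp (-2 * |u|)
    rw [neg_zero] at h
    rw [← h]
    refine setIntegral_congr_fun measurableSet_Ioi fun u hu => ?_
    have hu' : 0 < u := hu
    rw [ofReal_exp, ← Complex.exp_add, abs_neg, abs_of_pos hu']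
    congr 1; push_cast; ring
  have h2 : ∫ u in Ioi (0 : ℝ), cexp (I * v * u) * Real.exp (-2 * |u|) =
      ∫ u in Ioi (0 : ℝ), cexp ((I * v - 2) * u) := by
    refine setIntegral_congr_fun measurableSet_Ioi fun u hu => ?_
    have hu' : 0 < u := hu
    rw [ofReal_exp, ← Complex.exp_add, abs_of_pos hu']
    congr 1; push_cast; ring
  have hre1 : (-I * v - 2 : ℂ).re < 0 := by simp
  have hre2 : (I * v - 2 : ℂ).re < 0 := by simp
  have hne1 : (-I * v - 2 : ℂ) ≠ 0 := fun h => by rw [h] at hre1; simp at hre1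
  have hne2 : (I * v - 2 : ℂ) ≠ 0 := fun h => by rw [h] at hre2; simp at hre2
  have hne3 : (4 + v ^ 2 : ℂ) ≠ 0 := by
    have : (0 : ℝ) < 4 + v ^ 2 := by positivity
    exact_mod_cast this.ne'
  rw [h1, h2, integral_exp_mul_complex_Ioi hre1, integral_exp_mul_complex_Ioi hre2, W]
  push_cast
  simp only [mul_zero, Complex.exp_zero]
  rw [div_add_div _ _ hne1 hne2, div_eq_div_iff (mul_ne_zero hne1 hne2) hne3]
  linear_combination (4 * (v : ℂ) ^ 2) * I_sq

theorem continuous_zeroSum (a : (ZMod q)ˣ) (T : ℝ) : Continuous (zeroSum a T) := by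
  unfold zeroSum; fun_prop

/-- The trivial bound for the sum over zeros. -/
noncomputable def zeroSumBound (q : ℕ) [NeZero q] (T : ℝ) : ℝ :=
  ∑ χ : DirichletCharacter ℂ q, ∑ γ ∈ ords χ T, (mult χ γ : ℝ)

theorem norm_zeroSum_le (a : (ZMod q)ˣ) (T r : ℝ) : ‖zeroSum a T r‖ ≤ zeroSumBound q T := by
  refine (norm_sum_le _ _).trans (Finset.sum_le_sum fun χ _ => ?_)
  rw [norm_mul, RCLike.norm_conj]
  refine (mul_le_of_le_one_left (norm_nonneg _) (χ.norm_le_one _)).trans ?_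
  refine (norm_sum_le _ _).trans (Finset.sum_le_sum fun γ _ => ?_)
  rw [norm_mul, Complex.norm_natCast,
    show I * γ * r = ((γ * r : ℝ) : ℂ) * I by push_cast; ring, norm_exp_ofReal_mul_I, mul_one]

theorem integrable_sq_zeroSum (a : (ZMod q)ˣ) (T L : ℝ) :
    Integrable fun r : ℝ => ‖zeroSum a T r‖ ^ 2 * Real.exp (-2 * |r - L|) := by
  have h := (integrable_exp_neg_mul_abs (b := 2) (by norm_num)).comp_sub_right L
  refine h.bdd_mul (c := zeroSumBound q T ^ 2) ?_ (Filter.Eventually.of_forall fun r => ?_)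
  · exact ((continuous_zeroSum a T).norm.pow 2).aestronglyMeasurable
  · rw [norm_pow, norm_norm]
    gcongr
    exact norm_zeroSum_le a T r

/-- The form factor `F_q(x, T)` is a mean square of the sum over zeros. -/
theorem F_eq_integral (a : (ZMod q)ˣ) {x : ℝ} (hx : 0 < x) (T : ℝ) :
    F q a x T = ((∫ r : ℝ, ‖zeroSum a T r‖ ^ 2 * Real.exp (-2 * |r - Real.log x|) : ℝ) : ℂ) := by
  have hint : ∀ v : ℝ, Integrable fun u : ℝ => cexp (I * v * u) * Real.exp (-2 * |u|) := by
    intro v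
    have h := (integrable_exp_neg_mul_abs (b := 2) (by norm_num)).ofReal (𝕜 := ℂ)
    refine h.bdd_mul (c := 1) (by fun_prop) (Filter.Eventually.of_forall fun u => ?_)
    rw [show I * v * u = ((v * u : ℝ) : ℂ) * I by push_cast; ring, norm_exp_ofReal_mul_I]
  have hsq : ∀ u : ℝ, ((‖zeroSum a T (u + Real.log x)‖ ^ 2 * Real.exp (-2 * |u|) : ℝ) : ℂ) =
      ∑ χ₁ : DirichletCharacter ℂ q, ∑ χ₂ : DirichletCharacter ℂ q,
        ∑ γ₁ ∈ ords χ₁ T, ∑ γ₂ ∈ ords χ₂ T,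
          ((starRingEnd ℂ) (χ₁ (a : ZMod q)) * χ₂ (a : ZMod q) * ((mult χ₁ γ₁ : ℂ) * mult χ₂ γ₂) *
            (x : ℂ) ^ (I * ((γ₁ - γ₂ : ℝ) : ℂ))) *
              (cexp (I * ((γ₁ - γ₂ : ℝ) : ℂ) * u) * Real.exp (-2 * |u|)) := by
    intro u
    have hx0 : (x : ℂ) ≠ 0 := by exact_mod_cast hx.ne'
    have h1 : ((‖zeroSum a T (u + Real.log x)‖ ^ 2 : ℝ) : ℂ) =
        zeroSum a T (u + Real.log x) * (starRingEnd ℂ) (zeroSum a T (u + Real.log x)) := by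
      rw [mul_conj, normSq_eq_norm_sq]
    rw [ofReal_mul, h1, zeroSum, map_sum, Finset.sum_mul_sum, Finset.sum_mul]
    refine Finset.sum_congr rfl fun χ₁ _ => ?_
    rw [Finset.sum_mul]
    refine Finset.sum_congr rfl fun χ₂ _ => ?_
    rw [map_mul, conj_conj, map_sum, mul_mul_mul_comm, Finset.sum_mul_sum, Finset.mul_sum,
      Finset.sum_mul]
    refine Finset.sum_congr rfl fun γ₁ _ => ?_
    rw [Finset.mul_sum, Finset.sum_mul]
    refine Finset.sum_congr rfl fun γ₂ _ => ?_
    have h2 : (x : ℂ) ^ (I * ((γ₁ - γ₂ : ℝ) : ℂ)) * cexp (I * ((γ₁ - γ₂ : ℝ) : ℂ) * u) =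
        cexp (I * γ₁ * ((u + Real.log x : ℝ) : ℂ)) * cexp (-(I * γ₂ * ((u + Real.log x : ℝ) : ℂ))) := by
      rw [cpow_def_of_ne_zero hx0, ← ofReal_log hx.le, ← Complex.exp_add, ← Complex.exp_add]
      congr 1; push_cast; ring
    have h3 : (starRingEnd ℂ) ((mult χ₂ γ₂ : ℂ) * cexp (I * γ₂ * ((u + Real.log x : ℝ) : ℂ))) =
        mult χ₂ γ₂ * cexp (-(I * γ₂ * ((u + Real.log x : ℝ) : ℂ))) := by
      rw [map_mul, map_natCast, ← exp_conj, map_mul, map_mul, conj_I, conj_ofReal, conj_ofReal]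
      congr 2; ring
    rw [h3]
    linear_combination (-(starRingEnd ℂ) (χ₁ (a : ZMod q)) * χ₂ (a : ZMod q) *
      ((mult χ₁ γ₁ : ℂ) * mult χ₂ γ₂) * Real.exp (-2 * |u|)) * h2
  have hshift : ∫ r : ℝ, ‖zeroSum a T r‖ ^ 2 * Real.exp (-2 * |r - Real.log x|) =
      ∫ u : ℝ, ‖zeroSum a T (u + Real.log x)‖ ^ 2 * Real.exp (-2 * |u|) := by
    rw [← integral_add_right_eq_self _ (Real.log x)]
    simp
  rw [hshift, ← integral_complex_ofReal]
  simp_rw [hsq]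
  rw [integral_finsetSum _ (fun χ₁ _ => integrable_finsetSum _ fun χ₂ _ =>
    integrable_finsetSum _ fun γ₁ _ => integrable_finsetSum _ fun γ₂ _ => (hint _).const_mul _), F]
  refine Finset.sum_congr rfl fun χ₁ _ => ?_
  rw [integral_finsetSum _ (fun χ₂ _ =>
    integrable_finsetSum _ fun γ₁ _ => integrable_finsetSum _ fun γ₂ _ => (hint _).const_mul _)]
  refine Finset.sum_congr rfl fun χ₂ _ => ?_
  rw [integral_finsetSum _ (fun γ₁ _ => integrable_finsetSum _ fun γ₂ _ => (hint _).const_mul _),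
    G, Finset.mul_sum]
  refine Finset.sum_congr rfl fun γ₁ _ => ?_
  rw [integral_finsetSum _ (fun γ₂ _ => (hint _).const_mul _), Finset.mul_sum]
  refine Finset.sum_congr rfl fun γ₂ _ => ?_
  rw [integral_const_mul, integral_cexp_mul_exp_neg_abs]
  ring

theorem integral_sq_zeroSum_le (a : (ZMod q)ˣ) {x : ℝ} (hx : 0 < x) {T A : ℝ}
    (hA : ‖F q a x T‖ ≤ A) :
    ∫ r : ℝ, ‖zeroSum a T r‖ ^ 2 * Real.exp (-2 * |r - Real.log x|) ≤ A := by
  rw [F_eq_integral a hx, norm_real] at hA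
  exact (Real.le_norm_self _).trans hA

end FRepresentation

/-! ### The smoothed window -/

section Kernel

theorem gaussKernel_nonneg {δ : ℝ} (hδ : 0 < δ) (y : ℝ) : 0 ≤ gaussKernel δ y := by
  unfold gaussKernel; positivity

theorem continuous_gaussKernel (δ : ℝ) : Continuous (gaussKernel δ) := by
  unfold gaussKernel; fun_prop

theorem gaussKernel_eq {δ : ℝ} (y : ℝ) :
    gaussKernel δ y = (√(2 * Real.pi) * δ)⁻¹ * Real.exp (-(2 * δ ^ 2)⁻¹ * y ^ 2) := by
  rw [gaussKernel]; congr 2; ring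

theorem integrable_gaussKernel {δ : ℝ} (hδ : 0 < δ) : Integrable (gaussKernel δ) := by
  simp_rw [funext (gaussKernel_eq (δ := δ))]
  exact (integrable_exp_neg_mul_sq (by positivity)).const_mul _

theorem integral_gaussKernel {δ : ℝ} (hδ : 0 < δ) : ∫ y, gaussKernel δ y = 1 := by
  simp_rw [gaussKernel_eq]
  have h := Real.sqrt_mul (show 0 ≤ 2 * Real.pi by positivity) (δ ^ 2)
  rw [integral_const_mul, integral_gaussian,
    show Real.pi / (2 * δ ^ 2)⁻¹ = (2 * Real.pi) * δ ^ 2 by field_simp, h, Real.sqrt_sq hδ.le]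
  exact inv_mul_cancel₀ (by positivity)

theorem exp_mul_gaussKernel {δ : ℝ} (hδ : 0 < δ) (m y : ℝ) :
    Real.exp (m * y) * gaussKernel δ y =
      Real.exp (m ^ 2 * δ ^ 2 / 2) * gaussKernel δ (y - m * δ ^ 2) := by
  rw [gaussKernel, gaussKernel, mul_left_comm, ← Real.exp_add, mul_left_comm (Real.exp _),
    ← Real.exp_add]
  congr 2
  field_simp; ring

/-- The Gaussian density smoothed over a window of unit length: the weight that replaces the
indicator function of `(L, L + 1]`. -/
noncomputable def windowKernel (δ L r : ℝ) : ℝ := ∫ z in Ioc L (L + 1), gaussKernel δ (z - r)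

theorem integrable_gaussKernel_sub {δ : ℝ} (hδ : 0 < δ) (r : ℝ) :
    Integrable fun z => gaussKernel δ (z - r) := (integrable_gaussKernel hδ).comp_sub_right r

/-- A Chernoff bound for the Gaussian density. -/
theorem setIntegral_gaussKernel_le {δ m d r : ℝ} (hδ : 0 < δ) (hm : 0 ≤ m) {S : Set ℝ}
    (hS : MeasurableSet S) (hd : ∀ z ∈ S, d ≤ |z - r|) :
    ∫ z in S, gaussKernel δ (z - r) ≤ 2 * Real.exp (m ^ 2 * δ ^ 2 / 2) * Real.exp (-m * d) := by
  have hi : ∀ m : ℝ, Integrable fun z => Real.exp (m * (z - r)) * gaussKernel δ (z - r) := by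
    intro m
    simp_rw [exp_mul_gaussKernel hδ]
    exact (((integrable_gaussKernel hδ).comp_sub_right _).comp_sub_right r).const_mul _
  have hI : ∀ m : ℝ, ∫ z, Real.exp (m * (z - r)) * gaussKernel δ (z - r) =
      Real.exp (m ^ 2 * δ ^ 2 / 2) := by
    intro m
    simp_rw [exp_mul_gaussKernel hδ]
    rw [integral_const_mul, integral_sub_right_eq_self (fun y => gaussKernel δ (y - m * δ ^ 2)) r,
      integral_sub_right_eq_self (gaussKernel δ), integral_gaussKernel hδ, mul_one]
  have hsum := ((hi m).add (hi (-m))).const_mul (Real.exp (-m * d))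
  have hle : ∫ z in S, gaussKernel δ (z - r) ≤ ∫ z in S, Real.exp (-m * d) *
      (Real.exp (m * (z - r)) * gaussKernel δ (z - r) +
        Real.exp (-m * (z - r)) * gaussKernel δ (z - r)) := by
    refine setIntegral_mono_on (integrable_gaussKernel_sub hδ r).integrableOn hsum.integrableOn hS
      fun z hz => ?_
    have hg := gaussKernel_nonneg hδ (z - r)
    have h1 : 1 ≤ Real.exp (-m * d) * (Real.exp (m * (z - r)) + Real.exp (-m * (z - r))) := by
      have h2 : Real.exp (m * |z - r|) ≤ Real.exp (m * (z - r)) + Real.exp (-m * (z - r)) := by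
        rcases abs_cases (z - r) with ⟨h, _⟩ | ⟨h, _⟩ <;> rw [h]
        · linarith [Real.exp_nonneg (-m * (z - r))]
        · rw [show m * -(z - r) = -m * (z - r) by ring]
          linarith [Real.exp_nonneg (m * (z - r))]
      calc (1 : ℝ) ≤ Real.exp (-m * d) * Real.exp (m * |z - r|) := by
            rw [← Real.exp_add]
            refine Real.one_le_exp ?_
            nlinarith [hd z hz]
        _ ≤ _ := by gcongr
    nlinarith
  refine hle.trans ((setIntegral_le_integral hsum (Filter.Eventually.of_forall fun z => ?_)).trans
    (le_of_eq ?_))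
  · have hg := gaussKernel_nonneg hδ (z - r)
    simp only [Pi.zero_apply, Pi.add_apply]
    positivity
  · simp only [Pi.add_apply]
    rw [integral_const_mul, integral_add (hi m) (hi (-m)), hI, hI, neg_sq]; ring

theorem windowKernel_nonneg {δ : ℝ} (hδ : 0 < δ) (L r : ℝ) : 0 ≤ windowKernel δ L r :=
  integral_nonneg fun _ => gaussKernel_nonneg hδ _

theorem windowKernel_le_one {δ : ℝ} (hδ : 0 < δ) (L r : ℝ) : windowKernel δ L r ≤ 1 := by
  refine (setIntegral_le_integral (integrable_gaussKernel_sub hδ r)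
    (Filter.Eventually.of_forall fun _ => gaussKernel_nonneg hδ _)).trans (le_of_eq ?_)
  rw [integral_sub_right_eq_self (gaussKernel δ), integral_gaussKernel hδ]

theorem windowKernel_le_exp {δ : ℝ} (hδ : 0 < δ) (hδ1 : δ ≤ 1) (L r : ℝ) :
    windowKernel δ L r ≤ 2 * Real.exp 12 * Real.exp (-4 * |r - L|) := by
  refine (setIntegral_gaussKernel_le (m := 4) (d := |r - L| - 1) hδ (by norm_num)
    measurableSet_Ioc (fun z hz => ?_)).trans ?_
  · have h1 : |r - L| ≤ |z - r| + |z - L| := by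
      rw [abs_sub_comm z r]
      calc _ = |(r - z) + (z - L)| := by ring_nf
        _ ≤ _ := abs_add_le _ _
    have h2 : |z - L| ≤ 1 := by
      rw [abs_le]; constructor <;> linarith [hz.1, hz.2]
    linarith
  · rw [mul_assoc, mul_assoc, ← Real.exp_add, ← Real.exp_add]
    refine mul_le_mul_of_nonneg_left (Real.exp_le_exp.mpr ?_) zero_le_two
    have : δ ^ 2 ≤ 1 := by nlinarith
    nlinarith

/-- The smoothed window approximates the indicator function of `(L, L + 1]`. -/
theorem abs_windowKernel_sub_indicator_le {δ : ℝ} (hδ : 0 < δ) (L r : ℝ) :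
    |windowKernel δ L r - indicator (Ioc L (L + 1)) 1 r| ≤
      4 * (Real.exp (-|r - L| / δ) + Real.exp (-|r - (L + 1)| / δ)) := by
  have hE : Real.exp (1 / 2) ≤ 2 := by
    have h7 : Real.exp (1 / 2) ^ 2 ≤ 2 ^ 2 := by
      rw [← Real.exp_nat_mul]
      have := Real.exp_one_lt_d9
      norm_num; linarith
    exact le_of_sq_le_sq h7 (by norm_num)
  set d := min |r - L| |r - (L + 1)| with hd
  have hch : ∀ S : Set ℝ, MeasurableSet S → (∀ z ∈ S, d ≤ |z - r|) →
      ∫ z in S, gaussKernel δ (z - r) ≤ 4 * Real.exp (-d / δ) := by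
    intro S hS hSd
    refine (setIntegral_gaussKernel_le (m := 1 / δ) hδ (by positivity) hS hSd).trans ?_
    have h1 : (1 / δ) ^ 2 * δ ^ 2 / 2 = 1 / 2 := by field_simp
    rw [h1, show -(1 / δ) * d = -d / δ by ring]
    have := Real.exp_nonneg (-d / δ)
    nlinarith
  have hmin : Real.exp (-d / δ) ≤ Real.exp (-|r - L| / δ) + Real.exp (-|r - (L + 1)| / δ) := by
    rcases min_choice |r - L| |r - (L + 1)| with h | h <;> rw [hd, h]
    · linarith [Real.exp_nonneg (-|r - (L + 1)| / δ)]
    · linarith [Real.exp_nonneg (-|r - L| / δ)]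
  refine le_trans ?_ (mul_le_mul_of_nonneg_left hmin (by norm_num))
  by_cases hr : r ∈ Ioc L (L + 1)
  · rw [indicator_of_mem hr, Pi.one_apply]
    have h1 : windowKernel δ L r - 1 = -∫ z in (Ioc L (L + 1))ᶜ, gaussKernel δ (z - r) := by
      have h2 := integral_add_compl (measurableSet_Ioc (a := L) (b := L + 1))
        (integrable_gaussKernel_sub hδ r)
      rw [integral_sub_right_eq_self (μ := volume) (gaussKernel δ), integral_gaussKernel hδ] at h2
      rw [windowKernel]; linarith
    rw [h1, abs_neg, abs_of_nonneg (integral_nonneg fun _ => gaussKernel_nonneg hδ _)]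
    refine hch _ measurableSet_Ioc.compl fun z hz => ?_
    rcases lt_or_ge L z with h | h
    · have h3 : L + 1 < z := by
        by_contra h4
        exact hz ⟨h, not_lt.mp h4⟩
      refine (min_le_right _ _).trans ?_
      rw [abs_of_nonpos (by linarith [hr.2]), abs_of_nonneg (by linarith [hr.2])]; linarith
    · refine (min_le_left _ _).trans ?_
      rw [abs_of_nonneg (by linarith [hr.1]), abs_of_nonpos (by linarith [hr.1])]; linarith
  · rw [indicator_of_notMem hr, sub_zero, abs_of_nonneg (windowKernel_nonneg hδ L r)]
    refine hch _ measurableSet_Ioc fun z hz => ?_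
    rcases lt_or_ge L r with h | h
    · have h3 : L + 1 < r := by
        by_contra h4
        exact hr ⟨h, not_lt.mp h4⟩
      refine (min_le_right _ _).trans ?_
      rw [abs_of_nonneg (by linarith), abs_of_nonpos (by linarith [hz.2])]; linarith [hz.2]
    · refine (min_le_left _ _).trans ?_
      rw [abs_of_nonpos (by linarith), abs_of_nonneg (by linarith [hz.1])]; linarith [hz.1]

end Kernel

/-! ### The explicit formula over a window -/

section Window

theorem measurable_windowKernel (δ L : ℝ) : Measurable (windowKernel δ L) := by
  have h : StronglyMeasurable (fun p : ℝ × ℝ => gaussKernel δ (p.2 - p.1)) :=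
    ((continuous_gaussKernel δ).comp (continuous_snd.sub continuous_fst)).stronglyMeasurable
  exact (h.integral_prod_right (ν := volume.restrict (Ioc L (L + 1)))).measurable

variable {q : ℕ} [NeZero q]

/-- The zeros contribute `O(√(A X))` to the smoothed explicit formula if the form factor
`F_q(X, T)` is at most `A`. -/
theorem norm_integral_zeroSum_mul_windowKernel_le (a : (ZMod q)ˣ) {X T A δ : ℝ} (hX : 0 < X)
    (hδ : 0 < δ) (hδ1 : δ ≤ 1) (hA0 : 0 < A) (hA : ‖F q a X T‖ ≤ A) :
    ‖∫ r in Ioi (0 : ℝ), zeroSum a T r * cexp (r / 2) * windowKernel δ (Real.log X) r‖ ≤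
      2 * Real.exp 6 * √(A * X) := by
  set L := Real.log X with hL
  have hXL : Real.exp L = X := Real.exp_log hX
  set D := 4 * Real.exp 12 * X with hD
  have hD0 : 0 < D := by positivity
  -- the parameter `l` balances the two terms of the arithmetic-geometric mean inequality
  set l := √(D / A) with hl
  have hl0 : 0 < l := Real.sqrt_pos.mpr (by positivity)
  have hl2 : l ^ 2 = D / A := Real.sq_sqrt (by positivity)
  have hpt : ∀ r : ℝ, ‖zeroSum a T r * cexp (r / 2) * windowKernel δ L r‖ ≤
      l / 2 * (‖zeroSum a T r‖ ^ 2 * Real.exp (-2 * |r - L|)) +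
        D / (4 * l) * Real.exp (-1 * |r - L|) := by
    intro r
    have hk0 := windowKernel_nonneg hδ L r
    have hk1 := windowKernel_le_one hδ L r
    have hk := windowKernel_le_exp hδ hδ1 L r
    rw [norm_mul, norm_mul, norm_exp, norm_real, Real.norm_of_nonneg hk0]
    have hre : ((r : ℂ) / 2).re = r / 2 := by simp
    rw [hre]
    set u := ‖zeroSum a T r‖
    set k := windowKernel δ L r
    set w := |r - L| with hw
    have hE : (Real.exp (r / 2 + w) * k) ^ 2 ≤ D / 2 * Real.exp (-1 * w) := by
      calc (Real.exp (r / 2 + w) * k) ^ 2 = Real.exp (r / 2 + w) ^ 2 * (k * k) := by ring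
        _ ≤ Real.exp (r / 2 + w) ^ 2 * (1 * (2 * Real.exp 12 * Real.exp (-4 * w))) := by gcongr
        _ = 2 * Real.exp 12 * Real.exp (r + 2 * w + -4 * w) := by
            have h5 : Real.exp (r / 2 + w) ^ 2 = Real.exp (r + 2 * w) := by
              rw [← Real.exp_nat_mul]; congr 1; push_cast; ring
            rw [h5, Real.exp_add (r + 2 * w)]; ring
        _ ≤ 2 * Real.exp 12 * Real.exp (L + -1 * w) := by
            refine mul_le_mul_of_nonneg_left (Real.exp_le_exp.mpr ?_) (by positivity)
            have := le_abs_self (r - L)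
            linarith
        _ = _ := by rw [Real.exp_add, hXL, hD]; ring
    have h1 : u * Real.exp (r / 2) * k =
        (u * Real.exp (-w)) * (Real.exp (r / 2 + w) * k) := by
      rw [Real.exp_add, Real.exp_neg]; field_simp
    have h2 : u ^ 2 * Real.exp (-2 * w) = (u * Real.exp (-w)) ^ 2 := by
      rw [mul_pow, ← Real.exp_nat_mul]; congr 2; push_cast; ring
    rw [h1, h2]
    set α := u * Real.exp (-w)
    set β := Real.exp (r / 2 + w) * k
    have h3 : α * β ≤ l / 2 * α ^ 2 + 1 / (2 * l) * β ^ 2 := by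
      have h4 : 0 ≤ (l * α - β) ^ 2 / (2 * l) := by positivity
      have h5 : (l * α - β) ^ 2 / (2 * l) = l / 2 * α ^ 2 + 1 / (2 * l) * β ^ 2 - α * β := by
        field_simp; ring
      linarith
    refine h3.trans (add_le_add le_rfl ?_)
    calc 1 / (2 * l) * β ^ 2 ≤ 1 / (2 * l) * (D / 2 * Real.exp (-1 * w)) := by gcongr
      _ = _ := by field_simp; ring
  have hi1 := (integrable_sq_zeroSum a T L).const_mul (l / 2)
  have hi2 := ((integrable_exp_neg_mul_abs (b := 1) one_pos).comp_sub_right L).const_mul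
    (D / (4 * l))
  refine (norm_integral_le_of_norm_le (hi1.add hi2).integrableOn
    (Filter.Eventually.of_forall hpt)).trans ?_
  refine (setIntegral_le_integral (hi1.add hi2) (Filter.Eventually.of_forall fun r => ?_)).trans ?_
  · simp only [Pi.zero_apply, Pi.add_apply]; positivity
  · simp only [Pi.add_apply]
    rw [integral_add hi1 hi2, integral_const_mul, integral_const_mul,
      integral_sub_right_eq_self (μ := volume) (fun r => Real.exp (-1 * |r|)) L,
      integral_exp_neg_mul_abs one_pos]
    have h6 := integral_sq_zeroSum_le a hX hA
    have h7 : √(A * X) * (2 * Real.exp 6) = l * A := by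
      have h8 : √(A * X) * (2 * Real.exp 6) = √(A * D) := by
        have : A * D = (A * X) * (2 * Real.exp 6) ^ 2 := by
          rw [hD, mul_pow, ← Real.exp_nat_mul]; norm_num; ring
        rw [this, Real.sqrt_mul (show 0 ≤ A * X by positivity), Real.sqrt_sq (by positivity)]
      have h10 := Real.sqrt_mul (show 0 ≤ D / A by positivity) (A ^ 2)
      rw [h8, hl, show A * D = (D / A) * A ^ 2 by field_simp, h10, Real.sqrt_sq hA0.le]
    have h9 : D / l = l * A := by
      have : D = l ^ 2 * A := by rw [hl2]; field_simp
      rw [this]; field_simp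
    calc _ ≤ l / 2 * A + D / (4 * l) * (2 / 1) := by gcongr
      _ = l * A / 2 + D / l / 2 := by field_simp; ring
      _ = √(A * X) * (2 * Real.exp 6) := by rw [h9, h7]; ring
      _ = _ := by ring

theorem norm_mainDensity_le (a : (ZMod q)ˣ) (T : ℝ) {r : ℝ} (hr : 0 ≤ r) :
    ‖mainDensity a T r‖ ≤ (1 + zeroSumBound q T) * Real.exp r := by
  have hφ : (1 : ℝ) ≤ q.totient := by exact_mod_cast Nat.totient_pos.mpr (Nat.pos_of_neZero q)
  have hz := norm_zeroSum_le a T r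
  rw [mainDensity, norm_mul, norm_inv, Complex.norm_natCast]
  refine (mul_le_of_le_one_left (norm_nonneg _) (inv_le_one_of_one_le₀ hφ)).trans ?_
  refine (norm_sub_le _ _).trans ?_
  rw [norm_mul, norm_exp, norm_exp, add_mul, one_mul]
  have h1 : ((r : ℂ) / 2).re ≤ r := by simp; linarith
  have h2 : (r : ℂ).re = r := ofReal_re r
  rw [h2]
  have h3 : 0 ≤ zeroSumBound q T := (norm_nonneg _).trans hz
  gcongr

theorem continuous_mainDensity (a : (ZMod q)ˣ) (T : ℝ) : Continuous (mainDensity a T) := by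
  have := continuous_zeroSum a T
  unfold mainDensity; fun_prop

theorem gaussKernel_le_exp {δ : ℝ} (hδ : 0 < δ) (y : ℝ) :
    gaussKernel δ y ≤ (√(2 * Real.pi) * δ)⁻¹ * Real.exp (8 * δ ^ 2) * Real.exp (-4 * |y|) := by
  rw [gaussKernel, mul_assoc, ← Real.exp_add]
  refine mul_le_mul_of_nonneg_left (Real.exp_le_exp.mpr ?_) (by positivity)
  have h : -y ^ 2 / (2 * δ ^ 2) = 8 * δ ^ 2 + -4 * |y| - (|y| - 4 * δ ^ 2) ^ 2 / (2 * δ ^ 2) := by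
    have := sq_abs y
    field_simp
    rw [← this]; ring
  rw [h]
  have : 0 ≤ (|y| - 4 * δ ^ 2) ^ 2 / (2 * δ ^ 2) := by positivity
  linarith

theorem integrable_mainDensity_mul_gaussKernel_prod (a : (ZMod q)ˣ) (T : ℝ) {δ : ℝ} (hδ : 0 < δ)
    (L : ℝ) : Integrable (fun p : ℝ × ℝ => mainDensity a T p.2 * gaussKernel δ (p.1 - p.2))
      ((volume.restrict (Ioc L (L + 1))).prod (volume.restrict (Ioi 0))) := by
  set M := (1 + zeroSumBound q T) * ((√(2 * Real.pi) * δ)⁻¹ * Real.exp (8 * δ ^ 2)) with hM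
  have hzb : 0 ≤ zeroSumBound q T := by unfold zeroSumBound; positivity
  have hdom : Integrable (fun p : ℝ × ℝ => (M * Real.exp (4 * (L + 1))) *
      Real.exp (-3 * p.2)) ((volume.restrict (Ioc L (L + 1))).prod (volume.restrict (Ioi 0))) :=
    (integrable_const _).mul_prod (integrableOn_exp_mul_Ioi (by norm_num : (-3 : ℝ) < 0) 0)
  rw [Measure.prod_restrict] at *
  refine hdom.mono' ?_ ?_
  · have h1 := continuous_mainDensity a T
    have h2 := continuous_gaussKernel δ
    exact (by fun_prop : Continuous fun p : ℝ × ℝ =>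
      mainDensity a T p.2 * (gaussKernel δ (p.1 - p.2) : ℂ)).aestronglyMeasurable
  · filter_upwards [ae_restrict_mem (measurableSet_Ioc.prod measurableSet_Ioi)] with p hp
    have hp2 : 0 < p.2 := hp.2
    rw [norm_mul, norm_real, Real.norm_of_nonneg (gaussKernel_nonneg hδ _)]
    calc _ ≤ ((1 + zeroSumBound q T) * Real.exp p.2) * ((√(2 * Real.pi) * δ)⁻¹ *
          Real.exp (8 * δ ^ 2) * Real.exp (-4 * |p.1 - p.2|)) := by
          gcongr
          · exact gaussKernel_nonneg hδ _
          · exact norm_mainDensity_le a T hp2.le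
          · exact gaussKernel_le_exp hδ _
      _ = M * (Real.exp p.2 * Real.exp (-4 * |p.1 - p.2|)) := by rw [hM]; ring
      _ ≤ M * (Real.exp (4 * (L + 1)) * Real.exp (-3 * p.2)) := by
          rw [← Real.exp_add, ← Real.exp_add]
          refine mul_le_mul_of_nonneg_left (Real.exp_le_exp.mpr ?_) (by positivity)
          have h1 := neg_abs_le (p.1 - p.2)
          have h2 : p.1 ≤ L + 1 := hp.1.2
          linarith
      _ = _ := by ring

omit [NeZero q] in
theorem residueClass_mul_exp_le (a : ZMod q) {L : ℝ} (n : ℕ) :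
    residueClass a n * Real.exp (-4 * |Real.log n - L|) ≤ Real.exp (4 * L) * (1 / (n : ℝ) ^ 3) := by
  rcases eq_or_ne n 0 with rfl | hn
  · simp
  · have hn0 : (0 : ℝ) < n := by exact_mod_cast Nat.pos_of_ne_zero hn
    have h1 : residueClass a n ≤ n := (residueClass_le a n).trans
      (ArithmeticFunction.vonMangoldt_le_log.trans (Real.log_le_self hn0.le))
    have h2 : Real.exp (-4 * |Real.log n - L|) ≤ Real.exp (4 * L) * (1 / (n : ℝ) ^ 4) := by
      have h3 : (1 / (n : ℝ) ^ 4) = Real.exp (-4 * Real.log n) := by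
        rw [show -4 * Real.log n = -(((4 : ℕ) : ℝ) * Real.log n) by push_cast; ring, Real.exp_neg,
          Real.exp_nat_mul, Real.exp_log hn0, one_div]
      rw [h3, ← Real.exp_add]
      refine Real.exp_le_exp.mpr ?_
      have := le_abs_self (Real.log n - L)
      linarith
    calc _ ≤ (n : ℝ) * (Real.exp (4 * L) * (1 / (n : ℝ) ^ 4)) := by gcongr
      _ = _ := by field_simp

omit [NeZero q] in
theorem summable_residueClass_mul_windowKernel (a : ZMod q) {δ : ℝ} (hδ : 0 < δ) (hδ1 : δ ≤ 1)
    (L : ℝ) : Summable fun n : ℕ => residueClass a n * windowKernel δ L (Real.log n) := by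
  have hs : Summable fun n : ℕ => 2 * Real.exp 12 * (Real.exp (4 * L) * (1 / (n : ℝ) ^ 3)) :=
    ((Real.summable_one_div_nat_pow.mpr (by norm_num)).mul_left _).mul_left _
  refine hs.of_nonneg_of_le (fun n => mul_nonneg (residueClass_nonneg a n)
    (windowKernel_nonneg hδ L _)) (fun n => ?_)
  calc _ ≤ residueClass a n * (2 * Real.exp 12 * Real.exp (-4 * |Real.log n - L|)) :=
        mul_le_mul_of_nonneg_left (windowKernel_le_exp hδ hδ1 L _) (residueClass_nonneg a n)
    _ = 2 * Real.exp 12 * (residueClass a n * Real.exp (-4 * |Real.log n - L|)) := by ring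
    _ ≤ _ := by
        exact mul_le_mul_of_nonneg_left (residueClass_mul_exp_le a n) (by positivity)

omit [NeZero q] in
theorem integral_tsum_residueClass (a : ZMod q) {δ : ℝ} (hδ : 0 < δ) (hδ1 : δ ≤ 1) (L : ℝ) :
    ∫ z in Ioc L (L + 1), ∑' n : ℕ, (residueClass a n : ℂ) * gaussKernel δ (z - Real.log n) =
      ((∑' n : ℕ, residueClass a n * windowKernel δ L (Real.log n) : ℝ) : ℂ) := by
  have hi : ∀ n : ℕ, IntegrableOn (fun z => (residueClass a n : ℂ) *
      (gaussKernel δ (z - Real.log n) : ℂ)) (Ioc L (L + 1)) := fun n =>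
    ((integrable_gaussKernel_sub hδ _).ofReal.const_mul _).integrableOn
  have hnorm : ∀ n : ℕ, ∫ z in Ioc L (L + 1), ‖(residueClass a n : ℂ) *
      (gaussKernel δ (z - Real.log n) : ℂ)‖ = residueClass a n * windowKernel δ L (Real.log n) := by
    intro n
    rw [windowKernel, ← integral_const_mul]
    refine integral_congr_ae (Filter.Eventually.of_forall fun z => ?_)
    beta_reduce
    rw [norm_mul, norm_real, norm_real, Real.norm_of_nonneg (residueClass_nonneg a n),
      Real.norm_of_nonneg (gaussKernel_nonneg hδ _)]
  have h := hasSum_integral_of_summable_integral_norm hi (by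
    simp_rw [hnorm]; exact summable_residueClass_mul_windowKernel a hδ hδ1 L)
  rw [← h.tsum_eq, ofReal_tsum]
  refine tsum_congr fun n => ?_
  rw [integral_const_mul, integral_complex_ofReal, windowKernel]
  push_cast; rfl

theorem integral_integral_mainDensity (a : (ZMod q)ˣ) (T : ℝ) {δ : ℝ} (hδ : 0 < δ) (L : ℝ) :
    ∫ z in Ioc L (L + 1), ∫ r in Ioi (0 : ℝ), mainDensity a T r * gaussKernel δ (z - r) =
      ∫ r in Ioi (0 : ℝ), mainDensity a T r * windowKernel δ L r := by
  rw [integral_integral_swap (integrable_mainDensity_mul_gaussKernel_prod a T hδ L)]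
  refine integral_congr_ae (Filter.Eventually.of_forall fun r => ?_)
  beta_reduce
  rw [integral_const_mul, integral_complex_ofReal, windowKernel]

omit [NeZero q] in
theorem integrableOn_tsum_residueClass (a : ZMod q) {δ : ℝ} (hδ : 0 < δ) (L : ℝ) :
    IntegrableOn (fun z => ∑' n : ℕ, (residueClass a n : ℂ) * gaussKernel δ (z - Real.log n))
      (Ioc L (L + 1)) := by
  have hs : Summable fun n : ℕ => (√(2 * Real.pi) * δ)⁻¹ * Real.exp (8 * δ ^ 2) *
      (Real.exp (4 * (L + 1)) * (1 / (n : ℝ) ^ 3)) :=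
    ((Real.summable_one_div_nat_pow.mpr (by norm_num)).mul_left _).mul_left _
  have hcont : ContinuousOn (fun z => ∑' n : ℕ, (residueClass a n : ℂ) *
      gaussKernel δ (z - Real.log n)) (Icc L (L + 1)) := by
    refine continuousOn_tsum (fun n => ?_) hs (fun n z hz => ?_)
    · have := continuous_gaussKernel δ
      exact (by fun_prop : Continuous fun z : ℝ => (residueClass a n : ℂ) *
        (gaussKernel δ (z - Real.log n) : ℂ)).continuousOn
    · rw [norm_mul, norm_real, norm_real, Real.norm_of_nonneg (residueClass_nonneg a n),
        Real.norm_of_nonneg (gaussKernel_nonneg hδ _)]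
      calc _ ≤ residueClass a n * ((√(2 * Real.pi) * δ)⁻¹ * Real.exp (8 * δ ^ 2) *
            Real.exp (-4 * |z - Real.log n|)) :=
            mul_le_mul_of_nonneg_left (gaussKernel_le_exp hδ _) (residueClass_nonneg a n)
        _ = (√(2 * Real.pi) * δ)⁻¹ * Real.exp (8 * δ ^ 2) *
            (residueClass a n * Real.exp (-4 * |Real.log n - z|)) := by rw [abs_sub_comm]; ring
        _ ≤ (√(2 * Real.pi) * δ)⁻¹ * Real.exp (8 * δ ^ 2) *
            (Real.exp (4 * z) * (1 / (n : ℝ) ^ 3)) := by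
            exact mul_le_mul_of_nonneg_left (residueClass_mul_exp_le a n) (by positivity)
        _ ≤ _ := by
            gcongr
            exact hz.2
  exact hcont.integrableOn_Icc.mono_set Ioc_subset_Icc_self

end Window

/-- The explicit formula of `exists_smoothed_explicit_formula` integrated over the window
`(L, L + 1]`. -/
theorem exists_window_explicit_formula (hGRH : GRH) {c : ℝ} (hc : 0 < c) (hc' : c ≤ 1 / 16) :
    ∃ K X₀ : ℝ, 0 < K ∧ 3 ≤ X₀ ∧ ∀ X : ℝ, X₀ ≤ X → ∀ (q : ℕ) [NeZero q], (q : ℝ) ≤ X →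
      ∀ (a : (ZMod q)ˣ) (T δ : ℝ), 4 ≤ T → T ≤ X → 0 < δ → δ ≤ 1 →
        ‖((∑' n : ℕ, residueClass (a : ZMod q) n * windowKernel δ (Real.log X) (Real.log n) : ℝ) : ℂ)
          - ∫ r in Ioi (0 : ℝ), mainDensity a T r * windowKernel δ (Real.log X) r‖ ≤
        K * Real.log X * T / δ *
          (X ^ (4 * c) + X ^ 2 * Real.exp (-(δ ^ 2 * (T - 4) ^ 2 / 4))) := by
  obtain ⟨K, X₀, hK, hX₀, hmain⟩ := exists_smoothed_explicit_formula hGRH hc hc'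
  refine ⟨K * Real.exp 2, X₀, by positivity, hX₀, ?_⟩
  intro X hX q _ hqX a T δ hT4 hTX hδ hδ1
  have hX3 : 3 ≤ X := hX₀.trans hX
  set L := Real.log X with hL
  have hL0 : 0 ≤ L := Real.log_nonneg (by linarith)
  have hi2 : IntegrableOn (fun z => ∫ r in Ioi (0 : ℝ), mainDensity a T r * gaussKernel δ (z - r))
      (Ioc L (L + 1)) :=
    (integrable_mainDensity_mul_gaussKernel_prod a T hδ L).integral_prod_left
  rw [← integral_tsum_residueClass _ hδ hδ1, ← integral_integral_mainDensity a T hδ L,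
    ← integral_sub (integrableOn_tsum_residueClass _ hδ L) hi2]
  have hXc : Real.exp (4 * c * L) = X ^ (4 * c) := by
    rw [Real.rpow_def_of_pos (by linarith), hL]; ring_nf
  have hX2 : Real.exp (2 * L) = X ^ 2 := by
    have := Real.exp_nat_mul L 2
    rw [hL, Real.exp_log (by linarith)] at this
    exact_mod_cast this
  have hbd := norm_setIntegral_le_of_norm_le_const (μ := volume) (s := Ioc L (L + 1))
    (f := fun z => ∑' n : ℕ, (residueClass (a : ZMod q) n : ℂ) * gaussKernel δ (z - Real.log n) -
      ∫ r in Ioi (0 : ℝ), mainDensity a T r * gaussKernel δ (z - r))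
    (C := K * Real.exp 2 * L * T / δ *
          (X ^ (4 * c) + X ^ 2 * Real.exp (-(δ ^ 2 * (T - 4) ^ 2 / 4)))) (by simp) (fun z hz => by
      refine (hmain X hX q hqX a T δ z hT4 hTX hδ hδ1 (hL0.trans hz.1.le)).trans ?_
      have h1 : Real.exp (4 * c * z) ≤ Real.exp 2 * X ^ (4 * c) := by
        rw [← hXc, ← Real.exp_add]
        refine Real.exp_le_exp.mpr ?_
        nlinarith [hz.2]
      have h2 : Real.exp (2 * z - δ ^ 2 * (T - 4) ^ 2 / 4) ≤
          Real.exp 2 * (X ^ 2 * Real.exp (-(δ ^ 2 * (T - 4) ^ 2 / 4))) := by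
        rw [← hX2, ← Real.exp_add, ← Real.exp_add]
        refine Real.exp_le_exp.mpr ?_
        linarith [hz.2]
      calc _ ≤ K * L * T / δ * (Real.exp 2 * X ^ (4 * c) +
            Real.exp 2 * (X ^ 2 * Real.exp (-(δ ^ 2 * (T - 4) ^ 2 / 4)))) := by gcongr
        _ = _ := by ring)
  simpa using hbd

/-! ### The main terms in a window -/

section MainTerm

theorem exp_mul_exp_neg_abs_le (δ z r : ℝ) :
    Real.exp r * Real.exp (-|r - z| / δ) ≤ Real.exp z * Real.exp (-(1 / δ - 1) * |r - z|) := by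
  rw [← Real.exp_add, ← Real.exp_add]
  refine Real.exp_le_exp.mpr ?_
  have h1 := le_abs_self (r - z)
  have h2 : -(1 / δ - 1) * |r - z| = -|r - z| / δ + |r - z| := by ring
  rw [h2]; linarith

theorem integrable_exp_mul_windowKernel {δ : ℝ} (hδ : 0 < δ) (hδ1 : δ ≤ 1) (L : ℝ) :
    Integrable fun r : ℝ => Real.exp r * windowKernel δ L r := by
  have h := ((integrable_exp_neg_mul_abs (b := 3) (by norm_num)).comp_sub_right L).const_mul
    (2 * Real.exp 12 * Real.exp L)
  refine h.mono' (Real.measurable_exp.mul (measurable_windowKernel δ L)).aestronglyMeasurable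
    (Filter.Eventually.of_forall fun r => ?_)
  rw [Real.norm_of_nonneg (mul_nonneg (Real.exp_nonneg r) (windowKernel_nonneg hδ L r))]
  calc _ ≤ Real.exp r * (2 * Real.exp 12 * Real.exp (-4 * |r - L|)) := by
        gcongr; exact windowKernel_le_exp hδ hδ1 L r
    _ = 2 * Real.exp 12 * (Real.exp (r + -4 * |r - L|)) := by rw [Real.exp_add]; ring
    _ ≤ 2 * Real.exp 12 * (Real.exp (L + -3 * |r - L|)) := by
        refine mul_le_mul_of_nonneg_left (Real.exp_le_exp.mpr ?_) (by positivity)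
        have := le_abs_self (r - L)
        linarith
    _ = _ := by rw [Real.exp_add]; ring

/-- The smoothed window has essentially the same `e^r`-weighted mass as `(L, L + 1]`. -/
theorem abs_integral_exp_mul_windowKernel_sub_le {δ L : ℝ} (hδ : 0 < δ) (hδ1 : δ ≤ 1 / 2)
    (hL : 0 ≤ L) :
    |(∫ r in Ioi (0 : ℝ), Real.exp r * windowKernel δ L r) - (Real.exp 1 - 1) * Real.exp L| ≤
      64 * δ * Real.exp L := by
  have hb : 0 < 1 / δ - 1 := by
    have : 2 ≤ 1 / δ := by rw [le_div_iff₀ hδ]; linarith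
    linarith
  have hind : ∫ r in Ioi (0 : ℝ), Real.exp r * indicator (Ioc L (L + 1)) 1 r =
      (Real.exp 1 - 1) * Real.exp L := by
    have h1 : (fun r : ℝ => Real.exp r * indicator (Ioc L (L + 1)) (1 : ℝ → ℝ) r) =
        indicator (Ioc L (L + 1)) Real.exp := by
      ext r; by_cases hr : r ∈ Ioc L (L + 1) <;> simp [hr]
    have h2 : Ioc L (L + 1) ⊆ Ioi 0 := fun r hr => hL.trans_lt hr.1
    rw [h1, setIntegral_indicator measurableSet_Ioc, inter_eq_right.mpr h2,
      ← intervalIntegral.integral_of_le (by linarith), integral_exp, Real.exp_add]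
    ring
  have hiI : IntegrableOn (fun r : ℝ => Real.exp r * indicator (Ioc L (L + 1)) (1 : ℝ → ℝ) r)
      (Ioi 0) := by
    have h1 : (fun r : ℝ => Real.exp r * indicator (Ioc L (L + 1)) (1 : ℝ → ℝ) r) =
        indicator (Ioc L (L + 1)) Real.exp := by
      ext r; by_cases hr : r ∈ Ioc L (L + 1) <;> simp [hr]
    rw [h1]
    exact ((Real.continuous_exp.integrableOn_Icc (a := L) (b := L + 1)).mono_set
      Ioc_subset_Icc_self).integrable_indicator measurableSet_Ioc |>.integrableOn
  rw [← hind, ← integral_sub (integrable_exp_mul_windowKernel hδ (by linarith) L).integrableOn hiI]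
  have hdom : ∀ z : ℝ, Integrable fun r => 4 * (Real.exp z * Real.exp (-(1 / δ - 1) * |r - z|)) :=
    fun z => (((integrable_exp_neg_mul_abs hb).comp_sub_right z).const_mul _).const_mul _
  have hval : ∀ z : ℝ, ∫ r, 4 * (Real.exp z * Real.exp (-(1 / δ - 1) * |r - z|)) ≤
      16 * δ * Real.exp z := by
    intro z
    rw [integral_const_mul, integral_const_mul,
      integral_sub_right_eq_self (fun r => Real.exp (-(1 / δ - 1) * |r|)) z,
      integral_exp_neg_mul_abs hb]
    have h2 : 2 / (1 / δ - 1) ≤ 4 * δ := by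
      rw [div_le_iff₀ hb]
      have : 4 * δ * (1 / δ - 1) = 4 - 4 * δ := by field_simp
      linarith
    calc _ ≤ 4 * (Real.exp z * (4 * δ)) := by gcongr
      _ = _ := by ring
  rw [← Real.norm_eq_abs]
  refine (norm_integral_le_of_norm_le ((hdom L).add (hdom (L + 1))).integrableOn
    (Filter.Eventually.of_forall fun r => ?_)).trans ?_
  · rw [← mul_sub, norm_mul, Real.norm_eq_abs, Real.norm_eq_abs, abs_of_pos (Real.exp_pos r)]
    calc _ ≤ Real.exp r * (4 * (Real.exp (-|r - L| / δ) + Real.exp (-|r - (L + 1)| / δ))) := by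
          gcongr; exact abs_windowKernel_sub_indicator_le hδ L r
      _ = 4 * (Real.exp r * Real.exp (-|r - L| / δ)) +
          4 * (Real.exp r * Real.exp (-|r - (L + 1)| / δ)) := by ring
      _ ≤ _ := by
          simp only [Pi.add_apply]
          exact add_le_add (mul_le_mul_of_nonneg_left (exp_mul_exp_neg_abs_le δ L r) (by norm_num))
            (mul_le_mul_of_nonneg_left (exp_mul_exp_neg_abs_le δ (L + 1) r) (by norm_num))
  · refine (setIntegral_le_integral ((hdom L).add (hdom (L + 1)))
      (Filter.Eventually.of_forall fun r => ?_)).trans ?_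
    · simp only [Pi.zero_apply, Pi.add_apply]; positivity
    · simp only [Pi.add_apply]
      rw [integral_add (hdom L) (hdom (L + 1))]
      refine (add_le_add (hval L) (hval (L + 1))).trans ?_
      rw [Real.exp_add]
      have h3 : Real.exp 1 ≤ 3 := by have := Real.exp_one_lt_d9; linarith
      have h4 : 0 ≤ 16 * δ * Real.exp L := by positivity
      nlinarith

variable {q : ℕ} [NeZero q]

/-- The main terms of the explicit formula for a window: the expected number of primes, and the
contribution of the zeros estimated by means of the form factor. -/
theorem norm_integral_mainDensity_sub_le (a : (ZMod q)ˣ) {X T A δ : ℝ} (hX : 1 ≤ X)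
    (hδ : 0 < δ) (hδ1 : δ ≤ 1 / 2) (hA0 : 0 < A) (hA : ‖F q a X T‖ ≤ A) :
    ‖(∫ r in Ioi (0 : ℝ), mainDensity a T r * windowKernel δ (Real.log X) r) -
      (((Real.exp 1 - 1) * X / q.totient : ℝ) : ℂ)‖ ≤
        (2 * Real.exp 6 * √(A * X) + 64 * δ * X) / q.totient := by
  set L := Real.log X with hL
  have hX0 : 0 < X := by linarith
  have hXL : Real.exp L = X := Real.exp_log hX0
  have hφ : (0 : ℝ) < q.totient := by exact_mod_cast Nat.totient_pos.mpr (Nat.pos_of_neZero q)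
  have hi1 : Integrable fun r : ℝ => ((Real.exp r * windowKernel δ L r : ℝ) : ℂ) :=
    (integrable_exp_mul_windowKernel hδ (by linarith) L).ofReal
  have hi2 : IntegrableOn (fun r : ℝ => zeroSum a T r * cexp (r / 2) * windowKernel δ L r)
      (Ioi 0) := by
    have h := (integrable_exp_mul_windowKernel hδ (by linarith : δ ≤ 1) L).const_mul
      (zeroSumBound q T)
    refine h.integrableOn.mono' ?_ ?_
    · have h1 := continuous_zeroSum a T
      have h2 : Continuous fun r : ℝ => zeroSum a T r * cexp (r / 2) := by fun_prop
      exact (h2.measurable.mul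
        (measurable_ofReal.comp (measurable_windowKernel δ L))).aestronglyMeasurable
    · filter_upwards [ae_restrict_mem measurableSet_Ioi] with r hr
      have hr0 : 0 < r := hr
      have hk := windowKernel_nonneg hδ L r
      rw [norm_mul, norm_mul, norm_exp, norm_real, Real.norm_of_nonneg hk,
        ← mul_assoc]
      have h1 : ((r : ℂ) / 2).re ≤ r := by simp; linarith
      have h3 : 0 ≤ zeroSumBound q T := (norm_nonneg _).trans (norm_zeroSum_le a T r)
      exact mul_le_mul_of_nonneg_right (mul_le_mul (norm_zeroSum_le a T r)
        (Real.exp_le_exp.mpr h1) (Real.exp_nonneg _) h3) hk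
  have hsplit : ∫ r in Ioi (0 : ℝ), mainDensity a T r * windowKernel δ L r =
      (q.totient : ℂ)⁻¹ * (((∫ r in Ioi (0 : ℝ), Real.exp r * windowKernel δ L r : ℝ) : ℂ) -
        ∫ r in Ioi (0 : ℝ), zeroSum a T r * cexp (r / 2) * windowKernel δ L r) := by
    rw [← integral_complex_ofReal, ← integral_sub hi1.integrableOn hi2, ← integral_const_mul]
    refine integral_congr_ae (Filter.Eventually.of_forall fun r => ?_)
    simp only [mainDensity, ofReal_mul, ofReal_exp]
    ring
  have h1 := abs_integral_exp_mul_windowKernel_sub_le hδ hδ1 (Real.log_nonneg hX)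
  rw [← hL, hXL] at h1
  have h2 := norm_integral_zeroSum_mul_windowKernel_le a (T := T) hX0 hδ (by linarith) hA0 hA
  rw [← hL] at h2
  set I₁ := ∫ r in Ioi (0 : ℝ), Real.exp r * windowKernel δ L r
  set I₂ := ∫ r in Ioi (0 : ℝ), zeroSum a T r * cexp (r / 2) * windowKernel δ L r
  have h3 : (q.totient : ℂ)⁻¹ * ((I₁ : ℂ) - I₂) - (((Real.exp 1 - 1) * X / q.totient : ℝ) : ℂ) =
      (q.totient : ℂ)⁻¹ * (((I₁ - (Real.exp 1 - 1) * X : ℝ) : ℂ) - I₂) := by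
    push_cast; ring
  rw [hsplit, h3, norm_mul, norm_inv, Complex.norm_natCast, div_eq_inv_mul]
  gcongr
  refine (norm_sub_le _ _).trans ?_
  rw [norm_real, Real.norm_eq_abs]
  linarith

end MainTerm

/-! ### Primes in a residue class near the ends of the window -/

section Primes

variable {q : ℕ} [NeZero q]

theorem card_filter_zmod_eq_le (a : ZMod q) {u v : ℝ} (hu : 0 ≤ u) (huv : u ≤ v) :
    (((Finset.Ioc ⌊u⌋₊ ⌊v⌋₊).filter fun n : ℕ => (n : ZMod q) = a).card : ℝ) ≤
      (v - u) / q + 2 := by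
  have hq : (0 : ℚ) < q := by exact_mod_cast Nat.pos_of_neZero q
  have hq1 : (1 : ℝ) ≤ q := by exact_mod_cast Nat.pos_of_neZero q
  have hfilter : ((Finset.Ioc ⌊u⌋₊ ⌊v⌋₊).filter fun n : ℕ => (n : ZMod q) = a) =
      (Finset.Ioc ⌊u⌋₊ ⌊v⌋₊).filter fun n : ℕ => n ≡ a.val [MOD q] := by
    refine Finset.filter_congr fun n _ => ?_
    rw [← ZMod.natCast_eq_natCast_iff, ZMod.natCast_zmod_val]
  have hcard := Nat.Ioc_filter_modEq_card ⌊u⌋₊ ⌊v⌋₊ (Nat.pos_of_neZero q) a.val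
  rw [← hfilter] at hcard
  set N := ((Finset.Ioc ⌊u⌋₊ ⌊v⌋₊).filter fun n : ℕ => (n : ZMod q) = a).card
  have hfl : ((⌊u⌋₊ : ℕ) : ℚ) ≤ (⌊v⌋₊ : ℕ) := by exact_mod_cast Nat.floor_mono huv
  have h1 : (N : ℚ) ≤ ((⌊v⌋₊ : ℕ) - (⌊u⌋₊ : ℕ) : ℚ) / q + 1 := by
    have h2 : (N : ℚ) = ((max (⌊((⌊v⌋₊ : ℕ) - (a.val : ℕ) : ℚ) / q⌋ -
        ⌊((⌊u⌋₊ : ℕ) - (a.val : ℕ) : ℚ) / q⌋) 0 : ℤ) : ℚ) := by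
      rw [← hcard]; simp
    rw [h2]
    push_cast
    refine max_le ?_ (by have := div_nonneg (sub_nonneg.mpr hfl) hq.le; linarith)
    have h3 := Int.floor_le (((⌊v⌋₊ : ℕ) - (a.val : ℕ) : ℚ) / q)
    have h4 := Int.lt_floor_add_one (((⌊u⌋₊ : ℕ) - (a.val : ℕ) : ℚ) / q)
    have h5 : (((⌊v⌋₊ : ℕ) - (⌊u⌋₊ : ℕ) : ℚ) / q) = ((⌊v⌋₊ : ℕ) - (a.val : ℕ) : ℚ) / q -
        ((⌊u⌋₊ : ℕ) - (a.val : ℕ) : ℚ) / q := by ring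
    linarith
  have h1' : (N : ℝ) ≤ ((⌊v⌋₊ : ℕ) - (⌊u⌋₊ : ℕ) : ℝ) / q + 1 := by exact_mod_cast h1
  have h6 := Nat.floor_le (hu.trans huv)
  have h7 := Nat.lt_floor_add_one u
  have h8 : ((⌊v⌋₊ : ℕ) - (⌊u⌋₊ : ℕ) : ℝ) / q ≤ (v - u + 1) / q := by gcongr; linarith
  have h9 : (v - u + 1) / q ≤ (v - u) / q + 1 := by
    rw [add_div]; gcongr; rw [div_le_one (by linarith)]; exact hq1
  linarith

/-- Integers `n ≡ a (mod q)` with `log n` within `8δz` of `z` are counted trivially; for the others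
the exponential factor saves a power of `e^z`. -/
theorem summable_and_tsum_residueClass_mul_exp_le (a : ZMod q) {δ z : ℝ} (hδ : 0 < δ)
    (hδ1 : δ ≤ 1 / 8) (hz : 0 ≤ z) (hδz : 8 * δ * z ≤ 1) :
    (Summable fun n : ℕ => residueClass a n * Real.exp (-|Real.log n - z| / δ)) ∧
    ∑' n : ℕ, residueClass a n * Real.exp (-|Real.log n - z| / δ) ≤
      (z + 1) * (24 * δ * z * Real.exp z / q + 2) + ∑' n : ℕ, 1 / (n : ℝ) ^ 3 := by
  set d := 8 * δ * z with hd
  have hd0 : 0 ≤ d := by positivity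
  set u := Real.exp (z - d)
  set v := Real.exp (z + d)
  have huv : u ≤ v := Real.exp_le_exp.mpr (by linarith)
  set S := (Finset.Ioc ⌊u⌋₊ ⌊v⌋₊).filter fun n : ℕ => (n : ZMod q) = a with hS
  have hcard : (S.card : ℝ) ≤ 24 * δ * z * Real.exp z / q + 2 := by
    refine (card_filter_zmod_eq_le a (Real.exp_nonneg _) huv).trans ?_
    gcongr
    have h1 : Real.exp d ≤ 1 + 2 * d := by
      have := (abs_le.mp (Real.abs_exp_sub_one_le (x := d) (by rwa [abs_of_nonneg hd0]))).2
      rw [abs_of_nonneg hd0] at this; linarith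
    have h2 : 1 - d ≤ Real.exp (-d) := by have := Real.add_one_le_exp (-d); linarith
    calc v - u = Real.exp z * (Real.exp d - Real.exp (-d)) := by
          rw [mul_sub, ← Real.exp_add, ← Real.exp_add, ← sub_eq_add_neg z d]
      _ ≤ Real.exp z * (3 * d) := by gcongr; linarith
      _ = _ := by rw [hd]; ring
  have hs3 : Summable fun n : ℕ => 1 / (n : ℝ) ^ 3 :=
    Real.summable_one_div_nat_pow.mpr (by norm_num)
  have hsS : HasSum (fun n : ℕ => if n ∈ S then z + 1 else 0) (S.card * (z + 1)) := by
    have : HasSum (fun n : ℕ => if n ∈ S then z + 1 else 0) (∑ n ∈ S, if n ∈ S then z + 1 else 0) :=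
      hasSum_sum_of_ne_finset_zero fun n hn => by simp [hn]
    rwa [Finset.sum_ite_mem, Finset.inter_self, Finset.sum_const, nsmul_eq_mul] at this
  have hle : ∀ n : ℕ, residueClass a n * Real.exp (-|Real.log n - z| / δ) ≤
      (if n ∈ S then z + 1 else 0) + 1 / (n : ℝ) ^ 3 := by
    intro n
    have hA0 := residueClass_nonneg a n
    have h3 : 0 ≤ 1 / (n : ℝ) ^ 3 := by positivity
    rcases eq_or_ne n 0 with rfl | hn
    · have : (0 : ℝ) ≤ if 0 ∈ S then z + 1 else 0 := by split_ifs <;> linarith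
      simpa using this
    have hn0 : (0 : ℝ) < n := by exact_mod_cast Nat.pos_of_ne_zero hn
    by_cases hnS : n ∈ S
    · rw [if_pos hnS]
      have hnv : (n : ℝ) ≤ v := by
        have := (Finset.mem_Ioc.mp (Finset.mem_filter.mp hnS).1).2
        exact (Nat.le_floor_iff (Real.exp_nonneg _)).mp this
      have h4 : residueClass a n ≤ z + 1 := by
        refine (residueClass_le a n).trans (ArithmeticFunction.vonMangoldt_le_log.trans ?_)
        have := Real.log_le_log hn0 hnv
        rw [Real.log_exp] at this; linarith
      have h5 : Real.exp (-|Real.log n - z| / δ) ≤ 1 := by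
        rw [Real.exp_le_one_iff]
        exact div_nonpos_of_nonpos_of_nonneg (by simp) hδ.le
      have := mul_le_mul h4 h5 (Real.exp_nonneg _) (by linarith)
      linarith
    · rw [if_neg hnS, zero_add]
      by_cases hna : (n : ZMod q) = a
      · have hfar : d ≤ |Real.log n - z| := by
          by_contra! hlt
          rw [abs_lt] at hlt
          refine hnS (Finset.mem_filter.mpr ⟨Finset.mem_Ioc.mpr ⟨?_, ?_⟩, hna⟩)
          · rw [Nat.floor_lt (Real.exp_nonneg _), ← Real.exp_log hn0]
            exact Real.exp_lt_exp.mpr (by linarith)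
          · rw [Nat.le_floor_iff (Real.exp_nonneg _), ← Real.exp_log hn0]
            exact Real.exp_le_exp.mpr (by linarith)
        have h6 : Real.exp (-|Real.log n - z| / δ) ≤
            Real.exp (-4 * |Real.log n - z|) * Real.exp (-(4 * z)) := by
          rw [← Real.exp_add]
          refine Real.exp_le_exp.mpr ?_
          rw [div_le_iff₀ hδ]
          nlinarith [abs_nonneg (Real.log n - z)]
        calc _ ≤ residueClass a n *
              (Real.exp (-4 * |Real.log n - z|) * Real.exp (-(4 * z))) := by gcongr
          _ = (residueClass a n * Real.exp (-4 * |Real.log n - z|)) * Real.exp (-(4 * z)) := by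
              ring
          _ ≤ (Real.exp (4 * z) * (1 / (n : ℝ) ^ 3)) * Real.exp (-(4 * z)) :=
              mul_le_mul_of_nonneg_right (residueClass_mul_exp_le a n) (Real.exp_nonneg _)
          _ = _ := by rw [Real.exp_neg]; field_simp
      · have : residueClass a n = 0 := by
          simp [residueClass, hna]
        rw [this, zero_mul]; exact h3
  have hsum := Summable.of_nonneg_of_le (fun n => mul_nonneg (residueClass_nonneg a n)
    (Real.exp_nonneg _)) hle (hsS.summable.add hs3)
  refine ⟨hsum, (hsum.tsum_le_tsum hle (hsS.summable.add hs3)).trans ?_⟩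
  rw [hsS.summable.tsum_add hs3, hsS.tsum_eq, mul_comm (S.card : ℝ)]
  gcongr

omit [NeZero q] in
theorem psi_eq_sum_residueClass (x : ℝ) (a : ZMod q) :
    psi x q a = ∑ n ∈ Finset.Ioc 0 ⌊x⌋₊, residueClass a n := by
  rw [psi, Finset.sum_filter]
  refine Finset.sum_congr (by ext n; simp; omega) fun n _ => ?_
  simp [residueClass, indicator_apply]

omit [NeZero q] in
theorem hasSum_residueClass_mul_indicator (a : ZMod q) {X : ℝ} (hX : 1 ≤ X) :
    HasSum (fun n : ℕ => residueClass a n *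
      indicator (Ioc (Real.log X) (Real.log X + 1)) (1 : ℝ → ℝ) (Real.log n))
      (psi (Real.exp 1 * X) q a - psi X q a) := by
  have hX0 : 0 < X := by linarith
  have he : X ≤ Real.exp 1 * X := le_mul_of_one_le_left hX0.le (Real.one_le_exp zero_le_one)
  have hmem : ∀ n : ℕ, n ≠ 0 → (Real.log n ∈ Ioc (Real.log X) (Real.log X + 1) ↔
      n ∈ Finset.Ioc ⌊X⌋₊ ⌊Real.exp 1 * X⌋₊) := by
    intro n hn
    have hn0 : (0 : ℝ) < n := by exact_mod_cast Nat.pos_of_ne_zero hn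
    have h1 : Real.log X + 1 = Real.log (Real.exp 1 * X) := by
      rw [Real.log_mul (Real.exp_ne_zero _) hX0.ne', Real.log_exp, add_comm]
    rw [mem_Ioc, Finset.mem_Ioc, Nat.floor_lt hX0.le, Nat.le_floor_iff (by positivity), h1,
      Real.log_lt_log_iff hX0 hn0, Real.log_le_log_iff hn0 (by positivity)]
  have hval : psi (Real.exp 1 * X) q a - psi X q a = ∑ n ∈ Finset.Ioc ⌊X⌋₊ ⌊Real.exp 1 * X⌋₊,
      residueClass a n * indicator (Ioc (Real.log X) (Real.log X + 1)) (1 : ℝ → ℝ) (Real.log n) := by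
    rw [psi_eq_sum_residueClass, psi_eq_sum_residueClass, ← Finset.sum_Ioc_consecutive _
      (Nat.zero_le ⌊X⌋₊) (Nat.floor_mono he), add_sub_cancel_left]
    refine Finset.sum_congr rfl fun n hn => ?_
    have hn0 : n ≠ 0 := by have := (Finset.mem_Ioc.mp hn).1; omega
    rw [indicator_of_mem ((hmem n hn0).mpr hn)]; simp
  rw [hval]
  refine hasSum_sum_of_ne_finset_zero fun n hn => ?_
  rcases eq_or_ne n 0 with rfl | hn0
  · simp
  · rw [indicator_of_notMem (fun h => hn ((hmem n hn0).mp h)), mul_zero]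

/-- Removing the smoothing on the prime side costs `O(δ (log X)² X / q + log X)`. -/
theorem abs_tsum_residueClass_mul_windowKernel_sub_le (a : ZMod q) {δ X : ℝ} (hδ : 0 < δ)
    (hX : 3 ≤ X) (hδX : 8 * δ * (Real.log X + 1) ≤ 1) :
    |(∑' n : ℕ, residueClass a n * windowKernel δ (Real.log X) (Real.log n)) -
      (psi (Real.exp 1 * X) q a - psi X q a)| ≤
      (4000 + 8 * ∑' n : ℕ, 1 / (n : ℝ) ^ 3) *
        (δ * Real.log X ^ 2 * X / q + Real.log X) := by
  set L := Real.log X with hL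
  have hX0 : 0 < X := by linarith
  have hL1 : 1 ≤ L := by
    rw [hL, Real.le_log_iff_exp_le hX0]; have := Real.exp_one_lt_d9; linarith
  have hXL : Real.exp L = X := Real.exp_log hX0
  have hδ8 : δ ≤ 1 / 8 := by nlinarith
  have hq : (0 : ℝ) < q := by exact_mod_cast Nat.pos_of_neZero q
  have hind := hasSum_residueClass_mul_indicator a (by linarith : 1 ≤ X)
  have hk := summable_residueClass_mul_windowKernel a hδ (by linarith : δ ≤ 1) L
  obtain ⟨hs1, ht1⟩ := summable_and_tsum_residueClass_mul_exp_le a hδ hδ8 (by linarith : 0 ≤ L)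
    (by nlinarith)
  obtain ⟨hs2, ht2⟩ := summable_and_tsum_residueClass_mul_exp_le a hδ hδ8
    (by linarith : 0 ≤ L + 1) hδX
  set Z := ∑' n : ℕ, 1 / (n : ℝ) ^ 3
  have hZ : 0 ≤ Z := tsum_nonneg fun n => by positivity
  rw [← hind.tsum_eq, ← hk.tsum_sub hind.summable, ← Real.norm_eq_abs]
  refine (tsum_of_norm_bounded ((hs1.hasSum.add hs2.hasSum).mul_left 4) fun n => ?_).trans ?_
  · rw [← mul_sub, norm_mul, Real.norm_of_nonneg (residueClass_nonneg a n), Real.norm_eq_abs]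
    calc _ ≤ residueClass a n * (4 * (Real.exp (-|Real.log n - L| / δ) +
          Real.exp (-|Real.log n - (L + 1)| / δ))) :=
          mul_le_mul_of_nonneg_left (abs_windowKernel_sub_indicator_le hδ L _)
            (residueClass_nonneg a n)
      _ = _ := by ring
  · rw [Real.exp_add, hXL] at ht2
    rw [hXL] at ht1
    set D := δ * X / q with hD
    have hD0 : 0 ≤ D := by positivity
    have e1 : (L + 1) * (24 * δ * L * X / q + 2) ≤ 2 * L * (24 * L * D + 2) := by
      rw [show 24 * δ * L * X / q = 24 * L * D by rw [hD]; ring]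
      gcongr; linarith
    have e2 : (L + 1 + 1) * (24 * δ * (L + 1) * (X * Real.exp 1) / q + 2) ≤
        3 * L * (24 * (2 * L) * 3 * D + 2) := by
      rw [show 24 * δ * (L + 1) * (X * Real.exp 1) / q = 24 * (L + 1) * Real.exp 1 * D by
        rw [hD]; ring]
      have h3 : Real.exp 1 ≤ 3 := by have := Real.exp_one_lt_d9; linarith
      gcongr <;> linarith
    have e3 : δ * L ^ 2 * X / q = L ^ 2 * D := by rw [hD]; ring
    rw [e3]
    have e4 : Z ≤ Z * L := le_mul_of_one_le_right hZ hL1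
    have e5 : 0 ≤ Z * (L ^ 2 * D) := by positivity
    have e6 : 0 ≤ L ^ 2 * D := by positivity
    nlinarith

end Primes

/-- The explicit formula for a sharp window `(X, eX]`: the first term of the error comes from the
zeros, the second from the removal of the smoothing, the third from the shifted contour. -/
theorem exists_abs_psi_sub_le (hGRH : GRH) {c : ℝ} (hc : 0 < c) (hc' : c ≤ 1 / 16) :
    ∃ K X₀ : ℝ, 0 < K ∧ 3 ≤ X₀ ∧ ∀ X : ℝ, X₀ ≤ X → ∀ (q : ℕ) [NeZero q], (q : ℝ) ≤ X →
      ∀ (a : (ZMod q)ˣ) (T δ A : ℝ), 4 ≤ T → T ≤ X → 0 < δ → 8 * δ * (Real.log X + 1) ≤ 1 →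
        0 < A → ‖F q a X T‖ ≤ A →
        |psi (Real.exp 1 * X) q a - psi X q a - (Real.exp 1 - 1) * X / q.totient| ≤
          K * (√(A * X) / q.totient + δ * Real.log X ^ 2 * X / q.totient +
            Real.log X * T / δ * (X ^ (4 * c) +
              X ^ 2 * Real.exp (-(δ ^ 2 * (T - 4) ^ 2 / 4)))) := by
  obtain ⟨K, X₀, hK, hX₀, hmain⟩ := exists_window_explicit_formula hGRH hc hc'
  set M := 4000 + 8 * ∑' n : ℕ, 1 / (n : ℝ) ^ 3 with hM
  have hM0 : 4000 ≤ M := by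
    have : 0 ≤ ∑' n : ℕ, 1 / (n : ℝ) ^ 3 := tsum_nonneg fun n => by positivity
    linarith
  refine ⟨K + (2 * Real.exp 6 + 64) + M, X₀, by positivity, hX₀, ?_⟩
  intro X hX q _ hqX a T δ A hT4 hTX hδ hδX hA0 hA
  have hX3 : 3 ≤ X := hX₀.trans hX
  have hX0 : 0 < X := by linarith
  have hL1 : 1 ≤ Real.log X := by
    rw [Real.le_log_iff_exp_le hX0]; have := Real.exp_one_lt_d9; linarith
  have hδ8 : δ ≤ 1 / 8 := by nlinarith
  have h1 := hmain X hX q hqX a T δ hT4 hTX hδ (by linarith)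
  have h2 := norm_integral_mainDensity_sub_le a (by linarith : 1 ≤ X) hδ (by linarith) hA0 hA
  have h3 := abs_tsum_residueClass_mul_windowKernel_sub_le (a : ZMod q) hδ hX3 hδX
  set P := ∑' n : ℕ, residueClass (a : ZMod q) n * windowKernel δ (Real.log X) (Real.log n)
  set I₀ := ∫ r in Ioi (0 : ℝ), mainDensity a T r * windowKernel δ (Real.log X) r
  set Y := psi (Real.exp 1 * X) q a - psi X q a
  set R := (Real.exp 1 - 1) * X / q.totient with hR
  set L := Real.log X
  have h4 : |P - R| ≤ ‖(P : ℂ) - I₀‖ + ‖I₀ - (R : ℂ)‖ := by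
    rw [← Real.norm_eq_abs, ← norm_real, ofReal_sub]
    exact norm_sub_le_norm_sub_add_norm_sub _ _ _
  have h5 : |Y - R| ≤ |P - Y| + |P - R| := by
    rw [abs_sub_comm P Y]; exact abs_sub_le _ _ _
  have hφ : (0 : ℝ) < q.totient := by exact_mod_cast Nat.totient_pos.mpr (Nat.pos_of_neZero q)
  have hφq : (q.totient : ℝ) ≤ q := by exact_mod_cast Nat.totient_le q
  set V := L * T / δ * (X ^ (4 * c) + X ^ 2 * Real.exp (-(δ ^ 2 * (T - 4) ^ 2 / 4))) with hV
  have hLV : L ≤ V := by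
    have e1 : 1 ≤ X ^ (4 * c) := Real.one_le_rpow (by linarith) (by linarith)
    have e2 : 0 ≤ X ^ 2 * Real.exp (-(δ ^ 2 * (T - 4) ^ 2 / 4)) := by positivity
    have e3 : 1 ≤ T / δ := by rw [le_div_iff₀ hδ]; linarith
    have e4 : L * 1 ≤ L * (T / δ) := by gcongr
    rw [hV, mul_div_assoc]
    calc L ≤ L * (T / δ) * 1 := by linarith
      _ ≤ _ := by gcongr; linarith
  set S := √(A * X) / q.totient
  set D := δ * L ^ 2 * X / q.totient with hD
  have hS0 : 0 ≤ S := by positivity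
  have hD0 : 0 ≤ D := by positivity
  have e1 : δ * L ^ 2 * X / q ≤ D := by rw [hD]; gcongr
  have e2 : (2 * Real.exp 6 * √(A * X) + 64 * δ * X) / q.totient ≤ 2 * Real.exp 6 * S + 64 * D := by
    rw [add_div, mul_div_assoc]
    gcongr
    rw [hD, mul_assoc, mul_div_assoc]
    gcongr
    nlinarith [mul_pos hδ hX0, mul_self_nonneg (L - 1)]
  have e3 : M * (δ * L ^ 2 * X / q + L) ≤ M * (D + V) := by gcongr
  have e4 : K * L * T / δ * (X ^ (4 * c) + X ^ 2 * Real.exp (-(δ ^ 2 * (T - 4) ^ 2 / 4))) =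
      K * V := by rw [hV]; ring
  rw [e4] at h1
  have hV0 : 0 ≤ V := by linarith
  have g1 : 0 ≤ K * (S + D) := by positivity
  have g2 : 0 ≤ 2 * Real.exp 6 * (D + V) := by positivity
  have g3 : 0 ≤ M * S := by positivity
  have g4 : 0 ≤ 64 * (S + V) := by positivity
  calc |Y - R| ≤ M * (D + V) + (K * V + (2 * Real.exp 6 * S + 64 * D)) := by linarith
    _ ≤ _ := by nlinarith

/-! ### A lower bound for the totient -/

section Totient

theorem inv_card_add_one_le_prod (S : Finset ℕ) (hS : ∀ p ∈ S, 2 ≤ p) :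
    ((S.card : ℝ) + 1)⁻¹ ≤ ∏ p ∈ S, (1 - (p : ℝ)⁻¹) := by
  induction S using Finset.induction_on_max with
  | empty => simp
  | insert m S hm ih =>
    have hmS : m ∉ S := fun h => lt_irrefl _ (hm m h)
    have hm2 : 2 ≤ m := hS m (Finset.mem_insert_self _ _)
    have hcard : S.card + 2 ≤ m := by
      have h : S ⊆ Finset.Ico 2 m := fun p hp =>
        Finset.mem_Ico.mpr ⟨hS p (Finset.mem_insert_of_mem hp), hm p hp⟩
      have := Finset.card_le_card h
      rw [Nat.card_Ico] at this; omega
    rw [Finset.prod_insert hmS, Finset.card_insert_of_notMem hmS]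
    have h1 : (1 : ℝ) - ((S.card : ℝ) + 2)⁻¹ ≤ 1 - (m : ℝ)⁻¹ := by
      have : ((S.card : ℝ) + 2) ≤ m := by exact_mod_cast hcard
      gcongr
    have h2 := ih fun p hp => hS p (Finset.mem_insert_of_mem hp)
    have h3 : (0 : ℝ) ≤ 1 - ((S.card : ℝ) + 2)⁻¹ := by
      rw [sub_nonneg]; exact inv_le_one_of_one_le₀ (by linarith [S.card.cast_nonneg (α := ℝ)])
    calc (((S.card + 1 : ℕ) : ℝ) + 1)⁻¹ = (1 - ((S.card : ℝ) + 2)⁻¹) * ((S.card : ℝ) + 1)⁻¹ := by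
          push_cast; field_simp; ring
      _ ≤ _ := mul_le_mul h1 h2 (by positivity) (h3.trans h1)

/-- The `k`-th smallest prime factor of `q` is at least `k + 1`, and there are at most
`log q / log 2` of them, so that `q / φ(q)` is `O(log q)`. -/
theorem inv_totient_le {q : ℕ} (hq : 0 < q) :
    (q.totient : ℝ)⁻¹ ≤ 2 * (Real.log q + 1) * (q : ℝ)⁻¹ := by
  have hq0 : (0 : ℝ) < q := by exact_mod_cast hq
  have hφ : (0 : ℝ) < q.totient := by exact_mod_cast Nat.totient_pos.mpr hq
  set S := q.primeFactors
  have h1 : (q : ℝ) * ((S.card : ℝ) + 1)⁻¹ ≤ q.totient := by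
    have h := inv_card_add_one_le_prod S fun p hp => (Nat.prime_of_mem_primeFactors hp).two_le
    have h' := congrArg (Rat.cast : ℚ → ℝ) (Nat.totient_eq_mul_prod_factors q)
    push_cast at h'
    rw [h']; gcongr
  have h2 : (2 : ℝ) ^ S.card ≤ q := by
    have h3 : 2 ^ S.card ≤ ∏ p ∈ S, p := Finset.pow_card_le_prod _ _ _ fun p hp =>
      (Nat.prime_of_mem_primeFactors hp).two_le
    exact_mod_cast h3.trans (Nat.le_of_dvd hq (Nat.prod_primeFactors_dvd q))
  have h4 : (S.card : ℝ) * Real.log 2 ≤ Real.log q := by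
    rw [← Real.log_pow]; exact Real.log_le_log (by positivity) h2
  have h5 : (S.card : ℝ) + 1 ≤ 2 * (Real.log q + 1) := by
    have := Real.log_two_gt_d9
    nlinarith [(Nat.cast_nonneg S.card : (0 : ℝ) ≤ _)]
  rw [mul_inv_le_iff₀ (by positivity)] at h1
  rw [inv_le_iff_one_le_mul₀ hφ]
  have h6 : (q : ℝ) ≤ 2 * (Real.log q + 1) * q.totient := by
    refine h1.trans ?_
    rw [mul_comm]; gcongr
  calc (1 : ℝ) = q * (q : ℝ)⁻¹ := (mul_inv_cancel₀ hq0.ne').symm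
    _ ≤ 2 * (Real.log q + 1) * q.totient * (q : ℝ)⁻¹ := by gcongr
    _ = _ := by ring

theorem sum_inv_totient_le {Q : ℕ} {y : ℝ} (hy0 : 0 ≤ y) (hy : Real.log Q + 1 ≤ y) :
    ∑ q ∈ Finset.Icc 1 Q, (q.totient : ℝ)⁻¹ ≤ 2 * y ^ 2 := by
  have h1 : ∀ q ∈ Finset.Icc 1 Q, (q.totient : ℝ)⁻¹ ≤ 2 * y * (q : ℝ)⁻¹ := by
    intro q hq
    obtain ⟨hq1, hqQ⟩ := Finset.mem_Icc.mp hq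
    refine (inv_totient_le hq1).trans ?_
    have : Real.log q ≤ Real.log Q :=
      Real.log_le_log (by exact_mod_cast hq1) (by exact_mod_cast hqQ)
    gcongr; linarith
  refine (Finset.sum_le_sum h1).trans ?_
  rw [← Finset.mul_sum]
  have h2 : ∑ q ∈ Finset.Icc 1 Q, (q : ℝ)⁻¹ ≤ 1 + Real.log Q := by
    have h := harmonic_le_one_add_log Q
    rw [harmonic_eq_sum_Icc] at h
    have h' : ((∑ i ∈ Finset.Icc 1 Q, (i : ℚ)⁻¹ : ℚ) : ℝ) = ∑ q ∈ Finset.Icc 1 Q, (q : ℝ)⁻¹ := by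
      push_cast; rfl
    rwa [h'] at h
  calc _ ≤ 2 * y * y := by gcongr; linarith
    _ = _ := by ring

end Totient

/-! ### Adding the windows -/

section Telescoping

theorem abs_le_of_telescoping (f : ℝ → ℝ) {x B : ℝ} (J : ℕ)
    (h : ∀ j < J, |f (Real.exp 1 * (x * Real.exp (-(j + 1 : ℕ)))) -
      f (x * Real.exp (-(j + 1 : ℕ)))| ≤ B) :
    |f x| ≤ |f (x * Real.exp (-(J : ℕ)))| + J * B := by
  induction J with
  | zero => simp
  | succ J ih =>
    have h1 := ih fun j hj => h j (by omega)
    have h2 := h J (by omega)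
    have h3 : Real.exp 1 * (x * Real.exp (-((J + 1 : ℕ) : ℝ))) = x * Real.exp (-(J : ℝ)) := by
      rw [mul_left_comm, ← Real.exp_add]; congr 2; push_cast; ring
    rw [h3] at h2
    have h4 := abs_sub_abs_le_abs_sub (f (x * Real.exp (-(J : ℝ))))
      (f (x * Real.exp (-((J + 1 : ℕ) : ℝ))))
    have h5 : ((J + 1 : ℕ) : ℝ) * B = J * B + B := by push_cast; ring
    linarith

/-- The trivial bound for primes in a residue class. -/
theorem psi_nonneg_and_le {q : ℕ} [NeZero q] (a : ZMod q) {x : ℝ} (hx : 1 ≤ x) :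
    0 ≤ psi x q a ∧ psi x q a ≤ (x / q + 2) * Real.log x := by
  refine ⟨Finset.sum_nonneg fun n _ => ArithmeticFunction.vonMangoldt_nonneg, ?_⟩
  have h1 := card_filter_zmod_eq_le a (le_refl (0 : ℝ)) (by linarith : 0 ≤ x)
  have h2 : Finset.Ioc ⌊(0 : ℝ)⌋₊ ⌊x⌋₊ = Finset.Icc 1 ⌊x⌋₊ := by ext n; simp; omega
  rw [h2, sub_zero] at h1
  have hlog := Real.log_nonneg hx
  calc psi x q a ≤ ∑ n ∈ (Finset.Icc 1 ⌊x⌋₊).filter (fun n : ℕ => (n : ZMod q) = a),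
        Real.log x := by
        refine Finset.sum_le_sum fun n hn => ArithmeticFunction.vonMangoldt_le_log.trans ?_
        obtain ⟨hn1, hnx⟩ := Finset.mem_Icc.mp (Finset.mem_filter.mp hn).1
        exact Real.log_le_log (by exact_mod_cast hn1)
          ((Nat.le_floor_iff (by linarith)).mp hnx)
    _ ≤ _ := by
        rw [Finset.sum_const, nsmul_eq_mul]; gcongr

end Telescoping

section Parameters

/-- The size conditions relating `x` and the auxiliary parameter `y = x^{ε/100}`. -/
theorem eventually_log_add_one_le_rpow {ε : ℝ} (hε : 0 < ε) (B : ℝ) :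
    ∃ x₀ : ℝ, ∀ x : ℝ, x₀ ≤ x → 3 ≤ x ∧ B ≤ √x ∧ 2 ≤ x ^ (ε / 100) ∧
      Real.log x + 1 ≤ x ^ (ε / 100) := by
  have h1 : ∀ᶠ x : ℝ in Filter.atTop, Real.log x ≤ 2⁻¹ * x ^ (ε / 100) := by
    have h := (isLittleO_log_rpow_atTop (show 0 < ε / 100 by positivity)).bound
      (show (0 : ℝ) < 2⁻¹ by norm_num)
    filter_upwards [h, Filter.eventually_ge_atTop 1] with x hx hx1
    rw [Real.norm_of_nonneg (Real.log_nonneg hx1),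
      Real.norm_of_nonneg (Real.rpow_nonneg (by linarith) _)] at hx
    exact hx
  have h2 : ∀ᶠ x : ℝ in Filter.atTop, 2 ≤ x ^ (ε / 100) :=
    (tendsto_rpow_atTop (show 0 < ε / 100 by positivity)).eventually_ge_atTop 2
  have h3 : ∀ᶠ x : ℝ in Filter.atTop, B ≤ √x :=
    Real.tendsto_sqrt_atTop.eventually_ge_atTop B
  obtain ⟨x₀, hx₀⟩ := Filter.eventually_atTop.mp
    (((Filter.eventually_ge_atTop (3 : ℝ)).and h3).and (h2.and h1))
  refine ⟨x₀, fun x hx => ?_⟩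
  obtain ⟨⟨g1, g2⟩, g3, g4⟩ := hx₀ x hx
  exact ⟨g1, g2, g3, by linarith⟩

theorem rpow_div_hundred_pow {x : ℝ} (hx : 0 ≤ x) (ε : ℝ) (n : ℕ) :
    (x ^ (ε / 100)) ^ n = x ^ (ε * n / 100) := by
  rw [← Real.rpow_mul_natCast hx]; congr 1; ring

/-- The error term of `exists_abs_psi_sub_le` with the parameters `T = y^{140}`, `δ = y^{-120}` and
`A = C φ(q) y^{160}`. -/
theorem window_error_le {x y X φ C Y : ℝ} (hφ : 0 < φ) (hC : 0 ≤ C) (hy2 : 2 ≤ y) (hX1 : 1 ≤ X)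
    (hXu : X ≤ x) (hlogX : Real.log X + 1 ≤ y) (hY : Y ≤ y ^ 10) :
    √(C * (φ * y ^ 140 * y ^ 20) * X) / φ + (y ^ 120)⁻¹ * Real.log X ^ 2 * X / φ +
      Real.log X * y ^ 140 / (y ^ 120)⁻¹ * (Y +
        X ^ 2 * Real.exp (-(((y ^ 120)⁻¹) ^ 2 * (y ^ 140 - 4) ^ 2 / 4))) ≤
      (C + 3) * (x / y ^ 110 / φ + y ^ 271) := by
  have hX0 : 0 < X := by linarith
  have hx0 : 0 < x := by linarith
  have hy0 : 0 < y := by linarith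
  have hy1 : 1 ≤ y := by linarith
  have hlogX0 : 0 ≤ Real.log X := Real.log_nonneg hX1
  have hpow2 : ∀ {m n : ℕ}, m ≤ n → (2 : ℝ) ^ m ≤ y ^ n := fun {m n} hmn =>
    (pow_le_pow_left₀ (by norm_num) hy2 m).trans (pow_le_pow_right₀ hy1 hmn)
  have hT8 : 8 ≤ y ^ 140 := by have := hpow2 (show 3 ≤ 140 by norm_num); linarith
  set A := C * (φ * y ^ 140 * y ^ 20) with hA
  have hA0 : 0 ≤ A := by positivity
  -- arithmetic-geometric mean inequality for `√(A X) = √((x / y^110) * (A X y^110 / x))`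
  have e1 : √(A * X) / φ ≤ x / y ^ 110 / φ + C * y ^ 271 := by
    have h1 : √(A * X) ≤ x / y ^ 110 + C * (φ * y ^ 271) := by
      have h2 : A * X ≤ (x / y ^ 110) * (C * (φ * y ^ 271)) := by
        calc A * X ≤ A * x := by gcongr
          _ = (x / y ^ 110) * (C * (φ * y ^ 270)) := by
              rw [hA]; field_simp
          _ ≤ _ := by gcongr; norm_num
      rw [Real.sqrt_le_left (by positivity)]
      have h3 : 0 ≤ x / y ^ 110 := by positivity
      have h4 : 0 ≤ C * (φ * y ^ 271) := by positivity
      nlinarith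
    calc _ ≤ (x / y ^ 110 + C * (φ * y ^ 271)) / φ := by gcongr
      _ = _ := by field_simp
  have e2 : (y ^ 120)⁻¹ * Real.log X ^ 2 * X / φ ≤ x / y ^ 110 / φ := by
    gcongr
    calc _ ≤ (y ^ 120)⁻¹ * y ^ 2 * x := by gcongr; linarith
      _ = x / y ^ 118 := by field_simp
      _ ≤ _ := by gcongr; norm_num
  have e3 : X ^ 2 * Real.exp (-(((y ^ 120)⁻¹) ^ 2 * (y ^ 140 - 4) ^ 2 / 4)) ≤ y ^ 10 := by
    have h1 : y ^ 40 / 16 ≤ ((y ^ 120)⁻¹) ^ 2 * (y ^ 140 - 4) ^ 2 / 4 := by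
      have h2 : (y ^ 140 / 2) ^ 2 ≤ (y ^ 140 - 4) ^ 2 := by gcongr; linarith
      calc y ^ 40 / 16 = ((y ^ 120)⁻¹) ^ 2 * (y ^ 140 / 2) ^ 2 / 4 := by field_simp; norm_num
        _ ≤ _ := by gcongr
    have h3 : 2 * Real.log X ≤ y ^ 40 / 16 := by
      have h4 := hpow2 (show 5 ≤ 39 by norm_num)
      have h5 : 32 * y ≤ y ^ 40 := by
        calc 32 * y ≤ y ^ 39 * y := by gcongr; linarith
          _ = y ^ 40 := by ring
      linarith
    have h6 : X ^ 2 = Real.exp (2 * Real.log X) := by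
      have := Real.exp_nat_mul (Real.log X) 2
      rw [Real.exp_log hX0] at this
      exact_mod_cast this.symm
    rw [h6, ← Real.exp_add]
    refine (Real.exp_le_one_iff.mpr (by linarith)).trans (one_le_pow₀ hy1)
  have e4 : Real.log X * y ^ 140 / (y ^ 120)⁻¹ * (Y +
      X ^ 2 * Real.exp (-(((y ^ 120)⁻¹) ^ 2 * (y ^ 140 - 4) ^ 2 / 4))) ≤ 2 * y ^ 271 := by
    calc _ ≤ Real.log X * y ^ 140 / (y ^ 120)⁻¹ * (y ^ 10 + y ^ 10) := by gcongr
      _ ≤ y * y ^ 140 / (y ^ 120)⁻¹ * (y ^ 10 + y ^ 10) := by gcongr; linarith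
      _ = 2 * y ^ 271 := by field_simp; ring
  set P := x / y ^ 110 / φ
  have hP : 0 ≤ P := by positivity
  have hCP : 0 ≤ C * P := by positivity
  have hY0 : 0 ≤ y ^ 271 := by positivity
  nlinarith

/-- The error term on a window `(X, eX]`, in terms of `y = x^{ε/100}`. The choice `T = y^{140}` and
`δ = y^{-120}` makes `δ T = y^{20}` large, so that the Gaussian factor is negligible, while `T / δ`
remains small enough for `y^{271}`, summed over `q ≤ x / y^{400}`, to stay well below
`x / y^{100}`. -/
theorem exists_abs_psi_window_le (hGRH : GRH) (hPC : PairCorrelationConjecture) {ε : ℝ}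
    (hε : 0 < ε) (hε4 : ε ≤ 1 / 4) :
    ∃ K x₀ : ℝ, 0 < K ∧ ∀ x : ℝ, x₀ ≤ x → ∀ y : ℝ, y = x ^ (ε / 100) →
      3 ≤ x ∧ 2 ≤ y ∧ Real.log x + 1 ≤ y ∧ y ^ 400 ≤ x ∧
      ∀ (q : ℕ) [NeZero q], (q : ℝ) ≤ x / y ^ 400 → ∀ (a : (ZMod q)ˣ) (X : ℝ),
        x / y ^ 150 ≤ X → X ≤ x →
          |psi (Real.exp 1 * X) q a - psi X q a - (Real.exp 1 - 1) * X / q.totient| ≤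
            K * (x / y ^ 110 / q.totient + y ^ 271) := by
  obtain ⟨K, X₀, hK, hX₀, hmain⟩ := exists_abs_psi_sub_le hGRH (c := ε / 40) (by positivity)
    (by linarith)
  obtain ⟨C, x₁, hF⟩ := hPC hGRH (ε / 5) (by positivity)
  obtain ⟨x₀, hx₀⟩ := eventually_log_add_one_le_rpow hε (max X₀ x₁)
  refine ⟨K * (|C| + 1 + 3), x₀, by positivity, ?_⟩
  rintro x hx y rfl
  obtain ⟨hx3, hxB, hy2, hlogy⟩ := hx₀ x hx
  have hx0 : 0 < x := by linarith
  have hpow := rpow_div_hundred_pow hx0.le ε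
  set y := x ^ (ε / 100) with hy
  have hy0 : 0 < y := by linarith
  have hy1 : 1 ≤ y := by linarith
  have hy400 : y ^ 400 ≤ x := by
    rw [hpow]
    calc _ ≤ x ^ (1 : ℝ) := Real.rpow_le_rpow_of_exponent_le (by linarith)
          (by push_cast; linarith)
      _ = x := Real.rpow_one x
  refine ⟨hx3, hy2, hlogy, hy400, ?_⟩
  intro q _ hq a X hXl hXu
  have hφ : (0 : ℝ) < q.totient := by exact_mod_cast Nat.totient_pos.mpr (Nat.pos_of_neZero q)
  have hXy : y ^ 250 ≤ X := by
    refine le_trans ?_ hXl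
    rw [le_div_iff₀ (by positivity), ← pow_add]; exact hy400
  have hX1 : 1 ≤ X := (one_le_pow₀ hy1).trans hXy
  have hX0 : 0 < X := by linarith
  have hXs : √x ≤ X := by
    refine le_trans ?_ hXl
    rw [Real.sqrt_le_left (by positivity), div_pow, ← pow_mul, le_div_iff₀ (by positivity), sq]
    gcongr
    exact (pow_le_pow_right₀ hy1 (by norm_num)).trans hy400
  have hqX : (q : ℝ) * y ^ 250 ≤ X := by
    refine le_trans ?_ hXl
    rw [le_div_iff₀ (by positivity), mul_assoc, ← pow_add]
    exact (le_div_iff₀ (by positivity)).mp hq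
  have hXη : X ^ (ε / 5) ≤ y ^ 20 := by
    rw [hpow]
    refine (Real.rpow_le_rpow hX0.le hXu (by positivity)).trans (le_of_eq ?_)
    congr 1; push_cast; ring
  have hXc : X ^ (4 * (ε / 40)) ≤ y ^ 10 := by
    rw [hpow]
    refine (Real.rpow_le_rpow hX0.le hXu (by positivity)).trans (le_of_eq ?_)
    congr 1; push_cast; ring
  have hlogX : Real.log X + 1 ≤ y := by have := Real.log_le_log hX0 hXu; linarith
  have hlogX0 : 0 ≤ Real.log X := Real.log_nonneg hX1
  -- the pair correlation conjecture at `X`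
  have hFX := hF X ((le_max_right _ _).trans (hxB.trans hXs)) q a (y ^ 140)
    (by
      rw [Real.rpow_sub hX0, Real.rpow_one, le_div_iff₀ (by positivity)]
      refine le_trans ?_ hqX
      gcongr
      exact hXη.trans (pow_le_pow_right₀ hy1 (by norm_num)))
    (hXη.trans (pow_le_pow_right₀ hy1 (by norm_num)))
    ((pow_lt_pow_right₀ (by linarith) (by norm_num)).trans_le hXy)
  set A := (|C| + 1) * (q.totient * y ^ 140 * y ^ 20) with hA
  have hA0 : 0 < A := by positivity
  have hFA : ‖F q a X (y ^ 140)‖ ≤ A := by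
    refine hFX.trans ?_
    have hC : C ≤ |C| + 1 := by have := le_abs_self C; linarith
    rw [hA]
    exact mul_le_mul hC (by gcongr) (by positivity) (by positivity)
  have hpow2 : ∀ {m n : ℕ}, m ≤ n → (2 : ℝ) ^ m ≤ y ^ n := fun {m n} hmn =>
    (pow_le_pow_left₀ (by norm_num) hy2 m).trans (pow_le_pow_right₀ hy1 hmn)
  have hT4 : 4 ≤ y ^ 140 := by have := hpow2 (show 2 ≤ 140 by norm_num); linarith
  have hδ : 8 * (y ^ 120)⁻¹ * (Real.log X + 1) ≤ 1 := by
    have h1 : 8 * y ≤ y ^ 120 := by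
      have h2 := hpow2 (show 3 ≤ 119 by norm_num)
      calc 8 * y ≤ y ^ 119 * y := by gcongr; linarith
        _ = y ^ 120 := by ring
    calc _ ≤ 8 * (y ^ 120)⁻¹ * y := by gcongr
      _ = 8 * y / y ^ 120 := by ring
      _ ≤ 1 := (div_le_one (by positivity)).mpr h1
  have hres := hmain X ((le_max_left _ _).trans (hxB.trans hXs)) q
    ((le_mul_of_one_le_right (by positivity) (one_le_pow₀ hy1)).trans hqX) a (y ^ 140)
    (y ^ 120)⁻¹ A hT4 ((pow_le_pow_right₀ hy1 (by norm_num)).trans hXy)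
    (by positivity) hδ hA0 hFA
  refine hres.trans ?_
  rw [mul_assoc K]
  refine mul_le_mul_of_nonneg_left ?_ hK.le
  exact window_error_le hφ (by positivity : 0 ≤ |C| + 1) hy2 hX1 hXu hlogX hXc

/-- Summing the bound for the windows `(x e^{-j-1}, x e^{-j}]`. -/
theorem exists_abs_psi_sub_div_totient_le (hGRH : GRH) (hPC : PairCorrelationConjecture) {ε : ℝ}
    (hε : 0 < ε) (hε4 : ε ≤ 1 / 4) :
    ∃ K x₀ : ℝ, 0 < K ∧ ∀ x : ℝ, x₀ ≤ x → ∀ y : ℝ, y = x ^ (ε / 100) →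
      3 ≤ x ∧ 2 ≤ y ∧ Real.log x + 1 ≤ y ∧ y ^ 400 ≤ x ∧
      ∀ (q : ℕ) [NeZero q], (q : ℝ) ≤ x / y ^ 400 → ∀ a : (ZMod q)ˣ,
          |psi x q a - x / q.totient| ≤ K * (x / y ^ 109 / q.totient + y ^ 272) := by
  obtain ⟨K, x₀, hK, hmain⟩ := exists_abs_psi_window_le hGRH hPC hε hε4
  refine ⟨K + 6, x₀, by positivity, ?_⟩
  intro x hx y hy
  obtain ⟨hx3, hy2, hlogy, hy400, hwin⟩ := hmain x hx y hy
  refine ⟨hx3, hy2, hlogy, hy400, ?_⟩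
  intro q _ hq a
  have hx0 : 0 < x := by linarith
  have hy0 : 0 < y := by linarith
  have hy1 : 1 ≤ y := by linarith
  have hφ : (0 : ℝ) < q.totient := by exact_mod_cast Nat.totient_pos.mpr (Nat.pos_of_neZero q)
  have hφq : (q.totient : ℝ) ≤ q := by exact_mod_cast Nat.totient_le q
  have hly0 : 0 ≤ Real.log (y ^ 150) := Real.log_nonneg (one_le_pow₀ hy1)
  set J := ⌊Real.log (y ^ 150)⌋₊ with hJ
  have hJ1 : (J : ℝ) ≤ Real.log (y ^ 150) := Nat.floor_le hly0
  have hJ2 : Real.log (y ^ 150) < J + 1 := Nat.lt_floor_add_one _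
  have hJy : (J : ℝ) ≤ y := by
    have h1 : Real.log (y ^ 150) ≤ Real.log x := Real.log_le_log (by positivity)
      ((pow_le_pow_right₀ hy1 (by norm_num)).trans hy400)
    linarith
  have hexp : Real.exp (-Real.log (y ^ 150)) = (y ^ 150)⁻¹ := by
    rw [Real.exp_neg, Real.exp_log (by positivity)]
  set B := K * (x / y ^ 110 / q.totient + y ^ 271) with hB
  have htel := abs_le_of_telescoping (fun X => psi X q a - X / q.totient) (x := x) (B := B) J
    (fun j hj => by
      have hj' : ((j + 1 : ℕ) : ℝ) ≤ J := by exact_mod_cast hj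
      have h := hwin q hq a (x * Real.exp (-(j + 1 : ℕ))) (by
          rw [div_eq_mul_inv, ← hexp]
          gcongr
          linarith)
        (mul_le_of_le_one_right hx0.le
          (Real.exp_le_one_iff.mpr (neg_nonpos.mpr (Nat.cast_nonneg _))))
      refine le_trans (le_of_eq ?_) h
      congr 1; ring)
  refine htel.trans ?_
  set X := x * Real.exp (-(J : ℕ)) with hX
  have hXl : 1 ≤ X := by
    calc (1 : ℝ) ≤ x * (y ^ 150)⁻¹ := by
          rw [← div_eq_mul_inv, one_le_div (by positivity)]
          exact (pow_le_pow_right₀ hy1 (by norm_num)).trans hy400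
      _ ≤ X := by rw [← hexp, hX]; gcongr
  have hXu : X ≤ 3 * (x / y ^ 150) := by
    have h1 : Real.exp (-(J : ℝ)) ≤ Real.exp 1 * (y ^ 150)⁻¹ := by
      rw [← hexp, ← Real.exp_add]; exact Real.exp_le_exp.mpr (by linarith)
    have h2 : Real.exp 1 ≤ 3 := by have := Real.exp_one_lt_d9; linarith
    calc X ≤ x * (3 * (y ^ 150)⁻¹) := by rw [hX]; gcongr; exact h1.trans (by gcongr)
      _ = _ := by ring
  have hXx : X ≤ x := mul_le_of_le_one_right hx0.le (Real.exp_le_one_iff.mpr (by simp))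
  obtain ⟨hp0, hp1⟩ := psi_nonneg_and_le (a : ZMod q) hXl
  have hlogX : Real.log X ≤ y := by
    have := Real.log_le_log (by linarith) hXx; linarith
  set P := x / y ^ 109 / q.totient with hP
  have hXP : X / q.totient * y ≤ 3 * P := by
    calc _ ≤ 3 * (x / y ^ 150) / q.totient * y := by gcongr
      _ = 3 * (x / y ^ 149 / q.totient) := by field_simp
      _ ≤ _ := by rw [hP]; gcongr; norm_num
  have hp2 : psi X q a ≤ 3 * P + 2 * y ^ 272 := by
    calc _ ≤ (X / q.totient + 2) * y := by
          refine hp1.trans (mul_le_mul (by gcongr) hlogX (Real.log_nonneg hXl) (by positivity))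
      _ = X / q.totient * y + 2 * y ^ 1 := by ring
      _ ≤ 3 * P + 2 * y ^ 272 := by gcongr; norm_num
  have hp3 : X / q.totient ≤ 3 * P := (le_mul_of_one_le_right (by positivity) hy1).trans hXP
  have hp4 : 0 ≤ X / q.totient := by positivity
  have hJB : J * B ≤ K * (P + y ^ 272) := by
    calc J * B ≤ y * B := by gcongr
      _ = K * (P + y ^ 272) := by rw [hB, hP]; field_simp
  have hY : 0 ≤ y ^ 272 := by positivity
  have hP0 : 0 ≤ P := by positivity
  have h0 : |psi X q a - X / q.totient| ≤ 6 * (P + y ^ 272) := by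
    rw [abs_le]; constructor <;> linarith
  calc _ ≤ 6 * (P + y ^ 272) + K * (P + y ^ 272) := add_le_add h0 hJB
    _ = _ := by ring

end Parameters

end PairCorrelation

theorem mainTheorem2 (hGRH : PairCorrelation.GRH)
    (hPC : PairCorrelation.PairCorrelationConjecture) (ε : ℝ) (hε : 0 < ε) :
    ∃ C x₀ : ℝ, ∀ x : ℝ, x₀ ≤ x →
      ∑ q ∈ Finset.Icc 1 ⌊x ^ (1 - 4 * ε)⌋₊, PairCorrelation.maxError x q ≤ C * x ^ (1 - ε) := by
  rcases lt_or_ge (1 / 4) ε with hε4 | hε4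
  · -- there is no modulus `q ≤ x^{1-4ε}` as soon as `x > 1`
    refine ⟨0, 2, fun x hx => ?_⟩
    have h1 : x ^ (1 - 4 * ε) < 1 :=
      Real.rpow_lt_one_of_one_lt_of_neg (by linarith) (by linarith)
    rw [Nat.floor_eq_zero.mpr h1]
    simp
  obtain ⟨K, x₀, hK, hmain⟩ := PairCorrelation.exists_abs_psi_sub_div_totient_le hGRH hPC hε hε4
  refine ⟨3 * K, x₀, fun x hx => ?_⟩
  obtain ⟨hx3, hy2, hlogy, -, hq⟩ := hmain x hx _ rfl
  have hx0 : 0 < x := by linarith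
  have hpow := PairCorrelation.rpow_div_hundred_pow hx0.le ε
  set y := x ^ (ε / 100) with hy
  have hy0 : 0 < y := by linarith
  have hy1 : 1 ≤ y := by linarith
  have hQ : x ^ (1 - 4 * ε) = x / y ^ 400 := by
    rw [hpow, Real.rpow_sub hx0, Real.rpow_one]; congr 2; push_cast; ring
  have hQ' : x ^ (1 - ε) = x / y ^ 100 := by
    rw [hpow, Real.rpow_sub hx0, Real.rpow_one]; congr 2; push_cast; ring
  rw [hQ, hQ']
  set N := ⌊x / y ^ 400⌋₊ with hN
  have hNx : (N : ℝ) ≤ x / y ^ 400 := Nat.floor_le (by positivity)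
  have hterm : ∀ q ∈ Finset.Icc 1 N, PairCorrelation.maxError x q ≤
      K * (x / y ^ 109 * (q.totient : ℝ)⁻¹ + y ^ 272) := by
    intro q hqN
    obtain ⟨hq1, hqN⟩ := Finset.mem_Icc.mp hqN
    have : NeZero q := ⟨by omega⟩
    have hqx : (q : ℝ) ≤ x / y ^ 400 := le_trans (by exact_mod_cast hqN) hNx
    exact ciSup_le fun a => by
      rw [← div_eq_mul_inv]; exact hq q hqx a
  refine (Finset.sum_le_sum hterm).trans ?_
  rw [← Finset.mul_sum, Finset.sum_add_distrib, ← Finset.mul_sum, Finset.sum_const, Nat.card_Icc,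
    Nat.add_sub_cancel, nsmul_eq_mul]
  have hlogN : Real.log N + 1 ≤ y := by
    rcases Nat.eq_zero_or_pos N with h0 | h0
    · rw [h0]; simp; linarith
    · have : (N : ℝ) ≤ x := hNx.trans (div_le_self hx0.le (one_le_pow₀ hy1))
      have := Real.log_le_log (by exact_mod_cast h0) this
      linarith
  have h1 : x / y ^ 109 * ∑ q ∈ Finset.Icc 1 N, (q.totient : ℝ)⁻¹ ≤ 2 * (x / y ^ 100) := by
    calc _ ≤ x / y ^ 109 * (2 * y ^ 2) := by
          gcongr; exact PairCorrelation.sum_inv_totient_le hy0.le hlogN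
      _ = 2 * (x / y ^ 107) := by field_simp
      _ ≤ _ := by gcongr; norm_num
  have h2 : N * y ^ 272 ≤ x / y ^ 100 := by
    calc _ ≤ x / y ^ 400 * y ^ 272 := by gcongr
      _ = x / y ^ 128 := by field_simp
      _ ≤ _ := by gcongr; norm_num
  calc _ ≤ K * (2 * (x / y ^ 100) + x / y ^ 100) := by gcongr
    _ = _ := by ring
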